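/- **Setting.** Let $(\Omega,\mathcal F,\mathbb P)$ be a probability space carrying a one-dimensional purely jumping Lévy process $(z(t))_{t\ge 0}$ (with $z(0)=0$ a.s., independent and stationary increments, a.s. càdlàg paths) with Lévy measure $\nu$, i.e. $\nu(\{0\})=0$, $\int \min(1,y^2)\,\nu(dy)<\infty$ and $$\mathbb E e^{i\xi z(t)}=e^{t\psi(\xi)},\qquad \psi(\xi)=\int_{\mathbb R\setminus\{0\}}\bigl(e^{i\xi y}-1-i\xi y\,1_{\{|y|\le 1\}}\bigr)\,\nu(dy).$$ Let $\lambda_1,\lambda_2>0$, let $A=\mathrm{diag}\{-\lambda_1,-\lambda_2\}$, and let $F:\mathbb R^2\to\mathbb R^2$ be bounded and Lipschitz. For $x\in\mathbb R^2$ let $(X^x(t))_{t\ge0}$ be the càdlàg solution of $$dX(t)=[AX(t)+F(X(t))]\,dt+dZ_t,\qquad Z_t=[z(t),0]^T,\qquad X(0)=x,$$ all solutions being driven by the same $z$. Fix $K>0$ with $\gamma_K:=\nu(\Gamma_K)>0$, where $\Gamma_K=(-\infty,-K]\cup[K,\infty)$, put $\nu_K=\gamma_K^{-1}\nu|_{\Gamma_K}$,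 and let $\eta$ denote a random variable with law $\nu_K$. Fix $T>0$ and let $$\tau_0=0,\qquad \tau_k=\inf\{t>\tau_{k-1}+T:\ |\Delta z(t)|\ge K\}\quad(k\ge1),\qquad \Delta z(t)=z(t)-z(t-).$$ A *maximal coupling* of two probability measures $\mu_1,\mu_2$ on $\mathbb R$ is a probability measure on $\mathbb R\times\mathbb R$ with marginals $\mu_1,\mu_2$ which gives the set $\{(u,v):u\ne v\}$ the mass $\sup_{B}|\mu_1(B)-\mu_2(B)|$, the supremum being over Borel sets $B$. **Proposition 3.2.** There is a probability kernel $(a,b)\mapsto Q_{(a,b)}$ from $\mathbb R^2$ to $\mathbb R^2$ such that, for all $a,b\in\mathbb R$, $Q_{(a,b)}$ is a maximal coupling of the laws of $a+\eta$ and $b+\eta$. Let $Q$ be any such kernel. For $\hat x,\hat y\in\mathbb R^2$ let $P^{(2)}_{(\hat x,\hat y)}$ be the law of $\bigl([\xi_x,\hat x_2]^T,[\xi_y,\hat y_2]^T\bigr)$, where $(\xi_x,\xi_y)$ has law $Q_{(\hat x_1,\hat y_1)}$; for $x,y\in\mathbb R^2$ let $P^{(1)}_{(x,y)}$ be the law of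 $(X^x(\tau_1-),X^y(\tau_1-))$, and set $$P_{(x,y)}(A)=\int_{\mathbb R^2\times\mathbb R^2}P^{(2)}_{(\hat x,\hat y)}(A)\,P^{(1)}_{(x,y)}(d\hat x,d\hat y),\qquad A\in\mathcal B(\mathbb R^2\times\mathbb R^2).$$ Then $(P_{(x,y)})_{(x,y)\in\mathbb R^2\times\mathbb R^2}$ is a Markov transition kernel on $\mathbb R^2\times\mathbb R^2$, and there is a probability space $(\tilde\Omega,\tilde{\mathcal F},\tilde{\mathbb P})$ carrying, for every $(x,y)\in\mathbb R^2\times\mathbb R^2$, a Markov chain $S(k)=(S^x(k),S^y(k))$, $k\ge0$, in $\mathbb R^2\times\mathbb R^2$ with initial state $(x,y)$ and transition kernel $(P_{(x,y)})$, such that the process $(S^x(k))_{k\ge0}$ has the same distribution as $(X^x(\tau_k))_{k\ge0}$ and the process $(S^y(k))_{k\ge0}$ has the same distribution as $(X^y(\tau_k))_{k\ge0}$. -/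

import Mathlib

open MeasureTheory ProbabilityTheory Filter Topology
open scoped NNReal ENNReal

namespace DegenerateLevy

noncomputable section

/-- The state space `ℝ²` with its Euclidean norm. -/
abbrev Plane : Type := EuclideanSpace ℝ (Fin 2)

/-- A path indexed by `[0, ∞)` is càdlàg: right-continuous with left limits. -/
def IsCadlag {E : Type*} [TopologicalSpace E] (f : ℝ≥0 → E) : Prop :=
  ∀ t : ℝ≥0, ContinuousWithinAt f (Set.Ici t) t ∧ ∃ l : E, Tendsto f (𝓝[<] t) (𝓝 l)

/-- A Lévy measure on `ℝ`. -/
structure IsLevyMeasure (ν : Measure ℝ) : Prop where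
  zero : ν {0} = 0
  finite : ∫⁻ y, ENNReal.ofReal (min 1 (y ^ 2)) ∂ν < ⊤

/-- The symbol `ψ(ξ) = ∫_{ℝ∖{0}} (e^{iξy} - 1 - iξy 1_{|y| ≤ 1}) ν(dy)`. -/
def levySymbol (ν : Measure ℝ) (ξ : ℝ) : ℂ :=
  ∫ y in ({0}ᶜ : Set ℝ),
    (Complex.exp (Complex.I * ξ * y) - 1 -
      Complex.I * ξ * y * (Set.Icc (-1 : ℝ) 1).indicator (fun _ => (1 : ℂ)) y) ∂ν

/-- `z` is a one-dimensional purely jumping Lévy process with Lévy measure `ν`: it starts at `0`,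
has independent and stationary increments, almost surely càdlàg paths, and characteristic
function `E e^{iξ z(t)} = e^{tψ(ξ)}`. -/
structure IsPureJumpLevyProcess {Ω : Type*} [MeasurableSpace Ω] (P : Measure Ω)
    (ν : Measure ℝ) (z : ℝ≥0 → Ω → ℝ) : Prop where
  measurable : ∀ t, Measurable (z t)
  zero : ∀ᵐ ω ∂P, z 0 ω = 0
  cadlag : ∀ᵐ ω ∂P, IsCadlag (fun t => z t ω)
  indep : HasIndepIncrements z P
  stationary : ∀ s t : ℝ≥0, IdentDistrib (fun ω => z (s + t) ω - z s ω) (z t) P P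
  char_eq : ∀ (t : ℝ≥0) (ξ : ℝ),
    ∫ ω, Complex.exp (Complex.I * ξ * z t ω) ∂P = Complex.exp ((t : ℝ) * levySymbol ν ξ)

/-- The set `Γ_K = (-∞, -K] ∪ [K, ∞)` of big jumps. -/
def bigJumps (K : ℝ) : Set ℝ := Set.Iic (-K) ∪ Set.Ici K

/-- The law `ν_K = ν|_{Γ_K} / ν(Γ_K)` of a big jump. -/
def bigJumpLaw (ν : Measure ℝ) (K : ℝ) : Measure ℝ :=
  (ν (bigJumps K))⁻¹ • ν.restrict (bigJumps K)

/-- The jump `Δf(t) = f(t) - f(t-)` of a path; it is `0` at `t = 0`. -/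
def jump (f : ℝ≥0 → ℝ) (t : ℝ≥0) : ℝ := f t - Function.leftLim f t

/-- The sampling times of a path: `τ_0 = 0` and
`τ_k = inf {t > τ_{k-1} + T : |Δf(t)| ≥ K}`. -/
def samplingTime (T : ℝ≥0) (K : ℝ) (f : ℝ≥0 → ℝ) : ℕ → ℝ≥0
  | 0 => 0
  | k + 1 => sInf {t : ℝ≥0 | samplingTime T K f k + T < t ∧ K ≤ |jump f t|}

/-- The drift `A v + F(v)` with `A = diag(-lam1, -lam2)`. -/
def drift (lam1 lam2 : ℝ) (F : Plane → Plane) (v : Plane) : Plane :=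
  !₂[-lam1 * v 0, -lam2 * v 1] + F v

/-- `X` is a solution, started at `x`, of `dX = [A X + F(X)] dt + dZ` with `Z = (z, 0)`: a process
with almost surely càdlàg paths which almost surely satisfies the integrated equation for
all times. -/
structure IsSolution {Ω : Type*} [MeasurableSpace Ω] (P : Measure Ω) (lam1 lam2 : ℝ)
    (F : Plane → Plane) (z : ℝ≥0 → Ω → ℝ) (x : Plane) (X : ℝ≥0 → Ω → Plane) : Prop where
  measurable : ∀ t, Measurable (X t)
  cadlag : ∀ᵐ ω ∂P, IsCadlag (fun t => X t ω)
  eqn : ∀ᵐ ω ∂P, ∀ t : ℝ≥0,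
    X t ω = x + (∫ s in (0 : ℝ)..t, drift lam1 lam2 F (X s.toNNReal ω)) + !₂[z t ω, 0]

/-- The total variation distance `sup_A |μ₁(A) - μ₂(A)|` of two probability measures. -/
def tvDist {α : Type*} [MeasurableSpace α] (μ₁ μ₂ : Measure α) : ℝ :=
  ⨆ A : {A : Set α // MeasurableSet A}, |μ₁.real A - μ₂.real A|

/-- `π` is (the joint law of) a maximal coupling of `μ₁` and `μ₂`: a coupling under which the two
components differ with probability equal to the total variation distance. -/
structure IsMaximalCoupling {α : Type*} [MeasurableSpace α] (μ₁ μ₂ : Measure α)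
    (π : Measure (α × α)) : Prop where
  fst : π.map Prod.fst = μ₁
  snd : π.map Prod.snd = μ₂
  diff : π.real {p | p.1 ≠ p.2} = tvDist μ₁ μ₂

/-- `Q` is a measurable choice, for all `a b : ℝ`, of a maximal coupling of the laws of `a + η`
and `b + η`, where `η` has law `ρ`. -/
def IsMaximalCouplingKernel (ρ : Measure ℝ) (Q : Kernel (ℝ × ℝ) (ℝ × ℝ)) : Prop :=
  ∀ a b : ℝ,
    IsMaximalCoupling (ρ.map (fun η => a + η)) (ρ.map (fun η => b + η)) (Q (a, b))

/-- The joint law of `(X^x(τ_1-), X^y(τ_1-))`, both solutions being driven by the same noise. -/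
def preJumpLaw {Ω : Type*} [MeasurableSpace Ω] (P : Measure Ω) (T : ℝ≥0) (K : ℝ)
    (z : ℝ≥0 → Ω → ℝ) (X : Plane → ℝ≥0 → Ω → Plane) (x y : Plane) : Measure (Plane × Plane) :=
  P.map (fun ω =>
    (Function.leftLim (fun t => X x t ω) (samplingTime T K (fun t => z t ω) 1),
     Function.leftLim (fun t => X y t ω) (samplingTime T K (fun t => z t ω) 1)))

/-- The law of `((ξ_x, x̂₂), (ξ_y, ŷ₂))`, where `(ξ_x, ξ_y)` has the law `Q (x̂₁, ŷ₁)`: the first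
coordinates are coupled through `Q`, the second ones do not move. -/
def coupledJumpLaw (Q : Kernel (ℝ × ℝ) (ℝ × ℝ)) (p : Plane × Plane) : Measure (Plane × Plane) :=
  (Q (p.1 0, p.2 0)).map
    (fun u => ((!₂[u.1, p.1 1] : Plane), (!₂[u.2, p.2 1] : Plane)))

/-- `S` is a Markov chain with transition kernel `κ`: given the whole history
`S 0, …, S k`, the conditional law of `S (k + 1)` is `κ (S k)`. -/
structure IsMarkovChain {Ω α : Type*} [MeasurableSpace Ω] [MeasurableSpace α] (P : Measure Ω)
    (κ : Kernel α α) (S : ℕ → Ω → α) : Prop where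
  measurable : ∀ k, Measurable (S k)
  markov : ∀ k, HasCondDistrib (S (k + 1)) (fun ω (i : Finset.Iic k) => S i ω)
    (κ.comap (fun h : Finset.Iic k → α => h ⟨k, Finset.mem_Iic.2 le_rfl⟩)
      (measurable_pi_apply _)) P

end

end DegenerateLevy

/-! A single solution sampled at the times `τ_k` is a Markov chain. At `τ_1` it jumps by `(Δz(τ_1),
0)`, where `Δz(τ_1)` has law `ν_K` and is independent of `X(τ_1-)`, and the noise after `τ_1` is a
copy of `z` independent of `X(τ_1)`. One step of this chain is therefore: run to `τ_1-`, then add an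
independent `(η, 0)`. Since `Q` has the prescribed marginals, each component of the coupled kernel
performs exactly this step. So each component of a chain with the coupled kernel is Markov with the
one-solution kernel, and initial state and kernel determine the law
(`identDistrib_of_hasCondDistrib`).

The independence at `τ_1` is derived from increments alone, without Poisson random measures. The
path after `T` is cut by a grid of mesh `δ`, and the condition `|Δz| ≥ K` is relaxed to a continuous
cutoff `φ`. Independent stationary increments factor the expected grid sums exactly
(`integral_gridSum_mul`). Letting `δ → 0` and then `φ` tend to the indicator of `Γ_K`, the sums
converge pathwise to the functional at the first big jump (`IsCadlag.tendsto_gridSum`), while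
`E[φ(z(δ)) g(z(δ))] / δ` tends to the integral of `g` over `Γ_K`
(`IsLevyMeasure.tendsto_integral_div`, proved with characteristic functions). The outcome is
`integral_preValue_mul_jumpValue_mul_postPath`; the same sums show that a big jump almost surely
occurs.

Each solution is given only up to a null set depending on its starting point, so it cannot be
restarted at a random position by substitution. Instead the position before and at `τ_1` and the
noise afterwards are written as measurable functionals of starting point and path, by Euler schemes
and countably many times. Iterating the resulting `jumpMap` samples the solution
(`IsDriven.iterate_jumpMap`), and regeneration of the noise makes the iterates Markov
(`hasCondDistrib_iterate_fst`).

The coupling kernel comes from jointly measurable densities of two kernels with respect to their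
sum: the common part is put on the diagonal and the remainders are coupled as a product. -/

namespace DegenerateLevy

noncomputable section

/-! ### Maximal couplings and their measurable selection. -/

section MaximalCoupling

variable {α : Type*} [MeasurableSpace α]

lemma bddAbove_range_abs_measureReal_sub (μ₁ μ₂ : Measure α) [IsProbabilityMeasure μ₁]
    [IsProbabilityMeasure μ₂] :
    BddAbove (Set.range fun A : {A : Set α // MeasurableSet A} => |μ₁.real A - μ₂.real A|) := by
  refine ⟨1, ?_⟩
  rintro _ ⟨A, rfl⟩
  have h1 : μ₁.real A ≤ 1 := measureReal_le_one
  have h2 : μ₂.real A ≤ 1 := measureReal_le_one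
  have h3 : 0 ≤ μ₁.real A := measureReal_nonneg
  have h4 : 0 ≤ μ₂.real A := measureReal_nonneg
  exact abs_le.2 ⟨by linarith, by linarith⟩

lemma sub_measureReal_le_tvDist (μ₁ μ₂ : Measure α) [IsProbabilityMeasure μ₁]
    [IsProbabilityMeasure μ₂] {A : Set α} (hA : MeasurableSet A) :
    μ₁.real A - μ₂.real A ≤ tvDist μ₁ μ₂ :=
  (le_abs_self _).trans
    (le_ciSup (bddAbove_range_abs_measureReal_sub μ₁ μ₂) ⟨A, hA⟩)

/-- The coupling inequality. -/
lemma tvDist_le_of_coupling {μ₁ μ₂ : Measure α} {π : Measure (α × α)} [IsFiniteMeasure π]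
    (h1 : π.map Prod.fst = μ₁) (h2 : π.map Prod.snd = μ₂) :
    tvDist μ₁ μ₂ ≤ π.real {p | p.1 ≠ p.2} := by
  have key : ∀ A : Set α, MeasurableSet A →
      |μ₁.real A - μ₂.real A| ≤ π.real {p | p.1 ≠ p.2} := by
    intro A hA
    have e1 : μ₁.real A = π.real (Prod.fst ⁻¹' A) := by
      rw [← h1, map_measureReal_apply measurable_fst hA]
    have e2 : μ₂.real A = π.real (Prod.snd ⁻¹' A) := by
      rw [← h2, map_measureReal_apply measurable_snd hA]
    rw [e1, e2, abs_sub_le_iff]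
    constructor
    · have : π.real (Prod.fst ⁻¹' A) ≤ π.real ((Prod.snd ⁻¹' A) ∪ {p | p.1 ≠ p.2}) := by
        refine measureReal_mono ?_
        rintro ⟨a, b⟩ ha
        by_cases h : a = b
        · left; subst h; exact ha
        · right; exact h
      linarith [measureReal_union_le (μ := π) (Prod.snd ⁻¹' A) {p | p.1 ≠ p.2}]
    · have : π.real (Prod.snd ⁻¹' A) ≤ π.real ((Prod.fst ⁻¹' A) ∪ {p | p.1 ≠ p.2}) := by
        refine measureReal_mono ?_
        rintro ⟨a, b⟩ ha
        by_cases h : a = b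
        · left; subst h; exact ha
        · right; exact h
      linarith [measureReal_union_le (μ := π) (Prod.fst ⁻¹' A) {p | p.1 ≠ p.2}]
  have : Nonempty {A : Set α // MeasurableSet A} := ⟨⟨∅, MeasurableSet.empty⟩⟩
  exact ciSup_le fun A => key A A.2

/-- A maximal coupling of two measures with densities `f₁` and `f₂`: the common part is put on the
diagonal, the remainders are coupled independently. -/
def densityCoupling (μ : Measure α) (f₁ f₂ : α → ℝ≥0∞) : Measure (α × α) :=
  (μ.withDensity fun x => min (f₁ x) (f₂ x)).map (fun x => (x, x)) +
    (μ.withDensity (fun x => f₁ x - f₂ x) Set.univ)⁻¹ •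
      (μ.withDensity fun x => f₁ x - f₂ x).prod (μ.withDensity fun x => f₂ x - f₁ x)

lemma withDensity_min_add_withDensity_sub (μ : Measure α) {f₁ f₂ : α → ℝ≥0∞}
    (hf₁ : Measurable f₁) (hf₂ : Measurable f₂) :
    μ.withDensity (fun x => min (f₁ x) (f₂ x)) + μ.withDensity (fun x => f₁ x - f₂ x) =
      μ.withDensity f₁ := by
  rw [← withDensity_add_left (hf₁.min hf₂)]
  congr 1
  ext x
  simp only [Pi.add_apply]
  rcases le_total (f₁ x) (f₂ x) with h | h
  · simp [h, tsub_eq_zero_of_le h]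
  · simp [h, add_tsub_cancel_of_le h]

/-- The diagonal carries the common part `c`, so at most the mass of the remainder `r₁` lies off it.
That mass equals the difference of the two measures on `{f₂ < f₁}`, hence is at most the total
variation distance; the coupling inequality gives the converse. -/
lemma isMaximalCoupling_densityCoupling [MeasurableEq α] (μ : Measure α) {f₁ f₂ : α → ℝ≥0∞}
    (hf₁ : Measurable f₁) (hf₂ : Measurable f₂)
    [IsProbabilityMeasure (μ.withDensity f₁)] [IsProbabilityMeasure (μ.withDensity f₂)] :
    IsMaximalCoupling (μ.withDensity f₁) (μ.withDensity f₂) (densityCoupling μ f₁ f₂) := by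
  set c := μ.withDensity fun x => min (f₁ x) (f₂ x) with hc
  set r₁ := μ.withDensity fun x => f₁ x - f₂ x with hr₁
  set r₂ := μ.withDensity fun x => f₂ x - f₁ x with hr₂
  have s1 : c + r₁ = μ.withDensity f₁ := withDensity_min_add_withDensity_sub μ hf₁ hf₂
  have s2 : c + r₂ = μ.withDensity f₂ := by
    have := withDensity_min_add_withDensity_sub μ hf₂ hf₁
    simpa only [min_comm] using this
  have u1 : c Set.univ + r₁ Set.univ = 1 := by
    rw [← Measure.add_apply, s1]; exact measure_univ
  have u2 : c Set.univ + r₂ Set.univ = 1 := by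
    rw [← Measure.add_apply, s2]; exact measure_univ
  have cfin : c Set.univ ≠ ∞ := fun h => by simp [h] at u1
  have r1fin : r₁ Set.univ ≠ ∞ := fun h => by simp [h] at u1
  have r2fin : r₂ Set.univ ≠ ∞ := fun h => by simp [h] at u2
  have : IsFiniteMeasure c := ⟨cfin.lt_top⟩
  have : IsFiniteMeasure r₁ := ⟨r1fin.lt_top⟩
  have : IsFiniteMeasure r₂ := ⟨r2fin.lt_top⟩
  have req : r₁ Set.univ = r₂ Set.univ := (ENNReal.add_right_inj cfin).1 (u1.trans u2.symm)
  have hdiag : Measurable (fun x : α => (x, x)) := measurable_id.prodMk measurable_id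
  -- If the remainders vanish, the normalising factor is `∞`, but it multiplies the zero measure.
  have scal : ∀ ρ : Measure α, ρ Set.univ = r₁ Set.univ →
      (r₁ Set.univ)⁻¹ • r₁ Set.univ • ρ = ρ := by
    intro ρ hρ
    by_cases h0 : r₁ Set.univ = 0
    · have : ρ = 0 := Measure.measure_univ_eq_zero.1 (hρ.trans h0)
      simp [this]
    · rw [smul_smul, ENNReal.inv_mul_cancel h0 r1fin, one_smul]
  have fst : (densityCoupling μ f₁ f₂).map Prod.fst = μ.withDensity f₁ := by
    rw [densityCoupling, Measure.map_add _ _ measurable_fst, Measure.map_smul,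
      Measure.map_map measurable_fst hdiag, ← hr₁, ← hr₂, ← hc, Measure.map_fst_prod, ← req,
      scal r₁ rfl, ← s1]
    congr 1
    exact Measure.map_id
  have snd : (densityCoupling μ f₁ f₂).map Prod.snd = μ.withDensity f₂ := by
    rw [densityCoupling, Measure.map_add _ _ measurable_snd, Measure.map_smul,
      Measure.map_map measurable_snd hdiag, ← hr₁, ← hr₂, ← hc, Measure.map_snd_prod,
      scal r₂ req.symm, ← s2]
    congr 1
    exact Measure.map_id
  have fin : IsFiniteMeasure (densityCoupling μ f₁ f₂) := by
    have : IsFiniteMeasure ((densityCoupling μ f₁ f₂).map Prod.fst) := by rw [fst]; infer_instance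
    exact Measure.isFiniteMeasure_of_map (f := Prod.fst) measurable_fst.aemeasurable
  refine ⟨fst, snd, le_antisymm ?_ (tvDist_le_of_coupling fst snd)⟩
  have hmeas : MeasurableSet {p : α × α | p.1 ≠ p.2} :=
    (measurableSet_eq_fun measurable_fst measurable_snd).compl
  have hle : densityCoupling μ f₁ f₂ {p | p.1 ≠ p.2} ≤ r₁ Set.univ := by
    rw [densityCoupling, Measure.add_apply, Measure.map_apply hdiag hmeas]
    have : (fun x : α => (x, x)) ⁻¹' {p | p.1 ≠ p.2} = ∅ := by ext; simp
    rw [this, measure_empty, zero_add, Measure.smul_apply, smul_eq_mul]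
    calc (r₁ Set.univ)⁻¹ * (r₁.prod r₂) {p | p.1 ≠ p.2}
        ≤ (r₁ Set.univ)⁻¹ * (r₁.prod r₂) Set.univ := by gcongr; exact Set.subset_univ _
      _ = ((r₁ Set.univ)⁻¹ * r₁ Set.univ) * r₁ Set.univ := by
        rw [← Set.univ_prod_univ, Measure.prod_prod, ← req, mul_assoc]
      _ ≤ 1 * r₁ Set.univ := by gcongr; exact ENNReal.inv_mul_le_one _
      _ = r₁ Set.univ := one_mul _
  -- The set attaining the supremum: `r₁` lives on it and `r₂` does not charge it.
  set B : Set α := {x | f₂ x < f₁ x}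
  have hB : MeasurableSet B := measurableSet_lt hf₂ hf₁
  have rB : r₁ Set.univ = r₁ B := by
    refine (measure_eq_measure_of_null_sdiff (Set.subset_univ _) ?_).symm
    rw [hr₁, withDensity_apply _ (MeasurableSet.univ.diff hB)]
    rw [setLIntegral_congr_fun (MeasurableSet.univ.diff hB) (g := fun _ => 0)]
    · simp
    · intro x hx
      simp only [B, Set.mem_sdiff, Set.mem_univ, Set.mem_ofPred_eq, not_lt, true_and] at hx
      exact tsub_eq_zero_of_le hx
  have rB2 : r₂ B = 0 := by
    rw [hr₂, withDensity_apply _ hB, setLIntegral_congr_fun hB (g := fun _ => 0)]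
    · simp
    · intro x hx
      have : f₂ x < f₁ x := hx
      exact tsub_eq_zero_of_le this.le
  have : (r₁ Set.univ).toReal = (μ.withDensity f₁).real B - (μ.withDensity f₂).real B := by
    rw [← s1, ← s2, measureReal_add_apply, measureReal_add_apply, rB]
    simp [Measure.real, rB2]
  calc (densityCoupling μ f₁ f₂).real {p | p.1 ≠ p.2} ≤ (r₁ Set.univ).toReal :=
        ENNReal.toReal_mono r1fin hle
    _ ≤ tvDist _ _ := by
        rw [this]; exact sub_measureReal_le_tvDist _ _ hB

/-- The construction of `densityCoupling` carried out with kernels. The normalising constant depends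
on `b`, so it enters as a density constant in the second variable; finite densities keep the
remainders s-finite. -/
lemma exists_kernel_densityCoupling {β : Type*} [MeasurableSpace β] (κ : Kernel β α)
    [IsFiniteKernel κ] {g₁ g₂ : β → α → ℝ≥0} (m₁ : Measurable (Function.uncurry g₁))
    (m₂ : Measurable (Function.uncurry g₂)) :
    ∃ Q : Kernel β (α × α), ∀ b,
      Q b = densityCoupling (κ b) (fun x => (g₁ b x : ℝ≥0∞)) (fun x => (g₂ b x : ℝ≥0∞)) := by
  have e₁ : Measurable (Function.uncurry fun b x => (g₁ b x : ℝ≥0∞)) := m₁.coe_nnreal_ennreal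
  have e₂ : Measurable (Function.uncurry fun b x => (g₂ b x : ℝ≥0∞)) := m₂.coe_nnreal_ennreal
  have n₁ : Measurable (Function.uncurry fun b x => (g₁ b x : ℝ≥0∞) - g₂ b x) := e₁.sub e₂
  have n₂ : Measurable (Function.uncurry fun b x => (g₂ b x : ℝ≥0∞) - g₁ b x) := e₂.sub e₁
  have nm : Measurable (Function.uncurry fun b x => min (g₁ b x : ℝ≥0∞) (g₂ b x)) := e₁.min e₂
  have hk₁ : IsSFiniteKernel (κ.withDensity fun b x => (g₁ b x : ℝ≥0∞) - g₂ b x) :=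
    Kernel.IsSFiniteKernel.withDensity _ fun _ _ =>
      ne_top_of_le_ne_top ENNReal.coe_ne_top tsub_le_self
  have hk₂ : IsSFiniteKernel (κ.withDensity fun b x => (g₂ b x : ℝ≥0∞) - g₁ b x) :=
    Kernel.IsSFiniteKernel.withDensity _ fun _ _ =>
      ne_top_of_le_ne_top ENNReal.coe_ne_top tsub_le_self
  have hd : Measurable (Function.uncurry fun (b : β) (_ : α × α) =>
      ((κ.withDensity fun b x => (g₁ b x : ℝ≥0∞) - g₂ b x) b Set.univ)⁻¹) :=
    (Kernel.measurable_coe _ MeasurableSet.univ).inv.comp measurable_fst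
  refine ⟨(κ.withDensity fun b x => min (g₁ b x : ℝ≥0∞) (g₂ b x)).map (fun x => (x, x)) +
    ((κ.withDensity fun b x => (g₁ b x : ℝ≥0∞) - g₂ b x) ×ₖ
      (κ.withDensity fun b x => (g₂ b x : ℝ≥0∞) - g₁ b x)).withDensity
      (fun b _ => ((κ.withDensity fun b x => (g₁ b x : ℝ≥0∞) - g₂ b x) b Set.univ)⁻¹),
    fun b => ?_⟩
  rw [add_apply, Kernel.map_apply _ (by fun_prop),
    Kernel.withDensity_apply _ hd, Kernel.prod_apply, densityCoupling,
    Kernel.withDensity_apply _ nm, Kernel.withDensity_apply _ n₁, Kernel.withDensity_apply _ n₂,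
    withDensity_const]

/-- Measurable selection of maximal couplings of two Markov kernels. -/
theorem exists_kernel_isMaximalCoupling {β : Type*} [MeasurableSpace β] [MeasurableEq α]
    [MeasurableSpace.CountableOrCountablyGenerated β α] (κ₁ κ₂ : Kernel β α)
    [IsMarkovKernel κ₁] [IsMarkovKernel κ₂] :
    ∃ Q : Kernel β (α × α), ∀ b, IsMaximalCoupling (κ₁ b) (κ₂ b) (Q b) := by
  -- Both kernels have densities with respect to `κ₁ + κ₂`, namely `r` and `1 - r`, measurable
  -- jointly in parameter and point. The countability assumption on the spaces provides this.
  obtain ⟨r, hr, e₁, e₂⟩ : ∃ r : β → α → ℝ, (Measurable fun p : β × α => r p.1 p.2) ∧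
      (κ₁ + κ₂).withDensity (fun b x => ((r b x).toNNReal : ℝ≥0∞)) = κ₁ ∧
      (κ₁ + κ₂).withDensity (fun b x => ((1 - r b x).toNNReal : ℝ≥0∞)) = κ₂ :=
    ⟨κ₁.rnDerivAux (κ₁ + κ₂), Kernel.measurable_rnDerivAux _ _,
      Kernel.withDensity_rnDerivAux κ₁ κ₂, Kernel.withDensity_one_sub_rnDerivAux κ₁ κ₂⟩
  have m₁ : Measurable (Function.uncurry fun b x => (r b x).toNNReal) := hr.real_toNNReal
  have m₂ : Measurable (Function.uncurry fun b x => (1 - r b x).toNNReal) :=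
    (hr.const_sub 1).real_toNNReal
  obtain ⟨Q, hQ⟩ := exists_kernel_densityCoupling (κ₁ + κ₂) m₁ m₂
  refine ⟨Q, fun b => ?_⟩
  have p₁ : ((κ₁ + κ₂) b).withDensity (fun x => ((r b x).toNNReal : ℝ≥0∞)) = κ₁ b := by
    have m : Measurable (Function.uncurry fun b x => ((r b x).toNNReal : ℝ≥0∞)) :=
      m₁.coe_nnreal_ennreal
    rw [← Kernel.withDensity_apply _ m, e₁]
  have p₂ : ((κ₁ + κ₂) b).withDensity (fun x => ((1 - r b x).toNNReal : ℝ≥0∞)) = κ₂ b := by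
    have m : Measurable (Function.uncurry fun b x => ((1 - r b x).toNNReal : ℝ≥0∞)) :=
      m₂.coe_nnreal_ennreal
    rw [← Kernel.withDensity_apply _ m, e₂]
  have i₁ : IsProbabilityMeasure
      (((κ₁ + κ₂) b).withDensity (fun x => ((r b x).toNNReal : ℝ≥0∞))) := by
    rw [p₁]; infer_instance
  have i₂ : IsProbabilityMeasure
      (((κ₁ + κ₂) b).withDensity (fun x => ((1 - r b x).toNNReal : ℝ≥0∞))) := by
    rw [p₂]; infer_instance
  have q₁ : Measurable fun x => ((r b x).toNNReal : ℝ≥0∞) :=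
    (m₁.comp measurable_prodMk_left).coe_nnreal_ennreal
  have q₂ : Measurable fun x => ((1 - r b x).toNNReal : ℝ≥0∞) :=
    (m₂.comp measurable_prodMk_left).coe_nnreal_ennreal
  have key := isMaximalCoupling_densityCoupling ((κ₁ + κ₂) b) q₁ q₂
  rw [p₁, p₂] at key
  rw [hQ]
  exact key

end MaximalCoupling

/-! ### The law of a big jump and its coupling kernel. -/

/-- Markov's inequality: the integrand `min 1 (y ^ 2)` is at least `min 1 (K ^ 2)` on big jumps. -/
lemma IsLevyMeasure.bigJumps_lt_top {ν : Measure ℝ} (hν : IsLevyMeasure ν) {K : ℝ} (hK : 0 < K) :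
    ν (bigJumps K) < ⊤ := by
  have hm : 0 < min 1 (K ^ 2) := lt_min one_pos (by positivity)
  have hsub : bigJumps K ⊆
      {y | ENNReal.ofReal (min 1 (K ^ 2)) ≤ ENNReal.ofReal (min 1 (y ^ 2))} := by
    intro y hy
    refine ENNReal.ofReal_le_ofReal (min_le_min le_rfl ?_)
    rw [← sq_abs y]
    have : K ≤ |y| := by
      rcases hy with h | h
      · exact le_abs.2 (Or.inr (by simpa using neg_le_neg (Set.mem_Iic.1 h)))
      · exact le_abs.2 (Or.inl h)
    gcongr
  have := mul_meas_ge_le_lintegral₀ (μ := ν) (f := fun y => ENNReal.ofReal (min 1 (y ^ 2)))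
    (by fun_prop) (ENNReal.ofReal (min 1 (K ^ 2)))
  have h2 := (this.trans_lt hν.finite)
  have h3 : ν {y | ENNReal.ofReal (min 1 (K ^ 2)) ≤ ENNReal.ofReal (min 1 (y ^ 2))} < ⊤ := by
    refine ENNReal.lt_top_of_mul_ne_top_right h2.ne ?_
    simpa using hK.ne'
  exact (measure_mono hsub).trans_lt h3

lemma isProbabilityMeasure_bigJumpLaw {ν : Measure ℝ} (hν : IsLevyMeasure ν) {K : ℝ}
    (hK : 0 < K) (hγ : 0 < ν (bigJumps K)) : IsProbabilityMeasure (bigJumpLaw ν K) := by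
  refine ⟨?_⟩
  rw [bigJumpLaw, Measure.smul_apply, smul_eq_mul, Measure.restrict_apply_univ,
    ENNReal.inv_mul_cancel hγ.ne' (hν.bigJumps_lt_top hK).ne]

lemma exists_isMaximalCouplingKernel (ρ : Measure ℝ) [IsProbabilityMeasure ρ] :
    ∃ Q : Kernel (ℝ × ℝ) (ℝ × ℝ), IsMaximalCouplingKernel ρ Q := by
  have m1 : Measurable fun p : (ℝ × ℝ) × ℝ => p.1.1 + p.2 := by fun_prop
  have m2 : Measurable fun p : (ℝ × ℝ) × ℝ => p.1.2 + p.2 := by fun_prop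
  let κ₁ : Kernel (ℝ × ℝ) ℝ := (Kernel.id ×ₖ Kernel.const (ℝ × ℝ) ρ).map fun p => p.1.1 + p.2
  let κ₂ : Kernel (ℝ × ℝ) ℝ := (Kernel.id ×ₖ Kernel.const (ℝ × ℝ) ρ).map fun p => p.1.2 + p.2
  have : IsMarkovKernel κ₁ := Kernel.IsMarkovKernel.map _ m1
  have : IsMarkovKernel κ₂ := Kernel.IsMarkovKernel.map _ m2
  obtain ⟨Q, hQ⟩ := exists_kernel_isMaximalCoupling κ₁ κ₂
  refine ⟨Q, fun a b => ?_⟩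
  convert hQ (a, b) using 1
  · simp only [κ₁]
    rw [Kernel.map_apply _ m1, Kernel.prod_apply, Kernel.id_apply, Kernel.const_apply,
      Measure.dirac_prod, Measure.map_map m1 (by fun_prop)]
    rfl
  · simp only [κ₂]
    rw [Kernel.map_apply _ m2, Kernel.prod_apply, Kernel.id_apply, Kernel.const_apply,
      Measure.dirac_prod, Measure.map_map m2 (by fun_prop)]
    rfl

/-! ### Càdlàg paths: big jumps, oscillation, restarting. -/

section Cadlag

variable {E : Type*} [TopologicalSpace E]

lemma IsCadlag.tendsto_right {f : ℝ≥0 → E} (hf : IsCadlag f) {t : ℝ≥0} {ι : Type*} {l : Filter ι}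
    {u : ι → ℝ≥0} (hu : Tendsto u l (𝓝 t)) (h : ∀ᶠ i in l, t ≤ u i) :
    Tendsto (fun i => f (u i)) l (𝓝 (f t)) :=
  (hf t).1.tendsto.comp (tendsto_nhdsWithin_iff.2 ⟨hu, h⟩)

lemma IsCadlag.tendsto_leftLim [T2Space E] {f : ℝ≥0 → E} (hf : IsCadlag f) (t : ℝ≥0) :
    Tendsto f (𝓝[<] t) (𝓝 (Function.leftLim f t)) := by
  -- At `t = 0` the filter is trivial and there is nothing to prove.
  by_cases h : 𝓝[<] t = ⊥
  · rw [h]; exact tendsto_bot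
  · obtain ⟨l, hl⟩ := (hf t).2
    have : (𝓝[<] t).NeBot := ⟨h⟩
    rwa [leftLim_eq_of_tendsto hl]

lemma IsCadlag.tendsto_left [T2Space E] {f : ℝ≥0 → E} (hf : IsCadlag f) {t : ℝ≥0} {ι : Type*}
    {l : Filter ι} {u : ι → ℝ≥0} (hu : Tendsto u l (𝓝 t)) (h : ∀ᶠ i in l, u i < t) :
    Tendsto (fun i => f (u i)) l (𝓝 (Function.leftLim f t)) :=
  (hf.tendsto_leftLim t).comp (tendsto_nhdsWithin_iff.2 ⟨hu, h⟩)

lemma IsCadlag.leftLim_eq [T2Space E] {f : ℝ≥0 → E} (hf : IsCadlag f) {t : ℝ≥0} (ht : 0 < t) {l : E}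
    (h : Tendsto f (𝓝[<] t) (𝓝 l)) : Function.leftLim f t = l := by
  have : (𝓝[<] t).NeBot := nhdsLT_neBot_of_exists_lt ⟨0, ht⟩
  exact tendsto_nhds_unique (hf.tendsto_leftLim t) h

lemma IsCadlag.comp_continuous {F : Type*} [TopologicalSpace F] {f : ℝ≥0 → E} (hf : IsCadlag f)
    {g : E → F} (hg : Continuous g) : IsCadlag fun t => g (f t) := fun t =>
  ⟨hg.continuousAt.comp_continuousWithinAt (hf t).1,
    let ⟨l, hl⟩ := (hf t).2; ⟨g l, (hg.tendsto l).comp hl⟩⟩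

lemma tendsto_const_add_nhdsLT (s t : ℝ≥0) : Tendsto (fun u => s + u) (𝓝[<] t) (𝓝[<] (s + t)) :=
  tendsto_nhdsWithin_iff.2 ⟨(continuous_const_add s).continuousAt.tendsto.mono_left
    nhdsWithin_le_nhds, by
      filter_upwards [self_mem_nhdsWithin] with u hu
      exact add_lt_add_right (Set.mem_Iio.1 hu) s⟩

lemma IsCadlag.comp_const_add {f : ℝ≥0 → E} (hf : IsCadlag f) (s : ℝ≥0) :
    IsCadlag fun t => f (s + t) := fun t => by
  refine ⟨(hf (s + t)).1.comp (continuous_const_add s).continuousWithinAt ?_, ?_⟩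
  · intro u hu
    exact add_le_add_right (Set.mem_Ici.1 hu) s
  · obtain ⟨l, hl⟩ := (hf (s + t)).2
    exact ⟨l, hl.comp (tendsto_const_add_nhdsLT s t)⟩

end Cadlag

/-- The increments of a path after time `s`. -/
def shiftPath (s : ℝ≥0) (f : ℝ≥0 → ℝ) : ℝ≥0 → ℝ := fun t => f (s + t) - f s

lemma IsCadlag.shiftPath {f : ℝ≥0 → ℝ} (hf : IsCadlag f) (s : ℝ≥0) : IsCadlag (shiftPath s f) :=
  (hf.comp_const_add s).comp_continuous (g := fun y => y - f s) (by fun_prop)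

/-- Positivity of `t` matters: at `0` the restarted path has jump `0` by convention, while `f` may
jump at `s`. -/
lemma IsCadlag.jump_shiftPath {f : ℝ≥0 → ℝ} (hf : IsCadlag f) (s : ℝ≥0) {t : ℝ≥0} (ht : 0 < t) :
    jump (DegenerateLevy.shiftPath s f) t = jump f (s + t) := by
  have : Function.leftLim (DegenerateLevy.shiftPath s f) t = Function.leftLim f (s + t) - f s :=
    (hf.shiftPath s).leftLim_eq ht
      (((hf.tendsto_leftLim _).comp (tendsto_const_add_nhdsLT s t)).sub_const _)
  simp [jump, this, DegenerateLevy.shiftPath]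

/-- The set of times after `T` at which a path has a jump of size at least `K`. -/
def bigJumpTimes (T : ℝ≥0) (K : ℝ) (f : ℝ≥0 → ℝ) : Set ℝ≥0 := {t | T < t ∧ K ≤ |jump f t|}

/-- The first time after `T` at which a path has a jump of size at least `K`. -/
def firstBigJump (T : ℝ≥0) (K : ℝ) (f : ℝ≥0 → ℝ) : ℝ≥0 := sInf (bigJumpTimes T K f)

/-- The infimum is attained because big jumps cannot accumulate from the right: just after `s` the
path stays within `K / 3` of `f s`, so jumps there are smaller than `K`. -/
lemma IsCadlag.firstBigJump_mem {f : ℝ≥0 → ℝ} (hf : IsCadlag f) {T : ℝ≥0} {K : ℝ} (hK : 0 < K)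
    (hne : (bigJumpTimes T K f).Nonempty) : firstBigJump T K f ∈ bigJumpTimes T K f := by
  by_contra hmem
  set s := firstBigJump T K f with hs
  have hright : ∀ᶠ u in 𝓝[>] s, |f u - f s| < K / 3 := by
    have h1 : Tendsto f (𝓝[>] s) (𝓝 (f s)) :=
      (hf s).1.tendsto.mono_left (nhdsWithin_mono _ Set.Ioi_subset_Ici_self)
    filter_upwards [Metric.tendsto_nhds.1 h1 (K / 3) (by positivity)] with u hu
    exact hu
  obtain ⟨r, hr, hrsub⟩ := mem_nhdsGT_iff_exists_Ioo_subset.1 hright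
  obtain ⟨t, htS, htr⟩ := exists_lt_of_csInf_lt hne (show sInf (bigJumpTimes T K f) < r from hr)
  have hst : s < t := lt_of_le_of_ne (csInf_le (OrderBot.bddBelow _) htS) (by
    rintro h; exact hmem (h ▸ htS))
  have h0 : (𝓝[<] t).NeBot := nhdsLT_neBot_of_exists_lt ⟨s, hst⟩
  have hl : |Function.leftLim f t - f s| ≤ K / 3 := by
    refine le_of_tendsto ((hf.tendsto_leftLim t).sub_const (f s)).abs ?_
    filter_upwards [Ioo_mem_nhdsLT hst] with u hu
    have : |f u - f s| < K / 3 := hrsub ⟨hu.1, hu.2.trans htr⟩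
    exact this.le
  have h2 : |f t - f s| < K / 3 := hrsub ⟨hst, htr⟩
  have h3 : K ≤ |f t - Function.leftLim f t| := htS.2
  have : |f t - Function.leftLim f t| ≤ |f t - f s| + |Function.leftLim f t - f s| := by
    rw [abs_sub_comm (Function.leftLim f t)]
    exact abs_sub_le _ _ _
  linarith

lemma notMem_bigJumpTimes_of_lt_firstBigJump {f : ℝ≥0 → ℝ} {T : ℝ≥0} {K : ℝ} {t : ℝ≥0}
    (ht : t < firstBigJump T K f) : t ∉ bigJumpTimes T K f :=
  notMem_of_lt_csInf ht (OrderBot.bddBelow _)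

/-- Compactness of bounded time sets: if a càdlàg path oscillates by almost `K` over arbitrarily
short intervals with end points in a bounded set, then it has a jump of size at least `K`. -/
lemma IsCadlag.exists_bigJump {f : ℝ≥0 → ℝ} (hf : IsCadlag f) {K : ℝ} (hK : 0 < K)
    {I : Set ℝ≥0} {b : ℝ≥0} (hI : I ⊆ Set.Iic b)
    (h : ∀ n : ℕ, ∃ p ∈ I, ∃ q ∈ I, p ≤ q ∧ (q : ℝ) - p < 1 / ((n : ℝ) + 1) ∧
      K - 1 / ((n : ℝ) + 1) < |f q - f p|) :
    ∃ s, (∃ p ∈ I, ∃ q ∈ I, p < s ∧ s ≤ q) ∧ K ≤ |jump f s| := by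
  choose p hp q hq hpq hd hosc using h
  -- Along an ultrafilter `p n` converges, and it stays eventually on one side of its limit `s`; the
  -- same holds for `q n`. This replaces passing to subsequences.
  let U : Ultrafilter ℕ := hyperfilter ℕ
  have hU : (U : Filter ℕ) ≤ atTop := Nat.hyperfilter_le_atTop
  obtain ⟨s, -, hs⟩ := (isCompact_Icc (a := (0 : ℝ≥0)) (b := b)).ultrafilter_le_nhds' (U.map p)
    (by
      refine Ultrafilter.mem_map.2 (Filter.mem_of_superset univ_mem fun n _ => ?_)
      exact ⟨zero_le, hI (hp n)⟩)
  have hps : Tendsto p U (𝓝 s) := hs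
  have h1n : Tendsto (fun n : ℕ => 1 / ((n : ℝ) + 1)) U (𝓝 0) :=
    tendsto_one_div_add_atTop_nhds_zero_nat.mono_left hU
  have hqs : Tendsto q U (𝓝 s) := by
    rw [← NNReal.tendsto_coe] at hps ⊢
    have hdiff : Tendsto (fun n => (q n : ℝ) - p n) U (𝓝 0) :=
      squeeze_zero (fun n => sub_nonneg.2 (NNReal.coe_le_coe.2 (hpq n))) (fun n => (hd n).le) h1n
    simpa using hps.add hdiff
  have lim : ∀ {c : ℝ}, Tendsto (fun n => |f (q n) - f (p n)|) U (𝓝 c) → K ≤ c := by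
    intro c hc
    have : Tendsto (fun n : ℕ => K - 1 / ((n : ℝ) + 1)) U (𝓝 (K - 0)) := h1n.const_sub K
    rw [sub_zero] at this
    exact le_of_tendsto_of_tendsto' this hc fun n => (hosc n).le
  -- If both end points approach `s` from the same side, the increments tend to `0`, against `K >
  -- 0`. Only `p n < s ≤ q n` is left, and there the increments tend to the jump at `s`.
  by_cases c1 : ∀ᶠ n in U, s ≤ p n
  · exfalso
    have c2 : ∀ᶠ n in U, s ≤ q n := c1.mono fun n hn => hn.trans (hpq n)
    have := lim ((hf.tendsto_right hqs c2).sub (hf.tendsto_right hps c1)).abs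
    simp only [sub_self, abs_zero] at this
    linarith
  have c1' : ∀ᶠ n in U, p n < s := by
    simpa only [not_le] using Ultrafilter.eventually_not.2 c1
  by_cases c2 : ∀ᶠ n in U, s ≤ q n
  · obtain ⟨n, hn1, hn2⟩ := (c1'.and c2).exists
    exact ⟨s, ⟨p n, hp n, q n, hq n, hn1, hn2⟩,
      lim ((hf.tendsto_right hqs c2).sub (hf.tendsto_left hps c1')).abs⟩
  · exfalso
    have c2' : ∀ᶠ n in U, q n < s := by
      simpa only [not_le] using Ultrafilter.eventually_not.2 c2
    have := lim ((hf.tendsto_left hqs c2').sub (hf.tendsto_left hps c1')).abs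
    simp only [sub_self, abs_zero] at this
    linarith

/-- Without jumps of size at least `K`, the oscillation over short intervals stays below some
`K' < K`. -/
lemma IsCadlag.exists_oscillation_lt {f : ℝ≥0 → ℝ} (hf : IsCadlag f) {K : ℝ} (hK : 0 < K)
    {I : Set ℝ≥0} {b : ℝ≥0} (hI : I ⊆ Set.Iic b)
    (h : ∀ s, (∃ p ∈ I, ∃ q ∈ I, p < s ∧ s ≤ q) → |jump f s| < K) :
    ∃ K' < K, ∃ δ > 0, ∀ p ∈ I, ∀ q ∈ I, p ≤ q → (q : ℝ) - p < δ → |f q - f p| ≤ K' := by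
  by_contra! hcon
  obtain ⟨s, hs, hKs⟩ := hf.exists_bigJump hK hI fun n => by
    obtain ⟨p, hp, q, hq, hpq, hd, ho⟩ := hcon (K - 1 / ((n : ℝ) + 1))
      (sub_lt_self _ Nat.one_div_pos_of_nat) (1 / ((n : ℝ) + 1)) Nat.one_div_pos_of_nat
    exact ⟨p, hp, q, hq, hpq, hd, ho⟩
  exact absurd hKs (not_le.2 (h s hs))

/-- The path oscillates by almost `K` over arbitrarily short intervals inside `(T, t)`, expressed
through countably many coordinates. -/
def denseOscillation (T : ℝ≥0) (K : ℝ) (t : ℝ≥0) : Set (ℝ≥0 → ℝ) :=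
  {f | ∀ n : ℕ, ∃ i j : ℕ, (T < TopologicalSpace.denseSeq ℝ≥0 i ∧
    TopologicalSpace.denseSeq ℝ≥0 i ≤ TopologicalSpace.denseSeq ℝ≥0 j ∧
    TopologicalSpace.denseSeq ℝ≥0 j < t ∧
    (TopologicalSpace.denseSeq ℝ≥0 j : ℝ) - TopologicalSpace.denseSeq ℝ≥0 i < 1 / ((n : ℝ) + 1)) ∧
    K - 1 / ((n : ℝ) + 1) <
      |f (TopologicalSpace.denseSeq ℝ≥0 j) - f (TopologicalSpace.denseSeq ℝ≥0 i)|}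

lemma measurableSet_denseOscillation (T : ℝ≥0) (K : ℝ) (t : ℝ≥0) :
    MeasurableSet (denseOscillation T K t) := by
  have : denseOscillation T K t = ⋂ n : ℕ, ⋃ i : ℕ, ⋃ j : ℕ,
    {f : ℝ≥0 → ℝ | (T < TopologicalSpace.denseSeq ℝ≥0 i ∧
    TopologicalSpace.denseSeq ℝ≥0 i ≤ TopologicalSpace.denseSeq ℝ≥0 j ∧
    TopologicalSpace.denseSeq ℝ≥0 j < t ∧
    (TopologicalSpace.denseSeq ℝ≥0 j : ℝ) - TopologicalSpace.denseSeq ℝ≥0 i < 1 / ((n : ℝ) + 1)) ∧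
    K - 1 / ((n : ℝ) + 1) <
      |f (TopologicalSpace.denseSeq ℝ≥0 j) - f (TopologicalSpace.denseSeq ℝ≥0 i)|} := by
    ext f; simp [denseOscillation]
  rw [this]
  refine MeasurableSet.iInter fun n =>
    MeasurableSet.iUnion fun i => MeasurableSet.iUnion fun j => ?_
  rw [Set.ofPred_and]
  have hm : ∀ u : ℝ≥0, Measurable fun f : ℝ≥0 → ℝ => f u := fun u => measurable_pi_apply u
  exact (MeasurableSet.const _).inter
    (measurableSet_lt measurable_const ((hm _).sub (hm _)).abs)

/-- This makes the event of a big jump in `(T, t)` measurable for càdlàg paths. Short large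
oscillations force a jump by `exists_bigJump`; conversely, a jump is approximated by dense times on
its two sides, which the strict inequalities leave room for. -/
lemma IsCadlag.mem_denseOscillation_iff {f : ℝ≥0 → ℝ} (hf : IsCadlag f) {T : ℝ≥0} {K : ℝ}
    (hK : 0 < K) (t : ℝ≥0) :
    f ∈ denseOscillation T K t ↔ ∃ s ∈ bigJumpTimes T K f, s < t := by
  constructor
  · intro h
    obtain ⟨s, ⟨p, hp, q, hq, hps, hsq⟩, hs⟩ := hf.exists_bigJump (I := Set.Ioo T t) (b := t) hK
      (fun u hu => hu.2.le) fun n => by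
        obtain ⟨i, j, ⟨h1, h2, h3, h4⟩, h5⟩ := h n
        exact ⟨_, ⟨h1, h2.trans_lt h3⟩, _, ⟨h1.trans_le h2, h3⟩, h2, h4, h5⟩
    exact ⟨s, ⟨hp.1.trans hps, hs⟩, hsq.trans_lt hq.2⟩
  · rintro ⟨s, ⟨hTs, hKs⟩, hst⟩ n
    -- Half the tolerance is spent on each side of the jump, for time and for value alike.
    have hε : 0 < 1 / ((n : ℝ) + 1) / 2 := half_pos Nat.one_div_pos_of_nat
    set ε := 1 / ((n : ℝ) + 1) / 2 with hεdef
    have hl : ∀ᶠ u in 𝓝[<] s, |f u - Function.leftLim f s| < ε ∧ (s : ℝ) - u < ε := by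
      have h1 := Metric.tendsto_nhds.1 (hf.tendsto_leftLim s) ε hε
      have h2 : ∀ᶠ u : ℝ≥0 in 𝓝[<] s, dist u s < ε :=
        nhdsWithin_le_nhds (Metric.ball_mem_nhds s hε)
      filter_upwards [h1, h2] with u hu1 hu2
      refine ⟨hu1, ?_⟩
      rw [NNReal.dist_eq, abs_sub_comm] at hu2
      exact (le_abs_self _).trans_lt hu2
    have hr : ∀ᶠ u in 𝓝[>] s, |f u - f s| < ε ∧ (u : ℝ) - s < ε := by
      have h1 := Metric.tendsto_nhds.1 ((hf s).1.tendsto.mono_left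
        (nhdsWithin_mono _ Set.Ioi_subset_Ici_self)) ε hε
      have h2 : ∀ᶠ u : ℝ≥0 in 𝓝[>] s, dist u s < ε :=
        nhdsWithin_le_nhds (Metric.ball_mem_nhds s hε)
      filter_upwards [h1, h2] with u hu1 hu2
      refine ⟨hu1, ?_⟩
      rw [NNReal.dist_eq] at hu2
      exact (le_abs_self _).trans_lt hu2
    obtain ⟨a, ha, hasub⟩ := (mem_nhdsLT_iff_exists_Ioo_subset' hTs).1 hl
    obtain ⟨b, hb, hbsub⟩ := (mem_nhdsGT_iff_exists_Ioo_subset' hst).1 hr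
    have hdense := TopologicalSpace.denseRange_denseSeq ℝ≥0
    obtain ⟨_, ⟨i, rfl⟩, hi1, hi2⟩ := hdense.exists_between (max_lt hTs (Set.mem_Iio.1 ha))
    obtain ⟨_, ⟨j, rfl⟩, hj1, hj2⟩ := hdense.exists_between (lt_min hst (Set.mem_Ioi.1 hb))
    have pi := hasub ⟨(le_max_right _ _).trans_lt hi1, hi2⟩
    have pj := hbsub ⟨hj1, hj2.trans_le (min_le_right _ _)⟩
    refine ⟨i, j, ⟨(le_max_left _ _).trans_lt hi1, (hi2.trans hj1).le,
      hj2.trans_le (min_le_left _ _), ?_⟩, ?_⟩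
    · have := pi.2; have := pj.2
      have : 1 / ((n : ℝ) + 1) = ε + ε := by rw [hεdef]; ring
      linarith
    · have h1 := pi.1; have h2 := pj.1
      have h3 : 1 / ((n : ℝ) + 1) = ε + ε := by rw [hεdef]; ring
      have h4 : |f s - Function.leftLim f s| ≤
          |f (TopologicalSpace.denseSeq ℝ≥0 j) - f (TopologicalSpace.denseSeq ℝ≥0 i)| +
          |f (TopologicalSpace.denseSeq ℝ≥0 j) - f s| +
          |f (TopologicalSpace.denseSeq ℝ≥0 i) - Function.leftLim f s| := by
        set x := f (TopologicalSpace.denseSeq ℝ≥0 j)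
        set y := f (TopologicalSpace.denseSeq ℝ≥0 i)
        have e : f s - Function.leftLim f s =
          (x - y) + (-(x - f s)) + (y - Function.leftLim f s) := by ring
        calc |f s - Function.leftLim f s|
            = |(x - y) + (-(x - f s)) + (y - Function.leftLim f s)| := by rw [← e]
          _ ≤ |x - y| + |-(x - f s)| + |y - Function.leftLim f s| := abs_add_three _ _ _
          _ = _ := by rw [abs_neg]
      have h5 : K ≤ |f s - Function.leftLim f s| := hKs
      linarith

/-- A càdlàg path is bounded on bounded time sets. -/
lemma IsCadlag.exists_norm_le {E : Type*} [NormedAddCommGroup E] {f : ℝ≥0 → E} (hf : IsCadlag f)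
    (b : ℝ≥0) : ∃ C, ∀ t ≤ b, ‖f t‖ ≤ C := by
  by_contra! h
  choose p hp hC using fun n : ℕ => h n
  let U : Ultrafilter ℕ := hyperfilter ℕ
  have hU : (U : Filter ℕ) ≤ atTop := Nat.hyperfilter_le_atTop
  obtain ⟨s, -, hs⟩ := (isCompact_Icc (a := (0 : ℝ≥0)) (b := b)).ultrafilter_le_nhds' (U.map p)
    (Ultrafilter.mem_map.2 (Filter.mem_of_superset univ_mem fun n _ => ⟨zero_le, hp n⟩))
  have hps : Tendsto p U (𝓝 s) := hs
  have htop : Tendsto (fun n => ‖f (p n)‖) U atTop :=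
    tendsto_atTop_mono (fun n => (hC n).le) (tendsto_natCast_atTop_atTop.mono_left hU)
  by_cases c1 : ∀ᶠ n in U, s ≤ p n
  · exact not_tendsto_nhds_of_tendsto_atTop htop _ (hf.tendsto_right hps c1).norm
  · have c1' : ∀ᶠ n in U, p n < s := by
      simpa only [not_le] using Ultrafilter.eventually_not.2 c1
    exact not_tendsto_nhds_of_tendsto_atTop htop _ (hf.tendsto_left hps c1').norm

lemma samplingTime_one (T : ℝ≥0) (K : ℝ) (f : ℝ≥0 → ℝ) :
    samplingTime T K f 1 = firstBigJump T K f := by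
  simp [samplingTime, firstBigJump, bigJumpTimes]

/-- The admissible jump times are a translate of those of the restarted path, and infima of nonempty
sets commute with translation. For the empty set they do not, since its infimum in `ℝ≥0` is `0`. -/
lemma IsCadlag.samplingTime_succ {f : ℝ≥0 → ℝ} (hf : IsCadlag f) (T : ℝ≥0) (K : ℝ) (k : ℕ)
    (hne : (bigJumpTimes T K (DegenerateLevy.shiftPath (samplingTime T K f k) f)).Nonempty) :
    samplingTime T K f (k + 1) = samplingTime T K f k +
      firstBigJump T K (DegenerateLevy.shiftPath (samplingTime T K f k) f) := by
  set s := samplingTime T K f k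
  have : {t : ℝ≥0 | s + T < t ∧ K ≤ |jump f t|} =
      (fun t => s + t) '' bigJumpTimes T K (DegenerateLevy.shiftPath s f) := by
    ext t
    constructor
    · rintro ⟨h1, h2⟩
      obtain ⟨u, rfl⟩ := exists_add_of_le (le_self_add.trans h1.le)
      have hu : T < u := lt_of_add_lt_add_left h1
      refine ⟨u, ⟨hu, ?_⟩, rfl⟩
      rwa [hf.jump_shiftPath s (zero_le.trans_lt hu)]
    · rintro ⟨u, ⟨hu, h2⟩, rfl⟩
      rw [hf.jump_shiftPath s (zero_le.trans_lt hu)] at h2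
      exact ⟨add_lt_add_right hu s, h2⟩
  change sInf {t : ℝ≥0 | s + T < t ∧ K ≤ |jump f t|} = _
  rw [this, firstBigJump]
  symm
  exact Monotone.map_csInf_of_continuousAt (continuous_const_add s).continuousAt
    (fun a b h => by gcongr) hne (OrderBot.bddBelow _)

/-! ### Approximation of càdlàg paths on grids from the right. -/

section GridApproximation

lemma tendsto_ceil_mul_nhds (t : ℝ≥0) :
    Tendsto (fun h : ℝ≥0 => (⌈t / h⌉₊ : ℝ≥0) * h) (𝓝[>] 0) (𝓝 t) := by
  have h0 : Tendsto (fun h : ℝ≥0 => t + h) (𝓝[>] 0) (𝓝 t) := by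
    have : Tendsto (fun h : ℝ≥0 => t + h) (𝓝 0) (𝓝 (t + 0)) :=
      (continuous_const_add t).tendsto 0
    rw [add_zero] at this
    exact this.mono_left nhdsWithin_le_nhds
  refine tendsto_of_tendsto_of_tendsto_of_le_of_le' tendsto_const_nhds h0 ?_ ?_
  · filter_upwards [self_mem_nhdsWithin] with h hh
    have hh : 0 < h := hh
    calc t = t / h * h := by field_simp
      _ ≤ ⌈t / h⌉₊ * h := by gcongr; exact Nat.le_ceil _
  · filter_upwards [self_mem_nhdsWithin] with h hh
    have hh : 0 < h := hh
    calc (⌈t / h⌉₊ : ℝ≥0) * h ≤ (t / h + 1) * h := by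
          gcongr; exact (Nat.ceil_lt_add_one zero_le).le
      _ = t + h := by field_simp

lemma le_ceil_mul {t h : ℝ≥0} (hh : 0 < h) : t ≤ (⌈t / h⌉₊ : ℝ≥0) * h := by
  calc t = t / h * h := by field_simp
    _ ≤ ⌈t / h⌉₊ * h := by gcongr; exact Nat.le_ceil _

lemma ceil_mul_le {t h : ℝ≥0} (hh : 0 < h) : (⌈t / h⌉₊ : ℝ≥0) * h ≤ t + h := by
  calc (⌈t / h⌉₊ : ℝ≥0) * h ≤ (t / h + 1) * h := by
        gcongr; exact (Nat.ceil_lt_add_one zero_le).le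
    _ = t + h := by field_simp

variable {E : Type*} [NormedAddCommGroup E] [MeasurableSpace E] [BorelSpace E]

/-- The map factors through `ℕ`, so `g` may be arbitrary. -/
lemma measurable_comp_ceil_mul {β : Type*} [MeasurableSpace β] (g : ℝ≥0 → β) (h : ℝ≥0) :
    Measurable fun t : ℝ≥0 => g ((⌈t / h⌉₊ : ℝ≥0) * h) :=
  (measurable_from_nat (f := fun n : ℕ => g ((n : ℝ≥0) * h))).comp
    (Nat.measurable_ceil.comp (measurable_id.div_const h))

lemma IsCadlag.measurable {g : ℝ≥0 → E} (hg : IsCadlag g) : Measurable g := by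
  have hh : Tendsto (fun n : ℕ => (1 / ((n : ℝ≥0) + 1))) atTop (𝓝[>] 0) :=
    tendsto_nhdsWithin_iff.2 ⟨tendsto_one_div_add_atTop_nhds_zero_nat,
      Eventually.of_forall fun n => by simp⟩
  refine measurable_of_tendsto_metrizable
    (f := fun (n : ℕ) t => g ((⌈t / (1 / ((n : ℝ≥0) + 1))⌉₊ : ℝ≥0) * (1 / ((n : ℝ≥0) + 1))))
    (fun n => measurable_comp_ceil_mul g _) ?_
  refine tendsto_pi_nhds.2 fun t => ?_
  exact hg.tendsto_right ((tendsto_ceil_mul_nhds t).comp hh)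
    (Eventually.of_forall fun n => le_ceil_mul (by positivity))

/-- Left-point interpolation error of a càdlàg path on the right end points of a grid. -/
lemma IsCadlag.tendsto_integral_norm_sub_grid [SecondCountableTopology E] {g : ℝ≥0 → E}
    (hg : IsCadlag g) (M : ℝ≥0) :
    Tendsto (fun h : ℝ≥0 => ∫ s in (0 : ℝ)..M,
      ‖g s.toNNReal - g ((⌈s.toNNReal / h⌉₊ : ℝ≥0) * h)‖) (𝓝[>] 0) (𝓝 0) := by
  -- Grid points to the right of `[0, M]` overshoot by at most `h ≤ 1`.
  obtain ⟨C, hC⟩ := hg.exists_norm_le (M + 1)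
  have h1 : ∀ᶠ h : ℝ≥0 in 𝓝[>] 0, h ≤ 1 :=
    nhdsWithin_le_nhds (Iic_mem_nhds zero_lt_one)
  have key := intervalIntegral.tendsto_integral_filter_of_dominated_convergence
    (μ := volume) (a := (0 : ℝ)) (b := (M : ℝ)) (l := 𝓝[>] (0 : ℝ≥0))
    (F := fun (h : ℝ≥0) s => ‖g s.toNNReal - g ((⌈s.toNNReal / h⌉₊ : ℝ≥0) * h)‖)
    (f := fun _ => (0 : ℝ)) (fun _ => C + C) ?_ ?_ ?_ ?_
  · simpa using key
  · refine Eventually.of_forall fun h => Measurable.aestronglyMeasurable ?_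
    exact ((hg.measurable.comp measurable_real_toNNReal).sub
      ((measurable_comp_ceil_mul g h).comp measurable_real_toNNReal)).norm
  · filter_upwards [h1, self_mem_nhdsWithin] with h hh1 hh0
    refine Eventually.of_forall fun s hs => ?_
    rw [Set.uIoc_of_le M.coe_nonneg] at hs
    have hsM : s.toNNReal ≤ M := Real.toNNReal_le_iff_le_coe.2 hs.2
    rw [norm_norm]
    refine (norm_sub_le _ _).trans (add_le_add (hC _ (hsM.trans le_self_add)) (hC _ ?_))
    exact (ceil_mul_le hh0).trans (add_le_add hsM hh1)
  · exact intervalIntegrable_const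
  · refine Eventually.of_forall fun s _ => ?_
    have : Tendsto (fun h : ℝ≥0 => g ((⌈s.toNNReal / h⌉₊ : ℝ≥0) * h)) (𝓝[>] 0)
        (𝓝 (g s.toNNReal)) :=
      hg.tendsto_right (tendsto_ceil_mul_nhds _) (by
        filter_upwards [self_mem_nhdsWithin] with h hh using le_ceil_mul hh)
    simpa using (this.const_sub (g s.toNNReal)).norm

end GridApproximation

/-! ### Convergence of the Euler scheme with additive càdlàg noise. -/

/-- The explicit Euler scheme with step `h` for `dY = b(Y) dt + d(f, 0)`. -/
def euler (b : Plane → Plane) (h : ℝ≥0) (x : Plane) (f : ℝ≥0 → ℝ) : ℕ → Plane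
  | 0 => x
  | j + 1 => euler b h x f j + (h : ℝ) • b (euler b h x f j) +
      !₂[f ((j + 1 : ℕ) * h) - f (j * h), 0]

/-- `Y` is a càdlàg solution of `dY = b(Y) dt + d(f, 0)` started at `x`. -/
structure IsDriven (b : Plane → Plane) (x : Plane) (f : ℝ≥0 → ℝ) (Y : ℝ≥0 → Plane) : Prop where
  cadlag : IsCadlag Y
  eqn : ∀ t : ℝ≥0, Y t = x + (∫ s in (0 : ℝ)..t, b (Y s.toNNReal)) + !₂[f t, 0]

lemma planeVec_sub (a c : ℝ) : (!₂[a, 0] : Plane) - !₂[c, 0] = !₂[a - c, 0] := by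
  ext i; fin_cases i <;> simp

lemma measurable_planeVec {β : Type*} [MeasurableSpace β] {u v : β → ℝ} (hu : Measurable u)
    (hv : Measurable v) : Measurable fun p => (!₂[u p, v p] : Plane) := by
  refine (PiLp.continuous_toLp 2 (fun _ : Fin 2 => ℝ)).measurable.comp ?_
  refine measurable_pi_lambda _ fun i => ?_
  fin_cases i
  · exact hu
  · exact hv

lemma measurable_euler {b : Plane → Plane} (hb : Measurable b) (h : ℝ≥0) (j : ℕ) :
    Measurable fun p : Plane × (ℝ≥0 → ℝ) => euler b h p.1 p.2 j := by
  induction j with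
  | zero => exact measurable_fst
  | succ j ih =>
    have hm : ∀ u : ℝ≥0, Measurable fun p : Plane × (ℝ≥0 → ℝ) => p.2 u := fun u =>
      (measurable_pi_apply u).comp measurable_snd
    have h1 : Measurable fun p : Plane × (ℝ≥0 → ℝ) => (h : ℝ) • b (euler b h p.1 p.2 j) :=
      (hb.comp ih).const_smul (h : ℝ)
    have h2 : Measurable fun p : Plane × (ℝ≥0 → ℝ) =>
        (!₂[p.2 ((j + 1 : ℕ) * h) - p.2 (j * h), 0] : Plane) :=
      measurable_planeVec ((hm _).sub (hm _)) measurable_const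
    exact Measurable.add (Measurable.add ih h1) h2

/-- The Euler scheme only uses the path up to the current time. -/
lemma euler_congr (b : Plane → Plane) (h : ℝ≥0) (x : Plane) {f f' : ℝ≥0 → ℝ} {j : ℕ}
    (hff' : ∀ t ≤ (j : ℝ≥0) * h, f t = f' t) : euler b h x f j = euler b h x f' j := by
  induction j with
  | zero => rfl
  | succ j ih =>
    have hle : (j : ℝ≥0) * h ≤ ((j + 1 : ℕ) : ℝ≥0) * h := by gcongr; simp
    simp only [euler]
    rw [ih fun t ht => hff' t (ht.trans hle), hff' _ le_rfl, hff' _ hle]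

section EulerConvergence

variable {b : Plane → Plane} {x : Plane} {f : ℝ≥0 → ℝ} {Y : ℝ≥0 → Plane}

lemma IsCadlag.intervalIntegrable {g : ℝ≥0 → Plane} (hg : IsCadlag g) (s t : ℝ≥0) :
    IntervalIntegrable (fun r : ℝ => g r.toNNReal) volume s t := by
  obtain ⟨C, hC⟩ := hg.exists_norm_le (max s t)
  refine (intervalIntegrable_const (c := C)).mono_fun
    (hg.measurable.comp measurable_real_toNNReal).aestronglyMeasurable ?_
  rw [EventuallyLE, ae_restrict_iff' measurableSet_uIoc]
  refine Eventually.of_forall fun r hr => ?_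
  have hr2 : r ≤ max (s : ℝ) t := hr.2
  have : r.toNNReal ≤ max s t := by
    rw [Real.toNNReal_le_iff_le_coe]; exact_mod_cast hr2
  exact (hC _ this).trans (le_abs_self C)

lemma IsDriven.init (hY : IsDriven b x f Y) (hf : f 0 = 0) : Y 0 = x := by
  rw [hY.eqn 0, hf]
  ext i; fin_cases i <;> simp

lemma IsDriven.sub_eq (hY : IsDriven b x f Y) (hb : Continuous b) (s t : ℝ≥0) :
    Y t - Y s = (∫ r in (s : ℝ)..t, b (Y r.toNNReal)) + !₂[f t - f s, 0] := by
  have hi := (hY.cadlag.comp_continuous hb).intervalIntegrable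
  have := intervalIntegral.integral_add_adjacent_intervals (hi 0 s) (hi s t)
  rw [hY.eqn t, hY.eqn s, ← planeVec_sub]
  simp only [NNReal.coe_zero] at this
  rw [← this]
  abel

/-- Solutions can be restarted. -/
lemma IsDriven.shift (hY : IsDriven b x f Y) (hb : Continuous b) (s : ℝ≥0) :
    IsDriven b (Y s) (shiftPath s f) fun t => Y (s + t) := by
  refine ⟨hY.cadlag.comp_const_add s, fun t => ?_⟩
  have h1 := hY.sub_eq hb s (s + t)
  have h2 : ∫ r in (0 : ℝ)..t, b (Y (s + r.toNNReal)) =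
      ∫ r in (s : ℝ)..(s + t : ℝ≥0), b (Y r.toNNReal) := by
    have := intervalIntegral.integral_comp_add_left
      (f := fun r : ℝ => b (Y r.toNNReal)) (a := 0) (b := t) (s : ℝ)
    rw [add_zero] at this
    rw [NNReal.coe_add, ← this]
    refine intervalIntegral.integral_congr fun r hr => ?_
    rw [Set.uIcc_of_le t.coe_nonneg] at hr
    rw [Real.toNNReal_add s.coe_nonneg hr.1, Real.toNNReal_coe]
  rw [h2, add_assoc]
  exact sub_eq_iff_eq_add'.1 h1

/-- A discrete Gronwall estimate. The explicit scheme samples the drift at left end points, whereas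
a càdlàg function is approximated by its values at grid points on the right. Exchanging the two
telescopes to `h • (b (Y (j * h)) - b (Y 0))`, which is subtracted from the error beforehand. What
is left per step is the right-point integration error and a term of order `h ^ 2`. -/
lemma IsDriven.norm_sub_euler_le {L : ℝ≥0} (hY : IsDriven b x f Y) (hf : f 0 = 0)
    (hb : LipschitzWith L b) {h : ℝ≥0} (hh : 0 < h) {C : ℝ} {j : ℕ}
    (hC : ∀ t ≤ (j : ℝ≥0) * h, ‖b (Y t)‖ ≤ C) :
    ‖Y (j * h) - euler b h x f j - (h : ℝ) • (b (Y (j * h)) - b (Y 0))‖ ≤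
      Real.exp (L * (j * h)) * ((∫ s in (0 : ℝ)..((j : ℝ≥0) * h : ℝ≥0),
        ‖b (Y s.toNNReal) - b (Y ((⌈s.toNNReal / h⌉₊ : ℝ≥0) * h))‖) + 2 * h * L * C * (j * h)) := by
  have hg := hY.cadlag.comp_continuous hb.continuous
  set g : ℝ≥0 → Plane := fun t => b (Y t) with hgdef
  have hint : ∀ s t : ℝ≥0, IntervalIntegrable
      (fun s : ℝ => ‖g s.toNNReal - g ((⌈s.toNNReal / h⌉₊ : ℝ≥0) * h)‖) volume s t := by
    intro s t
    refine ((hg.intervalIntegrable s t).sub ?_).norm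
    obtain ⟨C, hC⟩ := hg.exists_norm_le (max s t + h)
    refine (intervalIntegrable_const (c := C)).mono_fun
      ((measurable_comp_ceil_mul g h).comp measurable_real_toNNReal).aestronglyMeasurable ?_
    rw [EventuallyLE, ae_restrict_iff' measurableSet_uIoc]
    refine Eventually.of_forall fun r hr => ?_
    have hr2 : r ≤ max (s : ℝ) t := hr.2
    have : r.toNNReal ≤ max s t := by
      rw [Real.toNNReal_le_iff_le_coe]; exact_mod_cast hr2
    exact (hC _ ((ceil_mul_le hh).trans (add_le_add_left this h))).trans (le_abs_self C)
  induction j with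
  | zero =>
    simp [euler, hY.init hf]
  | succ j ih =>
    have hle : (j : ℝ≥0) * h ≤ ((j + 1 : ℕ) : ℝ≥0) * h := by gcongr; simp
    have ih := ih fun t ht => hC t (ht.trans hle)
    set e := Y (j * h) - euler b h x f j with he
    set D : ℝ≥0 → ℝ := fun M => ∫ s in (0 : ℝ)..M,
        ‖g s.toNNReal - g ((⌈s.toNNReal / h⌉₊ : ℝ≥0) * h)‖ with hD
    have hCnn : 0 ≤ C := (norm_nonneg _).trans (hC 0 zero_le)
    -- the local integration error
    set I := (∫ s in ((j * h : ℝ≥0) : ℝ)..((j + 1 : ℕ) * h : ℝ≥0), g s.toNNReal) -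
      (h : ℝ) • g ((j + 1 : ℕ) * h) with hI
    have hIbound : ‖I‖ ≤ D ((j + 1 : ℕ) * h) - D (j * h) := by
      have e1 : I = ∫ s in ((j * h : ℝ≥0) : ℝ)..((j + 1 : ℕ) * h : ℝ≥0),
          (g s.toNNReal - g ((j + 1 : ℕ) * h)) := by
        rw [intervalIntegral.integral_sub (hg.intervalIntegrable _ _) intervalIntegrable_const,
          intervalIntegral.integral_const, hI]
        congr 2
        push_cast; ring
      have e2 : D ((j + 1 : ℕ) * h) - D (j * h) =
          ∫ s in ((j * h : ℝ≥0) : ℝ)..((j + 1 : ℕ) * h : ℝ≥0),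
            ‖g s.toNNReal - g ((⌈s.toNNReal / h⌉₊ : ℝ≥0) * h)‖ := by
        have := intervalIntegral.integral_add_adjacent_intervals (hint 0 (j * h))
          (hint (j * h) ((j + 1 : ℕ) * h))
        simp only [NNReal.coe_zero] at this
        rw [hD]
        simp only
        rw [← this]; ring
      rw [e1, e2]
      refine (intervalIntegral.norm_integral_le_integral_norm (NNReal.coe_le_coe.2 hle)).trans
        (le_of_eq ?_)
      refine intervalIntegral.integral_congr_ae (Eventually.of_forall fun s hs => ?_)
      rw [Set.uIoc_of_le (NNReal.coe_le_coe.2 hle)] at hs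
      have hs0 : 0 ≤ s := (NNReal.coe_nonneg _).trans hs.1.le
      have hceil : ⌈s.toNNReal / h⌉₊ = j + 1 := by
        rw [Nat.ceil_eq_iff (by simp)]
        have c1 : (j : ℝ≥0) * h < s.toNNReal := by
          rw [← NNReal.coe_lt_coe, Real.coe_toNNReal _ hs0]; exact hs.1
        have c2 : s.toNNReal ≤ ((j + 1 : ℕ) : ℝ≥0) * h := by
          rw [← NNReal.coe_le_coe, Real.coe_toNNReal _ hs0]; exact hs.2
        constructor
        · rw [lt_div_iff₀ hh]; simpa using c1
        · rw [div_le_iff₀ hh]; exact c2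
      rw [hceil]
    -- The noise is additive, so its increments cancel exactly.
    have hdecomp : Y ((j + 1 : ℕ) * h) - euler b h x f (j + 1) -
        (h : ℝ) • (g ((j + 1 : ℕ) * h) - g 0) =
        (e - (h : ℝ) • (g (j * h) - g 0)) + I +
          (h : ℝ) • (g (j * h) - b (euler b h x f j)) := by
      have h1 := hY.sub_eq hb.continuous (j * h) ((j + 1 : ℕ) * h)
      have h1' : Y ((j + 1 : ℕ) * h) = Y (j * h) +
        ((∫ r in ((j * h : ℝ≥0) : ℝ)..((j + 1 : ℕ) * h : ℝ≥0), b (Y r.toNNReal)) +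
          !₂[f ((j + 1 : ℕ) * h) - f (j * h), 0]) := by
        rw [← h1]; abel
      rw [he, hI, euler, h1']
      simp only [hgdef, smul_sub]
      abel
    have hlip : ‖g (j * h) - b (euler b h x f j)‖ ≤ L * ‖e‖ := by
      rw [he, ← dist_eq_norm, ← dist_eq_norm]
      exact hb.dist_le_mul _ _
    -- Returning from the corrected error to the error itself costs `2 * h * C`; the Lipschitz bound
    -- of `b` needs the latter.
    have he_le : ‖e‖ ≤ ‖e - (h : ℝ) • (g (j * h) - g 0)‖ + 2 * h * C := by
      have : e = (e - (h : ℝ) • (g (j * h) - g 0)) + (h : ℝ) • (g (j * h) - g 0) := by abel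
      calc ‖e‖ = ‖(e - (h : ℝ) • (g (j * h) - g 0)) + (h : ℝ) • (g (j * h) - g 0)‖ := by
            rw [← this]
        _ ≤ ‖e - (h : ℝ) • (g (j * h) - g 0)‖ + ‖(h : ℝ) • (g (j * h) - g 0)‖ := norm_add_le _ _
        _ ≤ ‖e - (h : ℝ) • (g (j * h) - g 0)‖ + 2 * h * C := by
          gcongr
          rw [norm_smul, Real.norm_of_nonneg h.coe_nonneg]
          have := norm_sub_le (g (j * h)) (g 0)
          have := hC _ hle
          have := hC 0 zero_le
          calc (h : ℝ) * ‖g (j * h) - g 0‖ ≤ h * (C + C) := by gcongr; linarith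
            _ = 2 * h * C := by ring
    rw [hdecomp]
    set A := ‖e - (h : ℝ) • (g (j * h) - g 0)‖
    have hjh : ((j + 1 : ℕ) : ℝ) * h = j * h + h := by push_cast; ring
    have hstep : ‖(e - (h : ℝ) • (g (j * h) - g 0)) + I +
        (h : ℝ) • (g (j * h) - b (euler b h x f j))‖ ≤
        A * (1 + L * h) + (D ((j + 1 : ℕ) * h) - D (j * h)) + 2 * h * L * C * h := by
      calc _ ≤ A + ‖I‖ + ‖(h : ℝ) • (g (j * h) - b (euler b h x f j))‖ := norm_add₃_le
        _ ≤ A + (D ((j + 1 : ℕ) * h) - D (j * h)) + h * (L * (A + 2 * h * C)) := by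
          gcongr
          rw [norm_smul, Real.norm_of_nonneg h.coe_nonneg]
          gcongr
          exact hlip.trans (by gcongr)
        _ = _ := by ring
    refine hstep.trans ?_
    have hexp1 : 1 + (L : ℝ) * h ≤ Real.exp (L * h) := by
      rw [add_comm]; exact Real.add_one_le_exp _
    have hexp2 : Real.exp (L * ((j + 1 : ℕ) * h)) = Real.exp (L * (j * h)) * Real.exp (L * h) := by
      rw [← Real.exp_add, hjh]; ring_nf
    have hexp3 : 1 ≤ Real.exp (L * ((j + 1 : ℕ) * h)) := Real.one_le_exp (by positivity)
    have hDd : 0 ≤ D ((j + 1 : ℕ) * h) - D (j * h) := (norm_nonneg _).trans hIbound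
    calc A * (1 + L * h) + (D ((j + 1 : ℕ) * h) - D (j * h)) + 2 * h * L * C * h
        ≤ (Real.exp (L * (j * h)) * (D (j * h) + 2 * h * L * C * (j * h))) * Real.exp (L * h) +
          Real.exp (L * ((j + 1 : ℕ) * h)) *
            ((D ((j + 1 : ℕ) * h) - D (j * h)) + 2 * h * L * C * h) := by
          rw [add_assoc]
          refine add_le_add (mul_le_mul ih hexp1 (by positivity) ((norm_nonneg _).trans ih)) ?_
          exact le_mul_of_one_le_left (by positivity) hexp3
      _ = _ := by rw [hexp2, hjh]; ring

/-- Convergence of the Euler scheme, uniformly on bounded time intervals. -/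
lemma IsDriven.tendsto_sub_euler {L : ℝ≥0} (hY : IsDriven b x f Y) (hf : f 0 = 0)
    (hb : LipschitzWith L b) {ι : Type*} {l : Filter ι} {h : ι → ℝ≥0} {j : ι → ℕ} {M : ℝ≥0}
    (hh : Tendsto h l (𝓝[>] 0)) (hM : ∀ᶠ i in l, (j i : ℝ≥0) * h i ≤ M) :
    Tendsto (fun i => Y (j i * h i) - euler b (h i) x f (j i)) l (𝓝 0) := by
  have hg := hY.cadlag.comp_continuous hb.continuous
  obtain ⟨C, hC⟩ := hg.exists_norm_le M
  have hCnn : 0 ≤ C := (norm_nonneg _).trans (hC 0 zero_le)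
  have hh0 : Tendsto (fun i => (h i : ℝ)) l (𝓝 0) := by
    simpa using NNReal.tendsto_coe.2 (tendsto_nhds_of_tendsto_nhdsWithin hh)
  have hbound : Tendsto (fun i => Real.exp (L * M) * ((∫ s in (0 : ℝ)..M,
        ‖b (Y s.toNNReal) - b (Y ((⌈s.toNNReal / h i⌉₊ : ℝ≥0) * h i))‖) +
          2 * h i * L * C * M) + h i * (C + C)) l (𝓝 0) := by
    have h1 := (hg.tendsto_integral_norm_sub_grid M).comp hh
    have h2 := ((h1.add ((((hh0.const_mul 2).mul_const (L : ℝ)).mul_const C).mul_const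
      (M : ℝ))).const_mul (Real.exp (L * M))).add (hh0.mul_const (C + C))
    simpa using h2
  refine squeeze_zero_norm' ?_ hbound
  filter_upwards [hM, hh self_mem_nhdsWithin] with i hi hpos
  have hpos : 0 < h i := hpos
  have key := hY.norm_sub_euler_le hf hb hpos (j := j i) (C := C)
    fun t ht => hC t (ht.trans hi)
  have hi' : (j i : ℝ) * h i ≤ M := by exact_mod_cast hi
  have hnn : ∀ s : ℝ, 0 ≤ ‖b (Y s.toNNReal) - b (Y ((⌈s.toNNReal / h i⌉₊ : ℝ≥0) * h i))‖ :=
    fun s => norm_nonneg _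
  have hmono : (∫ s in (0 : ℝ)..((j i : ℝ≥0) * h i : ℝ≥0),
        ‖b (Y s.toNNReal) - b (Y ((⌈s.toNNReal / h i⌉₊ : ℝ≥0) * h i))‖) ≤
      ∫ s in (0 : ℝ)..M,
        ‖b (Y s.toNNReal) - b (Y ((⌈s.toNNReal / h i⌉₊ : ℝ≥0) * h i))‖ := by
    refine intervalIntegral.integral_mono_interval le_rfl (NNReal.coe_nonneg _)
      (NNReal.coe_le_coe.2 hi) (Eventually.of_forall hnn) ?_
    have h0 := (hg.intervalIntegrable 0 M)
    rw [NNReal.coe_zero] at h0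
    refine (h0.sub ?_).norm
    obtain ⟨C, hC⟩ := hg.exists_norm_le (M + h i)
    refine (intervalIntegrable_const (c := C)).mono_fun
      ((measurable_comp_ceil_mul (fun t => b (Y t)) (h i)).comp
        measurable_real_toNNReal).aestronglyMeasurable ?_
    rw [EventuallyLE, ae_restrict_iff' measurableSet_uIoc]
    refine Eventually.of_forall fun r hr => ?_
    rw [Set.uIoc_of_le M.coe_nonneg] at hr
    have : r.toNNReal ≤ M := Real.toNNReal_le_iff_le_coe.2 hr.2
    exact (hC _ ((ceil_mul_le hpos).trans (add_le_add_left this _))).trans (le_abs_self C)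
  calc ‖Y (j i * h i) - euler b (h i) x f (j i)‖
      ≤ ‖Y (j i * h i) - euler b (h i) x f (j i) -
          (h i : ℝ) • (b (Y (j i * h i)) - b (Y 0))‖ +
        ‖(h i : ℝ) • (b (Y (j i * h i)) - b (Y 0))‖ := by
        have := norm_sub_norm_le (Y (j i * h i) - euler b (h i) x f (j i))
          ((h i : ℝ) • (b (Y (j i * h i)) - b (Y 0)))
        linarith
    _ ≤ _ := by
        refine add_le_add (key.trans ?_) ?_
        · have hInn : 0 ≤ ∫ s in (0 : ℝ)..((j i : ℝ≥0) * h i : ℝ≥0),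
              ‖b (Y s.toNNReal) - b (Y ((⌈s.toNNReal / h i⌉₊ : ℝ≥0) * h i))‖ :=
            intervalIntegral.integral_nonneg (NNReal.coe_nonneg _) fun s _ => hnn s
          gcongr
        · rw [norm_smul, Real.norm_of_nonneg (h i).coe_nonneg]
          gcongr
          exact (norm_sub_le _ _).trans (add_le_add (hC _ hi) (hC _ zero_le))

end EulerConvergence

lemma exists_lipschitzWith_drift (lam1 lam2 : ℝ) {F : Plane → Plane}
    (hF : ∃ L : ℝ≥0, LipschitzWith L F) :
    ∃ L : ℝ≥0, LipschitzWith L (drift lam1 lam2 F) := by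
  obtain ⟨L, hL⟩ := hF
  let A : Plane →ₗ[ℝ] Plane :=
    { toFun := fun v => !₂[-lam1 * v 0, -lam2 * v 1]
      map_add' := fun v w => by ext i; fin_cases i <;> simp <;> ring
      map_smul' := fun c v => by ext i; fin_cases i <;> simp <;> ring }
  exact ⟨_, (LinearMap.toContinuousLinearMap A).lipschitz.add hL⟩

/-! ### The first big jump as a measurable functional of the path. -/

/-- A measurable version of `firstBigJump`. -/
def bigJumpClock (T : ℝ≥0) (K : ℝ) (f : ℝ≥0 → ℝ) : ℝ≥0 :=
  (⨅ i : ℕ, (denseOscillation T K (TopologicalSpace.denseSeq ℝ≥0 i))ᶜ.indicator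
    (fun _ => (∞ : ℝ≥0∞)) f + TopologicalSpace.denseSeq ℝ≥0 i).toNNReal

lemma measurable_bigJumpClock (T : ℝ≥0) (K : ℝ) : Measurable (bigJumpClock T K) := by
  refine (Measurable.iInf fun i => ?_).ennreal_toNNReal
  exact (measurable_const.indicator (measurableSet_denseOscillation T K _).compl).add_const _

lemma IsCadlag.bigJumpClock_eq {f : ℝ≥0 → ℝ} (hf : IsCadlag f) {T : ℝ≥0} {K : ℝ} (hK : 0 < K)
    (hne : (bigJumpTimes T K f).Nonempty) : bigJumpClock T K f = firstBigJump T K f := by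
  have hmem := hf.firstBigJump_mem hK hne
  set s := firstBigJump T K f
  -- Holds because the infimum `s` is attained. The clock is then the infimum of the dense times
  -- beyond `s`, all others being sent to `∞`.
  have hiff : ∀ t, f ∈ denseOscillation T K t ↔ s < t := by
    intro t
    rw [hf.mem_denseOscillation_iff hK]
    constructor
    · rintro ⟨u, hu, hut⟩
      exact (csInf_le (OrderBot.bddBelow _) hu).trans_lt hut
    · intro h; exact ⟨s, hmem, h⟩
  have : (⨅ i : ℕ, (denseOscillation T K (TopologicalSpace.denseSeq ℝ≥0 i))ᶜ.indicator
    (fun _ => (∞ : ℝ≥0∞)) f + TopologicalSpace.denseSeq ℝ≥0 i) = s := by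
    refine le_antisymm ?_ ?_
    · refine le_of_forall_gt fun c hc => ?_
      obtain ⟨r, hr1, hr2⟩ := ENNReal.lt_iff_exists_nnreal_btwn.1 hc
      obtain ⟨_, ⟨i, rfl⟩, hi1, hi2⟩ :=
        (TopologicalSpace.denseRange_denseSeq ℝ≥0).exists_between (ENNReal.coe_lt_coe.1 hr1)
      refine (iInf_le _ i).trans_lt ?_
      rw [Set.indicator_of_notMem (by simpa using (hiff _).2 hi1), zero_add]
      exact (ENNReal.coe_lt_coe.2 hi2).trans hr2
    · refine le_iInf fun i => ?_
      by_cases hi : f ∈ denseOscillation T K (TopologicalSpace.denseSeq ℝ≥0 i)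
      · rw [Set.indicator_of_notMem (by simpa using hi), zero_add]
        exact ENNReal.coe_le_coe.2 ((hiff _).1 hi).le
      · rw [Set.indicator_of_mem (by simpa using hi)]
        simp
  rw [bigJumpClock, this, ENNReal.toNNReal_coe]

/-- The mesh of the grids used for approximating evaluations at random times. -/
def gridStep (n : ℕ) : ℝ≥0 := 1 / ((n : ℝ≥0) + 1)

lemma gridStep_pos (n : ℕ) : 0 < gridStep n := by unfold gridStep; positivity

lemma tendsto_gridStep : Tendsto gridStep atTop (𝓝[>] 0) :=
  tendsto_nhdsWithin_iff.2 ⟨tendsto_one_div_add_atTop_nhds_zero_nat,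
      Eventually.of_forall gridStep_pos⟩

/-- The index of the first grid point after `s`. -/
def gridIndex (s : ℝ≥0) (n : ℕ) : ℕ := ⌈s / gridStep n⌉₊

lemma measurable_gridIndex (n : ℕ) : Measurable fun s => gridIndex s n :=
  Nat.measurable_ceil.comp (measurable_id.div_const _)

lemma le_gridIndex_mul (s : ℝ≥0) (n : ℕ) : s ≤ (gridIndex s n : ℝ≥0) * gridStep n :=
  le_ceil_mul (gridStep_pos n)

lemma tendsto_gridIndex_mul (s : ℝ≥0) :
    Tendsto (fun n => (gridIndex s n : ℝ≥0) * gridStep n) atTop (𝓝 s) :=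
  (tendsto_ceil_mul_nhds s).comp tendsto_gridStep

/-- The preceding grid point is strictly earlier even when `s` lies on the grid. Since `s > 0` the
index is at least `1`, so the subtraction is not truncated. -/
lemma gridIndex_pred_mul_lt {s : ℝ≥0} (hs : 0 < s) (n : ℕ) :
    ((gridIndex s n - 1 : ℕ) : ℝ≥0) * gridStep n < s := by
  rw [← lt_div_iff₀ (gridStep_pos n)]
  refine Nat.lt_ceil.1 (Nat.sub_lt ?_ one_pos)
  exact Nat.ceil_pos.2 (div_pos hs (gridStep_pos n))

lemma tendsto_gridIndex_pred_mul {s : ℝ≥0} (hs : 0 < s) :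
    Tendsto (fun n => ((gridIndex s n - 1 : ℕ) : ℝ≥0) * gridStep n) atTop (𝓝 s) := by
  have h := (NNReal.tendsto_coe.2 (tendsto_gridIndex_mul s)).sub
    (NNReal.tendsto_coe.2 (tendsto_nhds_of_tendsto_nhdsWithin tendsto_gridStep))
  rw [NNReal.coe_zero, sub_zero] at h
  rw [← NNReal.tendsto_coe]
  refine h.congr fun n => ?_
  have : 1 ≤ gridIndex s n := Nat.ceil_pos.2 (div_pos hs (gridStep_pos n))
  rw [NNReal.coe_mul, NNReal.coe_mul, NNReal.coe_natCast, NNReal.coe_natCast, Nat.cast_sub this]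
  push_cast
  ring

lemma measurable_comp_index {α β : Type*} [MeasurableSpace α] [MeasurableSpace β]
    {u : ℕ → α → β} (hu : ∀ n, Measurable (u n)) {N : α → ℕ} (hN : Measurable N) :
    Measurable fun a => u (N a) a := by
  have : Measurable fun p : ℕ × α => u p.1 p.2 :=
    measurable_from_prod_countable_right hu
  exact this.comp (hN.prodMk measurable_id)

/-- The value of the solution just before its first big jump, as a functional of the noise. -/
def preValue (b : Plane → Plane) (T : ℝ≥0) (K : ℝ) (x : Plane) (f : ℝ≥0 → ℝ) : Plane :=
  limUnder atTop fun n =>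
    euler b (gridStep n) x f (gridIndex (bigJumpClock T K f) n - 1)

/-- The first big jump, as a functional of the noise. -/
def jumpValue (T : ℝ≥0) (K : ℝ) (f : ℝ≥0 → ℝ) : ℝ :=
  limUnder atTop fun n =>
    f (gridIndex (bigJumpClock T K f) n * gridStep n) -
      f ((gridIndex (bigJumpClock T K f) n - 1 : ℕ) * gridStep n)

/-- The value of the solution at its first big jump, as a functional of the noise. -/
def postValue (b : Plane → Plane) (T : ℝ≥0) (K : ℝ) (x : Plane) (f : ℝ≥0 → ℝ) : Plane :=
  preValue b T K x f + !₂[jumpValue T K f, 0]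

/-- The noise after the first big jump, as a functional of the noise. -/
def postPath (T : ℝ≥0) (K : ℝ) (f : ℝ≥0 → ℝ) : ℝ≥0 → ℝ := fun t =>
  limUnder atTop fun n =>
    f (gridIndex (bigJumpClock T K f) n * gridStep n + t) -
      f (gridIndex (bigJumpClock T K f) n * gridStep n)

/-- Keeps the functionals total: sequences that diverge receive a default value, so measurability
holds on the whole path space and not only on càdlàg paths. -/
lemma measurable_limUnder {α E : Type*} [MeasurableSpace α] [TopologicalSpace E]
    [PolishSpace E] [MeasurableSpace E] [BorelSpace E] [Nonempty E] {u : ℕ → α → E}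
    (hu : ∀ n, Measurable (u n)) : Measurable fun a => limUnder atTop fun n => u n a :=
  (StronglyMeasurable.limUnder fun n => (hu n).stronglyMeasurable).measurable

lemma measurable_preValue {b : Plane → Plane} (hb : Measurable b) (T : ℝ≥0) (K : ℝ) :
    Measurable fun p : Plane × (ℝ≥0 → ℝ) => preValue b T K p.1 p.2 := by
  refine measurable_limUnder fun n => ?_
  refine measurable_comp_index (u := fun j (p : Plane × (ℝ≥0 → ℝ)) =>
    euler b (gridStep n) p.1 p.2 (j - 1)) (fun j => measurable_euler hb _ _)
    (N := fun p => gridIndex (bigJumpClock T K p.2) n) ?_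
  exact (measurable_gridIndex n).comp ((measurable_bigJumpClock T K).comp measurable_snd)

lemma measurable_jumpValue (T : ℝ≥0) (K : ℝ) : Measurable (jumpValue T K) := by
  refine measurable_limUnder fun n => ?_
  refine measurable_comp_index (u := fun j (f : ℝ≥0 → ℝ) =>
    f (j * gridStep n) - f ((j - 1 : ℕ) * gridStep n)) (fun j => ?_)
    (N := fun p => gridIndex (bigJumpClock T K p) n) ?_
  · exact (measurable_pi_apply _).sub (measurable_pi_apply _)
  · exact (measurable_gridIndex n).comp (measurable_bigJumpClock T K)

lemma measurable_postValue {b : Plane → Plane} (hb : Measurable b) (T : ℝ≥0) (K : ℝ) :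
    Measurable fun p : Plane × (ℝ≥0 → ℝ) => postValue b T K p.1 p.2 :=
  (measurable_preValue hb T K).add
    (measurable_planeVec ((measurable_jumpValue T K).comp measurable_snd) measurable_const)

lemma measurable_postPath (T : ℝ≥0) (K : ℝ) : Measurable (postPath T K) := by
  refine measurable_pi_lambda _ fun t => measurable_limUnder fun n => ?_
  refine measurable_comp_index (u := fun j (f : ℝ≥0 → ℝ) =>
    f (j * gridStep n + t) - f (j * gridStep n)) (fun j => ?_)
    (N := fun p => gridIndex (bigJumpClock T K p) n) ?_
  · exact (measurable_pi_apply _).sub (measurable_pi_apply _)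
  · exact (measurable_gridIndex n).comp (measurable_bigJumpClock T K)

section Evaluation

variable {b : Plane → Plane} {x : Plane} {f : ℝ≥0 → ℝ} {Y : ℝ≥0 → Plane} {T : ℝ≥0} {K : ℝ}

lemma IsCadlag.firstBigJump_pos (hf : IsCadlag f) (hK : 0 < K)
    (hne : (bigJumpTimes T K f).Nonempty) : 0 < firstBigJump T K f :=
  zero_le.trans_lt (hf.firstBigJump_mem hK hne).1

/-- Along grid points strictly before the jump time `Y` tends to its left limit, and the Euler error
tends to `0`. -/
lemma IsDriven.preValue_eq {L : ℝ≥0} (hY : IsDriven b x f Y) (hb : LipschitzWith L b)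
    (hf : IsCadlag f) (hf0 : f 0 = 0) (hK : 0 < K) (hne : (bigJumpTimes T K f).Nonempty) :
    preValue b T K x f = Function.leftLim Y (firstBigJump T K f) := by
  have hpos := hf.firstBigJump_pos hK hne
  rw [preValue, hf.bigJumpClock_eq hK hne]
  refine Tendsto.limUnder_eq ?_
  have h1 := hY.tendsto_sub_euler hf0 hb (l := atTop) (h := gridStep)
    (j := fun n => gridIndex (firstBigJump T K f) n - 1) (M := firstBigJump T K f)
    tendsto_gridStep (Eventually.of_forall fun n => (gridIndex_pred_mul_lt hpos n).le)
  have h2 := hY.cadlag.tendsto_left (tendsto_gridIndex_pred_mul hpos)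
    (Eventually.of_forall fun n => gridIndex_pred_mul_lt hpos n)
  simpa using h2.sub h1

lemma IsCadlag.jumpValue_eq (hf : IsCadlag f) (hK : 0 < K)
    (hne : (bigJumpTimes T K f).Nonempty) :
    jumpValue T K f = jump f (firstBigJump T K f) := by
  have hpos := hf.firstBigJump_pos hK hne
  rw [jumpValue, hf.bigJumpClock_eq hK hne]
  refine Tendsto.limUnder_eq ?_
  exact (hf.tendsto_right (tendsto_gridIndex_mul _)
    (Eventually.of_forall fun n => le_gridIndex_mul _ n)).sub
    (hf.tendsto_left (tendsto_gridIndex_pred_mul hpos)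
    (Eventually.of_forall fun n => gridIndex_pred_mul_lt hpos n))

lemma IsCadlag.postPath_eq (hf : IsCadlag f) (hK : 0 < K)
    (hne : (bigJumpTimes T K f).Nonempty) :
    postPath T K f = DegenerateLevy.shiftPath (firstBigJump T K f) f := by
  funext t
  rw [postPath, hf.bigJumpClock_eq hK hne]
  refine Tendsto.limUnder_eq ?_
  exact (hf.tendsto_right ((tendsto_gridIndex_mul _).add_const t)
    (Eventually.of_forall fun n => add_le_add_left (le_gridIndex_mul _ n) t)).sub
    (hf.tendsto_right (tendsto_gridIndex_mul _)
    (Eventually.of_forall fun n => le_gridIndex_mul _ n))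

/-- The drift integral is continuous in time, so the solution jumps only with its noise. -/
lemma IsDriven.eq_leftLim_add_jump (hY : IsDriven b x f Y) (hb : Continuous b)
    (hf : IsCadlag f) {t : ℝ≥0} (ht : 0 < t) :
    Y t = Function.leftLim Y t + !₂[jump f t, 0] := by
  have : (𝓝[<] t).NeBot := nhdsLT_neBot_of_exists_lt ⟨0, ht⟩
  obtain ⟨C, hC⟩ := (hY.cadlag.comp_continuous hb).exists_norm_le t
  have hle : ∀ᶠ u in 𝓝[<] t, u ≤ t := by
    filter_upwards [self_mem_nhdsWithin] with u hu using le_of_lt hu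
  have hI : Tendsto (fun u : ℝ≥0 => ∫ r in (u : ℝ)..t, b (Y r.toNNReal)) (𝓝[<] t) (𝓝 0) := by
    have hz : Tendsto (fun u : ℝ≥0 => C * |(t : ℝ) - u|) (𝓝[<] t) (𝓝 0) := by
      have : Tendsto (fun u : ℝ≥0 => C * |(t : ℝ) - u|) (𝓝 t) (𝓝 (C * |(t : ℝ) - t|)) := by
        apply Continuous.tendsto; fun_prop
      simpa using this.mono_left nhdsWithin_le_nhds
    refine squeeze_zero_norm' ?_ hz
    filter_upwards [hle] with u hu
    refine intervalIntegral.norm_integral_le_of_norm_le_const fun r hr => ?_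
    rw [Set.uIoc_of_le (NNReal.coe_le_coe.2 hu)] at hr
    exact hC _ (Real.toNNReal_le_iff_le_coe.2 hr.2)
  have hJ : Tendsto (fun u : ℝ≥0 => (!₂[f t - f u, 0] : Plane)) (𝓝[<] t)
      (𝓝 !₂[jump f t, 0]) := by
    have hc : Continuous fun y : ℝ => (!₂[f t - y, 0] : Plane) := by fun_prop
    exact (hc.tendsto _).comp (hf.tendsto_leftLim t)
  have h1 : Tendsto (fun u => Y t - Y u) (𝓝[<] t) (𝓝 (0 + !₂[jump f t, 0])) := by
    refine (hI.add hJ).congr fun u => ?_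
    rw [hY.sub_eq hb u t]
  have h2 := tendsto_nhds_unique h1 ((hY.cadlag.tendsto_leftLim t).const_sub (Y t))
  rw [zero_add] at h2
  rw [h2]; abel

lemma IsDriven.postValue_eq {L : ℝ≥0} (hY : IsDriven b x f Y) (hb : LipschitzWith L b)
    (hf : IsCadlag f) (hf0 : f 0 = 0) (hK : 0 < K) (hne : (bigJumpTimes T K f).Nonempty) :
    postValue b T K x f = Y (firstBigJump T K f) := by
  rw [postValue, hY.preValue_eq hb hf hf0 hK hne, hf.jumpValue_eq hK hne,
    ← hY.eq_leftLim_add_jump hb.continuous hf (hf.firstBigJump_pos hK hne)]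

end Evaluation

/-! ### Small-time asymptotics of a Lévy process from characteristic functions. -/

/-- The weight `∫₀¹ (1 - cos (u y)) du`, comparable with `min 1 y²`. -/
def levyWeight (y : ℝ) : ℝ := ∫ u in (0 : ℝ)..1, (1 - Real.cos (u * y))

lemma continuous_levyWeight : Continuous levyWeight :=
  intervalIntegral.continuous_parametric_intervalIntegral_of_continuous' (by fun_prop) 0 1

lemma one_sub_cos_le (u y : ℝ) (hu : u ∈ Set.Icc (0 : ℝ) 1) :
    1 - Real.cos (u * y) ≤ 2 * min 1 (y ^ 2) := by
  rw [mul_min_of_nonneg _ _ two_pos.le]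
  refine le_min ?_ ?_
  · linarith [Real.neg_one_le_cos (u * y)]
  · have h1 := Real.one_sub_sq_div_two_le_cos (x := u * y)
    have h2 : (u * y) ^ 2 ≤ y ^ 2 := by
      rw [mul_pow]
      exact mul_le_of_le_one_left (sq_nonneg y) (pow_le_one₀ hu.1 hu.2)
    nlinarith [sq_nonneg y]

lemma intervalIntegrable_one_sub_cos (y : ℝ) :
    IntervalIntegrable (fun u => 1 - Real.cos (u * y)) volume 0 1 :=
  Continuous.intervalIntegrable (by fun_prop) _ _

lemma levyWeight_nonneg (y : ℝ) : 0 ≤ levyWeight y :=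
  intervalIntegral.integral_nonneg zero_le_one fun u _ => by linarith [Real.cos_le_one (u * y)]

lemma levyWeight_le (y : ℝ) : levyWeight y ≤ 2 * min 1 (y ^ 2) := by
  have := intervalIntegral.integral_mono_on (a := (0 : ℝ)) (b := 1) zero_le_one
    (intervalIntegrable_one_sub_cos y) (intervalIntegrable_const (c := 2 * min 1 (y ^ 2)))
    fun u hu => one_sub_cos_le u y hu
  simpa [levyWeight] using this

lemma levyWeight_eq {y : ℝ} (hy : y ≠ 0) : levyWeight y = 1 - Real.sin y / y := by
  rw [levyWeight, intervalIntegral.integral_sub intervalIntegrable_const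
    (Continuous.intervalIntegrable (by fun_prop) _ _),
    intervalIntegral.integral_comp_mul_right _ hy]
  simp [div_eq_inv_mul]

lemma levyWeight_abs (y : ℝ) : levyWeight |y| = levyWeight y := by
  rcases abs_choice y with h | h
  · rw [h]
  · rw [h]; simp [levyWeight]

lemma levyWeight_pos {y : ℝ} (hy : 0 < y) : 0 < levyWeight y := by
  rw [levyWeight_eq hy.ne', sub_pos, div_lt_one hy]
  exact Real.sin_lt hy

/-- Compactness on `[δ, max δ 2]`; beyond `2` the quotient `sin y / y` is at most `1 / 2`. -/
lemma exists_le_levyWeight {δ : ℝ} (hδ : 0 < δ) :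
    ∃ c > 0, ∀ y, δ ≤ |y| → c ≤ levyWeight y := by
  obtain ⟨y₀, hy₀, hmin⟩ := (isCompact_Icc (a := δ) (b := max δ 2)).exists_isMinOn
    ⟨δ, le_rfl, le_max_left _ _⟩ continuous_levyWeight.continuousOn
  refine ⟨min (levyWeight y₀) (1 / 2), lt_min (levyWeight_pos (hδ.trans_le hy₀.1)) (by norm_num),
    fun y hy => ?_⟩
  rw [← levyWeight_abs y]
  rcases le_total |y| (max δ 2) with h | h
  · exact (min_le_left _ _).trans (isMinOn_iff.1 hmin _ ⟨hy, h⟩)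
  · refine (min_le_right _ _).trans ?_
    have h2 : 2 ≤ |y| := (le_max_right _ _).trans h
    rw [levyWeight_eq (by linarith)]
    have : Real.sin |y| / |y| ≤ 1 / 2 := by
      rw [div_le_iff₀ (by linarith)]
      linarith [Real.sin_le_one |y|]
    linarith

section Fourier

variable {μ : Measure ℝ}

lemma norm_exp_I_mul (a : ℝ) : ‖Complex.exp (a * Complex.I)‖ = 1 := Complex.norm_exp_ofReal_mul_I a

/-- Fubini for the weighted Fourier transform. -/
lemma integral_exp_mul_levyWeight [SFinite μ] (hμ : Integrable (fun y => min 1 (y ^ 2)) μ) (ξ : ℝ) :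
    ∫ y, Complex.exp ((ξ * y : ℝ) * Complex.I) * levyWeight y ∂μ =
      ∫ u in (0 : ℝ)..1, ∫ y, Complex.exp ((ξ * y : ℝ) * Complex.I) *
        ((1 - Real.cos (u * y) : ℝ) : ℂ) ∂μ := by
  rw [intervalIntegral.integral_of_le zero_le_one]
  rw [integral_integral_swap (f := fun u y => Complex.exp ((ξ * y : ℝ) * Complex.I) *
        ((1 - Real.cos (u * y) : ℝ) : ℂ))]
  · refine integral_congr_ae (Eventually.of_forall fun y => ?_)
    simp only
    rw [integral_const_mul, ← intervalIntegral.integral_of_le zero_le_one,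
      intervalIntegral.integral_ofReal]
    rfl
  · have hb : Integrable (fun p : ℝ × ℝ => 2 * min 1 (p.2 ^ 2))
        ((volume.restrict (Set.Ioc 0 1)).prod μ) := (hμ.const_mul 2).comp_snd _
    refine hb.mono' (Continuous.aestronglyMeasurable (by fun_prop)) ?_
    have : ∀ᵐ u ∂(volume.restrict (Set.Ioc (0 : ℝ) 1)), u ∈ Set.Ioc (0 : ℝ) 1 :=
      ae_restrict_mem measurableSet_Ioc
    have h3 : ∀ᵐ p ∂((volume.restrict (Set.Ioc (0 : ℝ) 1)).prod μ), p.1 ∈ Set.Ioc (0 : ℝ) 1 :=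
      Measure.quasiMeasurePreserving_fst.ae this
    filter_upwards [h3] with p hp
    have hp' : p.1 ∈ Set.Icc (0 : ℝ) 1 := ⟨hp.1.le, hp.2⟩
    simp only [Function.uncurry]
    rw [norm_mul, norm_exp_I_mul, one_mul, Complex.norm_real, Real.norm_of_nonneg]
    · exact one_sub_cos_le _ _ hp'
    · linarith [Real.cos_le_one (p.1 * p.2)]

/-- The factor `1 - cos (u y)` turns a character into a second difference in frequency, so weighted
transforms are expressed through the characteristic function alone. -/
lemma ofReal_cos_mul_exp (ξ u y : ℝ) :
    Complex.exp ((ξ * y : ℝ) * Complex.I) * ((1 - Real.cos (u * y) : ℝ) : ℂ) =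
      Complex.exp ((ξ * y : ℝ) * Complex.I) -
        (Complex.exp (((ξ + u) * y : ℝ) * Complex.I) +
          Complex.exp (((ξ - u) * y : ℝ) * Complex.I)) / 2 := by
  have e1 : Complex.exp (((ξ + u) * y : ℝ) * Complex.I) =
      Complex.exp ((ξ * y : ℝ) * Complex.I) * Complex.exp ((u * y : ℝ) * Complex.I) := by
    rw [← Complex.exp_add]; congr 1; push_cast; ring
  have e2 : Complex.exp (((ξ - u) * y : ℝ) * Complex.I) =
      Complex.exp ((ξ * y : ℝ) * Complex.I) * Complex.exp (-(u * y : ℝ) * Complex.I) := by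
    rw [← Complex.exp_add]; congr 1; push_cast; ring
  have e3 : ((Real.cos (u * y) : ℝ) : ℂ) =
      (Complex.exp ((u * y : ℝ) * Complex.I) + Complex.exp (-(u * y : ℝ) * Complex.I)) / 2 := by
    rw [Complex.ofReal_cos, Complex.cos]
  rw [e1, e2, Complex.ofReal_sub, e3, Complex.ofReal_one]
  ring

lemma integral_exp_mul_one_sub_cos [IsFiniteMeasure μ] (ξ u : ℝ) :
    ∫ y, Complex.exp ((ξ * y : ℝ) * Complex.I) * ((1 - Real.cos (u * y) : ℝ) : ℂ) ∂μ =
      charFun μ ξ - (charFun μ (ξ + u) + charFun μ (ξ - u)) / 2 := by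
  have hi : ∀ ξ : ℝ, Integrable (fun y : ℝ => Complex.exp ((ξ * y : ℝ) * Complex.I)) μ := by
    intro ξ
    refine (integrable_const (1 : ℝ)).mono' (Continuous.aestronglyMeasurable (by fun_prop)) ?_
    exact Eventually.of_forall fun y => (norm_exp_I_mul _).le
  simp_rw [ofReal_cos_mul_exp]
  have hs : Integrable (fun y : ℝ => (Complex.exp (((ξ + u) * y : ℝ) * Complex.I) +
      Complex.exp (((ξ - u) * y : ℝ) * Complex.I)) / 2) μ :=
    ((hi (ξ + u)).add (hi (ξ - u))).div_const 2
  rw [integral_sub (hi ξ) hs, integral_div,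
    integral_add (hi _) (hi _)]
  simp_rw [charFun_apply_real]
  push_cast
  rfl

end Fourier

/-- The integrand of the Lévy symbol. -/
def levyIntegrand (ξ y : ℝ) : ℂ :=
  Complex.exp (Complex.I * ξ * y) - 1 -
      Complex.I * ξ * y * (Set.Icc (-1 : ℝ) 1).indicator (fun _ => (1 : ℂ)) y

lemma norm_exp_I_sub_one_sub_le (a : ℝ) :
    ‖Complex.exp (Complex.I * a) - 1 - Complex.I * a‖ ≤ 3 * a ^ 2 := by
  have hn : ‖Complex.I * (a : ℂ)‖ = |a| := by simp
  rcases le_total |a| 1 with h | h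
  · refine (Complex.norm_exp_sub_one_sub_id_le (by rw [hn]; exact h)).trans ?_
    rw [hn, sq_abs]; nlinarith [sq_nonneg a]
  · have h1 : ‖Complex.exp (Complex.I * a) - 1‖ ≤ |a| := Real.norm_exp_I_mul_ofReal_sub_one_le
    have h2 := norm_sub_le (Complex.exp (Complex.I * a) - 1) (Complex.I * a)
    rw [hn] at h2
    rw [← sq_abs]
    nlinarith

lemma norm_levyIntegrand_le (ξ y : ℝ) : ‖levyIntegrand ξ y‖ ≤ (2 + 3 * ξ ^ 2) * min 1 (y ^ 2) := by
  have e : Complex.I * ξ * y = Complex.I * ((ξ * y : ℝ) : ℂ) := by push_cast; ring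
  rw [levyIntegrand, e]
  by_cases hy : y ∈ Set.Icc (-1 : ℝ) 1
  · rw [Set.indicator_of_mem hy, mul_one]
    have hy2 : y ^ 2 ≤ 1 := by
      rw [sq_le_one_iff_abs_le_one]; exact abs_le.2 hy
    rw [min_eq_right hy2]
    refine (norm_exp_I_sub_one_sub_le _).trans ?_
    nlinarith [sq_nonneg y, mul_pow ξ y 2]
  · rw [Set.indicator_of_notMem hy, mul_zero, sub_zero]
    have hy2 : 1 ≤ y ^ 2 := by
      rw [one_le_sq_iff_one_le_abs]
      by_contra h
      exact hy (abs_le.1 (not_le.1 h).le)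
    rw [min_eq_left hy2, mul_one]
    have h1 := norm_sub_le (Complex.exp (Complex.I * ((ξ * y : ℝ) : ℂ))) 1
    rw [mul_comm Complex.I, norm_exp_I_mul, norm_one] at h1
    rw [mul_comm Complex.I]
    nlinarith [sq_nonneg ξ]

lemma measurable_levyIntegrand (ξ : ℝ) : Measurable (levyIntegrand ξ) := by
  have : Measurable fun y : ℝ => (Set.Icc (-1 : ℝ) 1).indicator (fun _ => (1 : ℂ)) y :=
    measurable_const.indicator measurableSet_Icc
  unfold levyIntegrand
  fun_prop

section LevyMeasure

variable {ν : Measure ℝ}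

lemma IsLevyMeasure.integrable (hν : IsLevyMeasure ν) : Integrable (fun y => min 1 (y ^ 2)) ν := by
  refine ⟨Continuous.aestronglyMeasurable (by fun_prop), ?_⟩
  rw [hasFiniteIntegral_iff_ofReal (Eventually.of_forall fun y => by positivity)]
  exact hν.finite

lemma IsLevyMeasure.sigmaFinite (hν : IsLevyMeasure ν) : SigmaFinite ν := by
  refine ⟨⟨⟨fun n => {0} ∪ bigJumps (1 / ((n : ℝ) + 1)), fun _ => trivial, fun n => ?_, ?_⟩⟩⟩
  · refine (measure_union_le _ _).trans_lt ?_
    rw [hν.zero, zero_add]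
    exact hν.bigJumps_lt_top Nat.one_div_pos_of_nat
  · refine Set.eq_univ_of_forall fun y => Set.mem_iUnion.2 ?_
    by_cases hy : y = 0
    · exact ⟨0, Or.inl hy⟩
    · obtain ⟨n, hn⟩ := exists_nat_one_div_lt (abs_pos.2 hy)
      refine ⟨n, Or.inr ?_⟩
      rcases le_abs.1 hn.le with h | h
      · exact Or.inr h
      · exact Or.inl (by simpa using neg_le_neg h)

lemma IsLevyMeasure.levySymbol_eq (hν : IsLevyMeasure ν) (ξ : ℝ) :
    levySymbol ν ξ = ∫ y, levyIntegrand ξ y ∂ν := by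
  have : ν.restrict ({0}ᶜ : Set ℝ) = ν := by
    rw [Measure.restrict_eq_self_of_ae_mem]
    exact compl_mem_ae_iff.2 hν.zero
  rw [levySymbol, this]
  rfl

lemma IsLevyMeasure.integrable_levyIntegrand (hν : IsLevyMeasure ν) (ξ : ℝ) :
    Integrable (levyIntegrand ξ) ν :=
  (hν.integrable.const_mul _).mono' (measurable_levyIntegrand ξ).aestronglyMeasurable
    (Eventually.of_forall (norm_levyIntegrand_le ξ))

lemma IsLevyMeasure.norm_levySymbol_le (hν : IsLevyMeasure ν) (ξ : ℝ) :
    ‖levySymbol ν ξ‖ ≤ (2 + 3 * ξ ^ 2) * ∫ y, min 1 (y ^ 2) ∂ν := by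
  rw [hν.levySymbol_eq, ← integral_const_mul]
  exact norm_integral_le_of_norm_le (hν.integrable.const_mul _)
    (Eventually.of_forall (norm_levyIntegrand_le ξ))

/-- The compensating terms of the Lévy integrand are affine in `ξ`, hence disappear in the second
difference. -/
lemma IsLevyMeasure.integral_exp_mul_one_sub_cos (hν : IsLevyMeasure ν) (ξ u : ℝ) :
    ∫ y, Complex.exp ((ξ * y : ℝ) * Complex.I) * ((1 - Real.cos (u * y) : ℝ) : ℂ) ∂ν =
      levySymbol ν ξ - (levySymbol ν (ξ + u) + levySymbol ν (ξ - u)) / 2 := by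
  have hi := hν.integrable_levyIntegrand
  have hs : Integrable (fun y => (levyIntegrand (ξ + u) y + levyIntegrand (ξ - u) y) / 2) ν :=
    ((hi _).add (hi _)).div_const 2
  rw [hν.levySymbol_eq, hν.levySymbol_eq, hν.levySymbol_eq, ← integral_add (hi _) (hi _),
    ← integral_div, ← integral_sub (hi _) hs]
  refine integral_congr_ae (Eventually.of_forall fun y => ?_)
  simp only
  rw [ofReal_cos_mul_exp]
  have e : ∀ ξ : ℝ, Complex.exp ((ξ * y : ℝ) * Complex.I) = Complex.exp (Complex.I * ξ * y) := by
    intro ξ; congr 1; push_cast; ring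
  rw [e, e, e]
  simp only [levyIntegrand]
  push_cast
  ring

lemma tendsto_cexp_sub_one_div (a : ℂ) {t : ℕ → ℝ} (ht : ∀ n, 0 < t n)
    (ht0 : Tendsto t atTop (𝓝 0)) :
    Tendsto (fun n => (Complex.exp (t n * a) - 1) / t n) atTop (𝓝 a) := by
  have h1 : HasDerivAt (fun s : ℝ => Complex.exp (s * a)) a 0 := by
    have h2 : HasDerivAt (fun s : ℝ => ((s : ℂ) * a)) a 0 := by
      simpa using (Complex.ofRealCLM.hasDerivAt (x := (0 : ℝ))).mul_const a
    simpa using h2.cexp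
  have h3 := (hasDerivAt_iff_tendsto_slope_zero.1 h1).comp
    (tendsto_nhdsWithin_iff.2 ⟨ht0, Eventually.of_forall fun n => (ht n).ne'⟩)
  refine h3.congr fun n => ?_
  simp [div_eq_inv_mul]

/-- Convergence of the weighted characteristic functions in small time. -/
lemma IsLevyMeasure.tendsto_weighted_charFun (hν : IsLevyMeasure ν) {μ : ℕ → Measure ℝ}
    [∀ n, IsProbabilityMeasure (μ n)] {t : ℕ → ℝ} (ht : ∀ n, 0 < t n)
    (ht0 : Tendsto t atTop (𝓝 0))
    (hμ : ∀ n ξ, charFun (μ n) ξ = Complex.exp (t n * levySymbol ν ξ)) (ξ : ℝ) :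
    Tendsto (fun n => ∫ y, Complex.exp ((ξ * y : ℝ) * Complex.I) *
        ((levyWeight y / t n : ℝ) : ℂ) ∂(μ n)) atTop
      (𝓝 (∫ y, Complex.exp ((ξ * y : ℝ) * Complex.I) * levyWeight y ∂ν)) := by
  have := hν.sigmaFinite
  rw [integral_exp_mul_levyWeight hν.integrable ξ]
  have hint : ∀ n, Integrable (fun y => min 1 (y ^ 2)) (μ n) := by
    intro n
    refine (integrable_const (1 : ℝ)).mono' (Continuous.aestronglyMeasurable (by fun_prop)) ?_
    refine Eventually.of_forall fun y => ?_
    rw [Real.norm_of_nonneg (by positivity)]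
    exact min_le_left _ _
  have heq : ∀ n, ∫ y, Complex.exp ((ξ * y : ℝ) * Complex.I) *
        ((levyWeight y / t n : ℝ) : ℂ) ∂(μ n) =
      ∫ u in (0 : ℝ)..1, (charFun (μ n) ξ -
        (charFun (μ n) (ξ + u) + charFun (μ n) (ξ - u)) / 2) / t n := by
    intro n
    rw [intervalIntegral.integral_div]
    simp_rw [← DegenerateLevy.integral_exp_mul_one_sub_cos]
    rw [← integral_exp_mul_levyWeight (hint n), ← integral_div]
    congr 1
    ext y
    push_cast
    ring
  simp_rw [heq, hν.integral_exp_mul_one_sub_cos]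
  set c := ∫ y, min 1 (y ^ 2) ∂ν
  set B := (2 + 3 * (|ξ| + 1) ^ 2) * c with hB
  have hc : 0 ≤ c := integral_nonneg fun y => by positivity
  have hBnn : 0 ≤ B := by positivity
  -- Only the frequencies `ξ` and `ξ ± u` with `u ≤ 1` occur, so one bound `B` on the symbol
  -- suffices.
  have hψ : ∀ ζ : ℝ, |ζ| ≤ |ξ| + 1 → ‖levySymbol ν ζ‖ ≤ B := by
    intro ζ hζ
    refine (hν.norm_levySymbol_le ζ).trans ?_
    rw [hB, ← sq_abs ζ]
    gcongr
  have htB : ∀ᶠ n in atTop, t n * B ≤ 1 := by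
    have : Tendsto (fun n => t n * B) atTop (𝓝 (0 * B)) := ht0.mul_const B
    rw [zero_mul] at this
    exact this.eventually_le_const one_pos
  have hexp : ∀ᶠ n in atTop, ∀ ζ : ℝ, |ζ| ≤ |ξ| + 1 →
      ‖(Complex.exp (t n * levySymbol ν ζ) - 1) / t n‖ ≤ 2 * B := by
    filter_upwards [htB] with n hn ζ hζ
    have h1 : ‖(t n : ℂ) * levySymbol ν ζ‖ ≤ t n * B := by
      rw [norm_mul, Complex.norm_real, Real.norm_of_nonneg (ht n).le]
      exact mul_le_mul_of_nonneg_left (hψ ζ hζ) (ht n).le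
    have h2 := Complex.norm_exp_sub_one_le (h1.trans hn)
    rw [norm_div, Complex.norm_real, Real.norm_of_nonneg (ht n).le, div_le_iff₀ (ht n)]
    linarith
  -- The coefficients of the second difference sum to `0`, so `1` may be subtracted from each
  -- exponential. With the bound `2 * B` on each quotient, the integrand is at most `4 * B`.
  have hsplit : ∀ n u, (charFun (μ n) ξ -
        (charFun (μ n) (ξ + u) + charFun (μ n) (ξ - u)) / 2) / t n =
      (Complex.exp (t n * levySymbol ν ξ) - 1) / t n -
        ((Complex.exp (t n * levySymbol ν (ξ + u)) - 1) / t n +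
          (Complex.exp (t n * levySymbol ν (ξ - u)) - 1) / t n) / 2 := by
    intro n u
    rw [hμ, hμ, hμ]
    ring
  refine intervalIntegral.tendsto_integral_filter_of_dominated_convergence (fun _ => 4 * B)
    ?_ ?_ ?_ ?_
  · refine Eventually.of_forall fun n => Measurable.aestronglyMeasurable ?_
    have hm : Measurable (charFun (μ n)) := measurable_charFun
    fun_prop
  · filter_upwards [hexp] with n hn
    refine Eventually.of_forall fun u hu => ?_
    rw [Set.uIoc_of_le zero_le_one] at hu
    have hu1 : |u| ≤ 1 := by rw [abs_of_pos hu.1]; exact hu.2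
    rw [hsplit]
    have b1 := hn ξ (by linarith)
    have b2 := hn (ξ + u) ((abs_add_le _ _).trans (by linarith))
    have b3 := hn (ξ - u) ((abs_sub _ _).trans (by linarith))
    have hn2 : ∀ z w v : ℂ, ‖z - (w + v) / 2‖ ≤ ‖z‖ + (‖w‖ + ‖v‖) / 2 := by
      intro z w v
      refine (norm_sub_le _ _).trans ?_
      have h2 : ‖(w + v) / 2‖ = ‖w + v‖ / 2 := by simp
      rw [h2]
      linarith [norm_add_le w v]
    refine (hn2 _ _ _).trans ?_
    linarith
  · exact intervalIntegrable_const
  · refine Eventually.of_forall fun u _ => ?_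
    simp_rw [hsplit]
    exact (tendsto_cexp_sub_one_div _ ht ht0).sub
      (((tendsto_cexp_sub_one_div _ ht ht0).add (tendsto_cexp_sub_one_div _ ht ht0)).div_const 2)

/-- A measure with density `w`. -/
lemma integral_withDensity_ofReal {μ : Measure ℝ} {w : ℝ → ℝ} (hw : Measurable w)
    (hw0 : ∀ y, 0 ≤ w y) {E : Type*} [NormedAddCommGroup E] [NormedSpace ℝ E] (g : ℝ → E) :
    ∫ y, g y ∂(μ.withDensity fun y => ENNReal.ofReal (w y)) = ∫ y, w y • g y ∂μ := by
  rw [integral_withDensity_eq_integral_toReal_smul (by fun_prop) (by simp)]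
  refine integral_congr_ae (Eventually.of_forall fun y => ?_)
  simp [ENNReal.toReal_ofReal (hw0 y)]

/-- Finite measures converge weakly when their characteristic functions do and the limit is
nonzero. -/
lemma tendsto_finiteMeasure_of_tendsto_charFun {ρ : ℕ → FiniteMeasure ℝ} {ρ₀ : FiniteMeasure ℝ}
    (h0 : ρ₀ ≠ 0) (h : ∀ ξ, Tendsto (fun n => charFun (ρ n : Measure ℝ) ξ) atTop
      (𝓝 (charFun (ρ₀ : Measure ℝ) ξ))) : Tendsto ρ atTop (𝓝 ρ₀) := by
  have hmass : Tendsto (fun n => (ρ n).mass) atTop (𝓝 ρ₀.mass) := by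
    have h1 := (Complex.continuous_re.tendsto _).comp (h 0)
    simp only [charFun_zero, Function.comp_def, Complex.ofReal_re] at h1
    exact NNReal.tendsto_coe.1 h1
  refine FiniteMeasure.tendsto_of_tendsto_normalize_testAgainstNN_of_tendsto_mass ?_ hmass
  refine ProbabilityMeasure.tendsto_iff_tendsto_charFun.2 fun ξ => ?_
  have hm0 : ρ₀.mass ≠ 0 := ρ₀.mass_nonzero_iff.2 h0
  have hev : ∀ᶠ n in atTop, (ρ n).mass ≠ 0 := hmass.eventually_ne hm0
  have hchar : ∀ σ : FiniteMeasure ℝ, σ.mass ≠ 0 →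
      charFun (σ.normalize : Measure ℝ) ξ = (σ.mass : ℝ)⁻¹ • charFun (σ : Measure ℝ) ξ := by
    intro σ hσ
    rw [σ.toMeasure_normalize_eq_of_nonzero (σ.mass_nonzero_iff.1 hσ), charFun_apply, charFun_apply,
      integral_smul_nnreal_measure]
    rfl
  rw [hchar _ hm0]
  refine Tendsto.congr' (hev.mono fun n hn => (hchar _ hn).symm) ?_
  exact ((NNReal.tendsto_coe.2 hmass).inv₀ (by simpa using hm0)).smul (h ξ)

/-- Small-time asymptotics of a Lévy process away from the origin. -/
theorem IsLevyMeasure.tendsto_integral_div (hν : IsLevyMeasure ν) {K : ℝ} (hK : 0 < K)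
    (hγ : 0 < ν (bigJumps K)) {μ : ℕ → Measure ℝ}
    [∀ n, IsProbabilityMeasure (μ n)] {t : ℕ → ℝ} (ht : ∀ n, 0 < t n)
    (ht0 : Tendsto t atTop (𝓝 0))
    (hμ : ∀ n ξ, charFun (μ n) ξ = Complex.exp (t n * levySymbol ν ξ))
    {g : ℝ → ℝ} (hg : Continuous g) {C : ℝ} (hgC : ∀ y, |g y| ≤ C) {δ : ℝ} (hδ : 0 < δ)
    (hgδ : ∀ y, |y| < δ → g y = 0) :
    Tendsto (fun n => (∫ y, g y ∂(μ n)) / t n) atTop (𝓝 (∫ y, g y ∂ν)) := by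
  have hw := continuous_levyWeight
  have hfin : ∀ n, IsFiniteMeasure
      ((μ n).withDensity fun y => ENNReal.ofReal (levyWeight y / t n)) := fun n => by
    refine isFiniteMeasure_withDensity_ofReal (Integrable.hasFiniteIntegral ?_)
    refine Integrable.div_const ?_ _
    refine (integrable_const (2 : ℝ)).mono' hw.aestronglyMeasurable ?_
    refine Eventually.of_forall fun y => ?_
    rw [Real.norm_of_nonneg (levyWeight_nonneg y)]
    refine (levyWeight_le y).trans ?_
    linarith [min_le_left 1 (y ^ 2)]
  have hfin0 : IsFiniteMeasure (ν.withDensity fun y => ENNReal.ofReal (levyWeight y)) := by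
    refine isFiniteMeasure_withDensity_ofReal (Integrable.hasFiniteIntegral ?_)
    refine (hν.integrable.const_mul 2).mono' hw.aestronglyMeasurable ?_
    refine Eventually.of_forall fun y => ?_
    rw [Real.norm_of_nonneg (levyWeight_nonneg y)]
    exact levyWeight_le y
  let ρ : ℕ → FiniteMeasure ℝ := fun n => ⟨_, hfin n⟩
  let ρ₀ : FiniteMeasure ℝ := ⟨_, hfin0⟩
  have hmw : Measurable levyWeight := hw.measurable
  -- The limit must be nonzero for the passage to normalised measures. Big jumps have positive
  -- `ν`-mass and the weight is positive on them.
  have hne : ρ₀ ≠ 0 := by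
    intro h
    have h1 : (ν.withDensity fun y => ENNReal.ofReal (levyWeight y)) = 0 :=
      congrArg (fun σ : FiniteMeasure ℝ => (σ : Measure ℝ)) h
    rw [withDensity_eq_zero_iff (by fun_prop)] at h1
    refine hγ.ne' (measure_mono_null (fun y hy => ?_) (ae_iff.1 h1))
    intro hy0
    have hy1 : 0 < |y| := by
      rcases hy with h | h
      · exact abs_pos.2 (by have := Set.mem_Iic.1 h; intro h0; linarith)
      · exact abs_pos.2 (by have := Set.mem_Ici.1 h; intro h0; linarith)
    have := levyWeight_pos hy1
    rw [levyWeight_abs] at this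
    have h2 : ENNReal.ofReal (levyWeight y) = 0 := hy0
    rw [ENNReal.ofReal_eq_zero] at h2
    linarith
  have hlim : Tendsto ρ atTop (𝓝 ρ₀) := by
    refine tendsto_finiteMeasure_of_tendsto_charFun hne fun ξ => ?_
    have key := hν.tendsto_weighted_charFun ht ht0 hμ ξ
    have e0 : charFun (ρ₀ : Measure ℝ) ξ =
        ∫ y, Complex.exp ((ξ * y : ℝ) * Complex.I) * levyWeight y ∂ν := by
      rw [charFun_apply_real]
      refine (integral_withDensity_ofReal hmw levyWeight_nonneg _).trans ?_
      refine integral_congr_ae (Eventually.of_forall fun y => ?_)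
      simp [mul_comm]
    have en : ∀ n, charFun (ρ n : Measure ℝ) ξ =
        ∫ y, Complex.exp ((ξ * y : ℝ) * Complex.I) * ((levyWeight y / t n : ℝ) : ℂ) ∂(μ n) := by
      intro n
      rw [charFun_apply_real]
      refine (integral_withDensity_ofReal (hmw.div_const _)
        (fun y => div_nonneg (levyWeight_nonneg y) (ht n).le) _).trans ?_
      refine integral_congr_ae (Eventually.of_forall fun y => ?_)
      simp [mul_comm]
    rw [e0]
    simp_rw [en]
    exact key
  obtain ⟨c, hc, hcw⟩ := exists_le_levyWeight hδ
  -- The quotient of `g` by the weight, with denominator truncated below at `c` to be bounded and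
  -- continuous near `0`; there `g` vanishes, so nothing changes.
  let G : BoundedContinuousFunction ℝ ℝ :=
    BoundedContinuousFunction.ofNormedAddCommGroup (fun y => g y / max c (levyWeight y))
      (hg.div (by fun_prop) fun y => (hc.trans_le (le_max_left _ _)).ne') (C / c) (fun y => by
        rw [norm_div, Real.norm_of_nonneg (hc.le.trans (le_max_left c (levyWeight y)))]
        have hC : 0 ≤ C := (abs_nonneg _).trans (hgC 0)
        exact div_le_div₀ hC (hgC y) hc (le_max_left _ _))
  have hG : ∀ y, levyWeight y * G y = g y := by
    intro y
    change levyWeight y * (g y / max c (levyWeight y)) = g y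
    rcases lt_or_ge |y| δ with h | h
    · simp [hgδ y h]
    · rw [max_eq_right (hcw y h)]
      have := hc.trans_le (hcw y h)
      field_simp
  have h1 := FiniteMeasure.tendsto_iff_forall_integral_tendsto.1 hlim G
  have e0 : ∫ y, G y ∂(ρ₀ : Measure ℝ) = ∫ y, g y ∂ν := by
    refine (integral_withDensity_ofReal hmw levyWeight_nonneg _).trans ?_
    exact integral_congr_ae (Eventually.of_forall fun y => hG y)
  have en : ∀ n, ∫ y, G y ∂(ρ n : Measure ℝ) = (∫ y, g y ∂(μ n)) / t n := by
    intro n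
    refine (integral_withDensity_ofReal (hmw.div_const _)
      (fun y => div_nonneg (levyWeight_nonneg y) (ht n).le) _).trans ?_
    rw [← integral_div]
    refine integral_congr_ae (Eventually.of_forall fun y => ?_)
    simp only [smul_eq_mul]
    rw [← hG y]; ring
  rw [e0] at h1
  exact h1.congr en

end LevyMeasure

/-! ### Independence and stationarity of increments on path space. -/

/-- Fits a finite set of times to independence of increments along monotone sequences; starting at
`0` lets every value of the path be a sum of increments. -/
lemma exists_monotone_enumeration (D : Finset ℝ≥0) :
    ∃ t : ℕ → ℝ≥0, Monotone t ∧ t 0 = 0 ∧ ∀ u ∈ D, ∃ k, t k = u := by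
  classical
  set E := insert 0 D with hE
  have hpos : 0 < E.card := Finset.card_pos.2 ⟨0, Finset.mem_insert_self _ _⟩
  let e := E.orderEmbOfFin rfl
  have hrange : ∀ u ∈ E, ∃ i : Fin E.card, e i = u := by
    intro u hu
    have : u ∈ Set.range e := by rw [Finset.range_orderEmbOfFin]; exact hu
    exact this
  refine ⟨fun n => e ⟨min n (E.card - 1), by omega⟩, ?_, ?_, ?_⟩
  · intro a c hac
    refine e.monotone ?_
    rw [Fin.mk_le_mk]
    omega
  · obtain ⟨i, hi⟩ := hrange 0 (Finset.mem_insert_self _ _)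
    refine le_antisymm ?_ zero_le
    rw [← hi]
    refine e.monotone ?_
    rw [Fin.le_def]
    simp
  · intro u hu
    obtain ⟨i, hi⟩ := hrange u (Finset.mem_insert_of_mem hu)
    refine ⟨i, ?_⟩
    rw [← hi]
    have := i.2
    exact congrArg e (Fin.ext (min_eq_left (by omega)))

/-- The path stopped at time `s`, started from `0`. -/
def stopPath (s : ℝ≥0) (f : ℝ≥0 → ℝ) : ℝ≥0 → ℝ := fun u => f (min u s) - f 0

lemma measurable_stopPath (s : ℝ≥0) : Measurable (stopPath s) :=
  measurable_pi_lambda _ fun _ => (measurable_pi_apply _).sub (measurable_pi_apply _)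

lemma measurable_shiftPath (s : ℝ≥0) : Measurable (shiftPath s) :=
  measurable_pi_lambda _ fun _ => (measurable_pi_apply _).sub (measurable_pi_apply _)

section Increments

variable {Ω : Type*} [MeasurableSpace Ω] {P : Measure Ω} {ν : Measure ℝ} {z : ℝ≥0 → Ω → ℝ}

lemma IsPureJumpLevyProcess.measurable_path (hz : IsPureJumpLevyProcess P ν z) :
    Measurable fun ω t => z t ω :=
  measurable_pi_lambda _ hz.measurable

/-- The past and the increments after time `s` are independent. -/
lemma IsPureJumpLevyProcess.indepFun_stopPath_shiftPath [IsProbabilityMeasure P]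
    (hz : IsPureJumpLevyProcess P ν z) (s : ℝ≥0) :
    IndepFun (fun ω => stopPath s fun t => z t ω) (fun ω => shiftPath s fun t => z t ω) P := by
  classical
  refine IndepFun.process_indepFun_process (X := fun u ω => stopPath s (fun t => z t ω) u)
    (Y := fun u ω => shiftPath s (fun t => z t ω) u)
    (fun u => (hz.measurable _).sub (hz.measurable _))
    (fun u => (hz.measurable _).sub (hz.measurable _)) fun I J => ?_
  obtain ⟨t, ht, ht0, hD⟩ := exists_monotone_enumeration
    (insert s (I.image (fun u => min u s) ∪ J.image (fun u => s + u)))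
  obtain ⟨m, hm⟩ := hD s (Finset.mem_insert_self _ _)
  set Δ : ℕ → Ω → ℝ := fun i ω => z (t (i + 1)) ω - z (t i) ω
  have hΔ : ∀ i, Measurable (Δ i) := fun i => (hz.measurable _).sub (hz.measurable _)
  have hind : iIndepFun Δ P := hz.indep.nat ht
  have hsum : ∀ k ω, ∑ i ∈ Finset.range k, Δ i ω = z (t k) ω - z 0 ω := by
    intro k ω
    rw [← ht0]
    exact Finset.sum_range_sub (fun i => z (t i) ω) k
  -- Increments with index below `m` generate the past of `s = t m`, the others generate the future.
  have hI := indep_iSup_of_disjoint (fun i => (hΔ i).comap_le) hind.iIndep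
    (S := {i | i < m}) (T := {i | m ≤ i}) (by
      rw [Set.disjoint_left]; exact fun i hi hi' => absurd (show i < m from hi) (not_lt.2 hi'))
  refine (IndepFun_iff_Indep _ _ _).2
    (indep_of_indep_of_le_left (indep_of_indep_of_le_right hI ?_) ?_)
  · rw [← measurable_iff_comap_le]
    refine @measurable_pi_lambda _ _ _ (_) _ _ fun u => ?_
    obtain ⟨k, hk⟩ := hD (s + u) (Finset.mem_insert_of_mem (Finset.mem_union_right _
      (Finset.mem_image_of_mem _ u.2)))
    -- The enumeration may repeat times, so `k` can precede `m` when `u = 0`; the maximum repairs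
    -- the index.
    have hk' : t (max k m) = s + u := by
      rcases le_total m k with h | h
      · rw [max_eq_left h, hk]
      · rw [max_eq_right h]
        refine le_antisymm ?_ ?_
        · rw [hm]; exact le_self_add
        · rw [← hk]; exact ht h
    have e : (fun ω => shiftPath s (fun t => z t ω) u) =
        fun ω => ∑ i ∈ Finset.Ico m (max k m), Δ i ω := by
      funext ω
      rw [Finset.sum_Ico_eq_sub _ (le_max_right _ _), hsum, hsum, hk', hm, shiftPath]
      ring
    rw [e]
    refine @Finset.measurable_fun_sum _ _ _ _ _ _ (_) _ _ fun i hi => ?_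
    have hi' : i ∈ {i | m ≤ i} := (Finset.mem_Ico.1 hi).1
    exact (comap_measurable (Δ i)).mono (le_iSup₂_of_le i hi' le_rfl) le_rfl
  · rw [← measurable_iff_comap_le]
    refine @measurable_pi_lambda _ _ _ (_) _ _ fun u => ?_
    obtain ⟨k, hk⟩ := hD (min u s) (Finset.mem_insert_of_mem (Finset.mem_union_left _
      (Finset.mem_image_of_mem (fun u => min u s) u.2)))
    have hk' : t (min k m) = min (u : ℝ≥0) s := by
      rcases le_total k m with h | h
      · rw [min_eq_left h, hk]
      · rw [min_eq_right h]
        refine le_antisymm ?_ ?_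
        · rw [← hk]; exact ht h
        · rw [hm]; exact min_le_right _ _
    have e : (fun ω => stopPath s (fun t => z t ω) u) =
        fun ω => ∑ i ∈ Finset.range (min k m), Δ i ω := by
      funext ω
      rw [hsum, hk', stopPath]
    rw [e]
    refine @Finset.measurable_fun_sum _ _ _ _ _ _ (_) _ _ fun i hi => ?_
    have hi' : i ∈ {i | i < m} := (Finset.mem_range.1 hi).trans_le (min_le_right _ _)
    exact (comap_measurable (Δ i)).mono (le_iSup₂_of_le i hi' le_rfl) le_rfl

/-- The increments after time `s` have the same law as the process itself. -/
lemma IsPureJumpLevyProcess.identDistrib_shiftPath [IsProbabilityMeasure P]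
    (hz : IsPureJumpLevyProcess P ν z) (s : ℝ≥0) :
    IdentDistrib (fun ω => shiftPath s fun t => z t ω) (fun ω t => z t ω) P P := by
  classical
  refine (identDistrib_iff_forall_finset_identDistrib
    (X := fun u ω => shiftPath s (fun t => z t ω) u) (Y := z)
    ((measurable_shiftPath s).comp hz.measurable_path).aemeasurable
    hz.measurable_path.aemeasurable).2 fun I => ?_
  obtain ⟨t, ht, ht0, hD⟩ := exists_monotone_enumeration I
  choose k hk using fun u : I => hD u u.2
  -- Two independent families with equal marginals, by stationarity over intervals of the same
  -- length.
  have hinc : IdentDistrib (fun ω (i : ℕ) => z (s + t (i + 1)) ω - z (s + t i) ω)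
      (fun ω (i : ℕ) => z (t (i + 1)) ω - z (t i) ω) P P := by
    refine IdentDistrib.pi (fun i => ?_) (hz.indep.nat (t := fun i => s + t i) ?_)
      (hz.indep.nat ht)
    · obtain ⟨d, hd⟩ := exists_add_of_le (ht (Nat.le_succ i))
      rw [Nat.succ_eq_add_one] at hd
      have h1 := hz.stationary (s + t i) d
      have h2 := hz.stationary (t i) d
      rw [add_assoc, ← hd] at h1
      rw [← hd] at h2
      exact h1.trans h2.symm
    · exact fun a c hac => add_le_add_right (ht hac) s
  have hg : Measurable fun (v : ℕ → ℝ) (u : I) => ∑ i ∈ Finset.range (k u), v i :=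
    measurable_pi_lambda _ fun u => Finset.measurable_fun_sum _ fun i _ => measurable_pi_apply i
  have h3 := hinc.comp hg
  have e1 : (fun ω => I.restrict fun u => shiftPath s (fun t => z t ω) u) =
      (fun (v : ℕ → ℝ) (u : I) => ∑ i ∈ Finset.range (k u), v i) ∘
        fun ω (i : ℕ) => z (s + t (i + 1)) ω - z (s + t i) ω := by
    funext ω u
    simp only [Function.comp, Finset.restrict]
    rw [Finset.sum_range_sub (fun i => z (s + t i) ω), hk, ht0, add_zero, shiftPath]
  have e2 : (fun ω => I.restrict fun u => z u ω) =ᵐ[P]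
      (fun (v : ℕ → ℝ) (u : I) => ∑ i ∈ Finset.range (k u), v i) ∘
        fun ω (i : ℕ) => z (t (i + 1)) ω - z (t i) ω := by
    filter_upwards [hz.zero] with ω hω
    funext u
    simp only [Function.comp, Finset.restrict]
    rw [Finset.sum_range_sub (fun i => z (t i) ω), hk, ht0, hω, sub_zero]
  rw [e1]
  have hm : AEMeasurable (fun ω => I.restrict fun u => z u ω) P :=
    (measurable_pi_lambda _ fun u => hz.measurable _).aemeasurable
  exact h3.trans (IdentDistrib.of_ae_eq hm e2).symm

lemma shiftPath_shiftPath (s t : ℝ≥0) (f : ℝ≥0 → ℝ) :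
    shiftPath t (shiftPath s f) = shiftPath (s + t) f := by
  funext u
  simp only [shiftPath, add_assoc]
  ring

/-- Factorization of expectations over past, increment, and future. -/
lemma IsPureJumpLevyProcess.integral_mul_increment_mul [IsProbabilityMeasure P]
    (hz : IsPureJumpLevyProcess P ν z) {s δ : ℝ≥0} {A : Ω → ℝ} {a : (ℝ≥0 → ℝ) → ℝ}
    (ha : Measurable a) (hA : A =ᵐ[P] fun ω => a (stopPath s fun t => z t ω))
    {ψ : ℝ → ℝ} (hψ : Measurable ψ) {h : (ℝ≥0 → ℝ) → ℝ} (hh : Measurable h) :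
    ∫ ω, A ω * (ψ (z (s + δ) ω - z s ω) * h (shiftPath (s + δ) fun t => z t ω)) ∂P =
      (∫ ω, A ω ∂P) * ((∫ ω, ψ (z δ ω) ∂P) * ∫ ω, h (fun t => z t ω) ∂P) := by
  have hzm := hz.measurable_path
  -- Increment and future form one functional of the noise after `s`. Independence at `s` splits off
  -- the past; stationarity moves `B` to time `0`, and independence at `δ` splits it again.
  set B : (ℝ≥0 → ℝ) → ℝ := fun f => ψ (f δ) * h (shiftPath δ f) with hB
  have hBm : Measurable B :=
    (hψ.comp (measurable_pi_apply δ)).mul (hh.comp (measurable_shiftPath δ))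
  have e1 : ∀ ω, ψ (z (s + δ) ω - z s ω) * h (shiftPath (s + δ) fun t => z t ω) =
      B (shiftPath s fun t => z t ω) := by
    intro ω
    rw [hB]
    simp only [shiftPath_shiftPath]
    rfl
  have e2 : ∫ ω, B (shiftPath s fun t => z t ω) ∂P = ∫ ω, B (fun t => z t ω) ∂P :=
    ((hz.identDistrib_shiftPath s).comp hBm).integral_eq
  have e3 : ∫ ω, B (fun t => z t ω) ∂P =
      (∫ ω, ψ (z δ ω) ∂P) * ∫ ω, h (fun t => z t ω) ∂P := by
    have hind := (hz.indepFun_stopPath_shiftPath δ).comp (hψ.comp (measurable_pi_apply δ)) hh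
    have h0 := hind.integral_fun_mul_eq_mul_integral
      ((hψ.comp (measurable_pi_apply δ)).comp
        ((measurable_stopPath δ).comp hzm)).aestronglyMeasurable
      (hh.comp ((measurable_shiftPath δ).comp hzm)).aestronglyMeasurable
    have h1 : ∫ ω, h (shiftPath δ fun t => z t ω) ∂P = ∫ ω, h (fun t => z t ω) ∂P :=
      ((hz.identDistrib_shiftPath δ).comp hh).integral_eq
    have heval : ∀ᵐ ω ∂P, stopPath δ (fun t => z t ω) δ = z δ ω := by
      filter_upwards [hz.zero] with ω hω
      simp [stopPath, hω]
    have h2 : ∫ ω, ψ (stopPath δ (fun t => z t ω) δ) ∂P = ∫ ω, ψ (z δ ω) ∂P :=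
      integral_congr_ae (heval.mono fun ω hω => by simp only [hω])
    have h3 : ∫ ω, B (fun t => z t ω) ∂P = ∫ ω, ψ (stopPath δ (fun t => z t ω) δ) *
        h (shiftPath δ fun t => z t ω) ∂P :=
      integral_congr_ae (heval.mono fun ω hω => by simp only [hω, hB])
    rw [h3, ← h1, ← h2]
    exact h0
  simp_rw [e1]
  have hind := (hz.indepFun_stopPath_shiftPath s).comp ha hBm
  have h0 := hind.integral_fun_mul_eq_mul_integral
    (ha.comp ((measurable_stopPath s).comp hzm)).aestronglyMeasurable
    (hBm.comp ((measurable_shiftPath s).comp hzm)).aestronglyMeasurable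
  have h4 : ∫ ω, A ω * B (shiftPath s fun t => z t ω) ∂P =
      ∫ ω, a (stopPath s fun t => z t ω) * B (shiftPath s fun t => z t ω) ∂P :=
    integral_congr_ae (hA.mono fun ω hω => by simp only [hω])
  rw [h4, integral_congr_ae hA, ← e3, ← e2]
  exact h0

end Increments

/-! ### Grid sums and the factorization of their expectations. -/

/-- The increment of a path over the `i`-th interval of the grid of mesh `δ` started at `T`. -/
def gridIncrement (T δ : ℝ≥0) (f : ℝ≥0 → ℝ) (i : ℕ) : ℝ :=
  f (T + (i + 1 : ℕ) * δ) - f (T + i * δ)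

/-- The weight of the event that none of the first `j` numbers is selected by the cutoff. -/
def survival (φ : ℝ → ℝ) (ξ : ℕ → ℝ) (j : ℕ) : ℝ := ∏ i ∈ Finset.range j, (1 - φ (ξ i))

/-- The grid approximation of a functional evaluated at the first big jump. -/
def gridSum (φ : ℝ → ℝ) (T δ : ℝ≥0) (N : ℕ) (G : Plane → ℝ) (g : ℝ → ℝ)
    (h : (ℝ≥0 → ℝ) → ℝ) (Y : ℝ≥0 → Plane) (f : ℝ≥0 → ℝ) : ℝ :=
  ∑ j ∈ Finset.range N, G (Y (T + j * δ)) * survival φ (gridIncrement T δ f) j *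
    (φ (gridIncrement T δ f j) * g (gridIncrement T δ f j) *
      h (shiftPath (T + (j + 1 : ℕ) * δ) f))

/-- A telescoping sum: the weights of "first selected at `j`" and of "never selected" add up to `1`.
-/
lemma sum_survival_mul (φ : ℝ → ℝ) (ξ : ℕ → ℝ) (N : ℕ) :
    ∑ j ∈ Finset.range N, survival φ ξ j * φ (ξ j) = 1 - survival φ ξ N := by
  induction N with
  | zero => simp [survival]
  | succ N ih =>
    rw [Finset.sum_range_succ, ih]
    simp only [survival, Finset.prod_range_succ]
    ring

section Weights

variable {φ : ℝ → ℝ}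

lemma survival_nonneg (h1 : ∀ y, φ y ≤ 1) (ξ : ℕ → ℝ) (j : ℕ) : 0 ≤ survival φ ξ j :=
  Finset.prod_nonneg fun _ _ => sub_nonneg.2 (h1 _)

lemma survival_le_one (h0 : ∀ y, 0 ≤ φ y) (h1 : ∀ y, φ y ≤ 1) (ξ : ℕ → ℝ) (j : ℕ) :
    survival φ ξ j ≤ 1 :=
  Finset.prod_le_one (fun i _ => sub_nonneg.2 (h1 _)) fun i _ => by linarith [h0 (ξ i)]

/-- The weights sum to at most `1`, so the bound does not depend on mesh or number of steps, as
bounded convergence requires. -/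
lemma abs_gridSum_le (h0 : ∀ y, 0 ≤ φ y) (h1 : ∀ y, φ y ≤ 1)
    {T δ : ℝ≥0} {N : ℕ} {G : Plane → ℝ} {g : ℝ → ℝ} {h : (ℝ≥0 → ℝ) → ℝ}
    {CG Cg Ch : ℝ} (hG : ∀ v, |G v| ≤ CG) (hg : ∀ y, |g y| ≤ Cg) (hh : ∀ f, |h f| ≤ Ch)
    (Y : ℝ≥0 → Plane) (f : ℝ≥0 → ℝ) :
    |gridSum φ T δ N G g h Y f| ≤ CG * Cg * Ch := by
  have hCG : 0 ≤ CG := (abs_nonneg _).trans (hG 0)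
  have hCg : 0 ≤ Cg := (abs_nonneg _).trans (hg 0)
  have hCh : 0 ≤ Ch := (abs_nonneg _).trans (hh 0)
  set ξ := gridIncrement T δ f
  calc |gridSum φ T δ N G g h Y f|
      ≤ ∑ j ∈ Finset.range N, CG * Cg * Ch * (survival φ ξ j * φ (ξ j)) := by
        refine (Finset.abs_sum_le_sum_abs _ _).trans (Finset.sum_le_sum fun j _ => ?_)
        rw [abs_mul, abs_mul, abs_mul, abs_mul, abs_of_nonneg (survival_nonneg h1 ξ j),
          abs_of_nonneg (h0 _)]
        have := survival_nonneg h1 ξ j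
        have := h0 (ξ j)
        calc _ ≤ CG * survival φ ξ j * (φ (ξ j) * Cg * Ch) := by
              gcongr
              · exact hG _
              · exact hg _
              · exact hh _
          _ = _ := by ring
    _ = CG * Cg * Ch * (1 - survival φ ξ N) := by
        rw [← Finset.mul_sum, sum_survival_mul]
    _ ≤ CG * Cg * Ch * 1 := by
        gcongr
        linarith [survival_nonneg h1 ξ N]
    _ = _ := mul_one _

end Weights

section Expectation

variable {Ω : Type*} [MeasurableSpace Ω] {P : Measure Ω} {ν : Measure ℝ} {z : ℝ≥0 → Ω → ℝ}
  {b : Plane → Plane} {L : ℝ≥0} {x : Plane} {Y : ℝ≥0 → Ω → Plane}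

/-- A solution at a positive time is a functional of the noise up to that time. -/
lemma exists_measurable_comp_stopPath (hz0 : ∀ᵐ ω ∂P, z 0 ω = 0) (hb : LipschitzWith L b)
    (hY : ∀ᵐ ω ∂P, IsDriven b x (fun t => z t ω) fun t => Y t ω) {s : ℝ≥0} (hs : 0 < s) :
    ∃ a : (ℝ≥0 → ℝ) → Plane, Measurable a ∧
      Y s =ᵐ[P] fun ω => a (stopPath s fun t => z t ω) := by
  -- The step `s / (n + 1)` puts `s` on the grid at index `n + 1`, so the scheme reads the path only
  -- up to `s`; the step is positive because `s` is.
  refine ⟨fun f => limUnder atTop fun n : ℕ => euler b (s / ((n : ℝ≥0) + 1)) x f (n + 1),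
    measurable_limUnder fun n => (measurable_euler hb.continuous.measurable
      (s / ((n : ℝ≥0) + 1)) (n + 1)).comp (measurable_const (a := x) |>.prodMk measurable_id), ?_⟩
  have hmul : ∀ n : ℕ, ((n + 1 : ℕ) : ℝ≥0) * (s / ((n : ℝ≥0) + 1)) = s := fun n => by
    push_cast
    exact mul_div_cancel₀ _ (by positivity)
  filter_upwards [hz0, hY] with ω hω hYω
  have h1 := hYω.tendsto_sub_euler hω hb (l := atTop)
    (h := fun n : ℕ => s / ((n : ℝ≥0) + 1)) (j := fun n => n + 1) (M := s) (by
      refine tendsto_nhdsWithin_iff.2 ⟨?_, Eventually.of_forall fun n => ?_⟩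
      · have := tendsto_one_div_add_atTop_nhds_zero_nat (𝕜 := ℝ≥0).const_mul s
        simpa [div_eq_mul_inv] using this
      · exact Set.mem_Ioi.2 (by positivity))
    (Eventually.of_forall fun n => (hmul n).le)
  simp only [hmul] at h1
  refine (Tendsto.limUnder_eq ?_).symm
  have h2 := (tendsto_const_nhds (x := Y s ω)).sub h1
  simp only [sub_sub_cancel, sub_zero] at h2
  refine h2.congr fun n => euler_congr b _ x fun t ht => ?_
  rw [hmul] at ht
  simp [stopPath, min_eq_left ht, hω]

lemma measurable_gridIncrement (hz : IsPureJumpLevyProcess P ν z) (T δ : ℝ≥0) (i : ℕ) :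
    Measurable fun ω => gridIncrement T δ (fun t => z t ω) i :=
  (hz.measurable _).sub (hz.measurable _)

lemma measurable_survival (hz : IsPureJumpLevyProcess P ν z) {φ : ℝ → ℝ} (hφ : Measurable φ)
    (T δ : ℝ≥0) (j : ℕ) :
    Measurable fun ω => survival φ (gridIncrement T δ fun t => z t ω) j :=
  Finset.measurable_fun_prod _ fun i _ =>
    measurable_const.sub (hφ.comp (measurable_gridIncrement hz T δ i))

lemma measurable_gridSum (hz : IsPureJumpLevyProcess P ν z) (hYm : ∀ t, Measurable (Y t))
    {φ : ℝ → ℝ} (hφ : Measurable φ) (T δ : ℝ≥0) (N : ℕ) {G : Plane → ℝ} (hG : Measurable G)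
    {g : ℝ → ℝ} (hg : Measurable g) {h : (ℝ≥0 → ℝ) → ℝ} (hh : Measurable h) :
    Measurable fun ω => gridSum φ T δ N G g h (fun t => Y t ω) fun t => z t ω := by
  refine Finset.measurable_fun_sum _ fun j _ => ?_
  have hi := measurable_gridIncrement hz T δ j
  exact ((hG.comp (hYm _)).mul (measurable_survival hz hφ T δ j)).mul
    (((hφ.comp hi).mul (hg.comp hi)).mul
      (hh.comp ((measurable_shiftPath _).comp hz.measurable_path)))

variable [IsProbabilityMeasure P]

/-- Position and survival weight depend on the noise up to `T + j * δ`; the next increment and the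
later noise are independent of it and of each other. -/
lemma integral_gridSum_term (hz : IsPureJumpLevyProcess P ν z) (hb : LipschitzWith L b)
    (hY : ∀ᵐ ω ∂P, IsDriven b x (fun t => z t ω) fun t => Y t ω)
    {φ : ℝ → ℝ} (hφ : Measurable φ) {T : ℝ≥0} (hT : 0 < T) (δ : ℝ≥0)
    {G : Plane → ℝ} (hG : Measurable G) {ψ : ℝ → ℝ} (hψ : Measurable ψ)
    {h : (ℝ≥0 → ℝ) → ℝ} (hh : Measurable h) (j : ℕ) :
    ∫ ω, G (Y (T + j * δ) ω) * survival φ (gridIncrement T δ fun t => z t ω) j *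
      (ψ (gridIncrement T δ (fun t => z t ω) j) *
        h (shiftPath (T + (j + 1 : ℕ) * δ) fun t => z t ω)) ∂P =
    (∫ ω, G (Y (T + j * δ) ω) * survival φ (gridIncrement T δ fun t => z t ω) j ∂P) *
      ((∫ ω, ψ (z δ ω) ∂P) * ∫ ω, h (fun t => z t ω) ∂P) := by
  obtain ⟨a, ha, hYa⟩ := exists_measurable_comp_stopPath hz.zero hb hY
    (s := T + j * δ) (hT.trans_le le_self_add)
  have hstep : T + ((j + 1 : ℕ) : ℝ≥0) * δ = T + j * δ + δ := by push_cast; ring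
  have key := hz.integral_mul_increment_mul (s := T + j * δ) (δ := δ)
    (A := fun ω => G (Y (T + j * δ) ω) * survival φ (gridIncrement T δ fun t => z t ω) j)
    (a := fun f => G (a f) * survival φ (gridIncrement T δ f) j) ?_ ?_ hψ hh
  · rw [← key]
    simp only [gridIncrement, hstep]
  · refine (hG.comp ha).mul (Finset.measurable_fun_prod _ fun i _ => ?_)
    exact measurable_const.sub (hφ.comp ((measurable_pi_apply _).sub (measurable_pi_apply _)))
  · filter_upwards [hYa] with ω hω
    rw [hω]
    congr 1
    refine Finset.prod_congr rfl fun i hi => ?_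
    have hij : i + 1 ≤ j := Finset.mem_range.1 hi
    have h1 : T + ((i + 1 : ℕ) : ℝ≥0) * δ ≤ T + j * δ := by gcongr
    have h2 : T + (i : ℝ≥0) * δ ≤ T + j * δ := by gcongr; omega
    simp only [gridIncrement, stopPath, min_eq_left h2, min_eq_left h1, sub_sub_sub_cancel_right]

/-- Factorization of the expected grid sums. -/
lemma integral_gridSum_mul (hz : IsPureJumpLevyProcess P ν z) (hb : LipschitzWith L b)
    (hYm : ∀ t, Measurable (Y t))
    (hY : ∀ᵐ ω ∂P, IsDriven b x (fun t => z t ω) fun t => Y t ω)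
    {φ : ℝ → ℝ} (hφ : Measurable φ) (h0 : ∀ y, 0 ≤ φ y) (h1 : ∀ y, φ y ≤ 1)
    {T : ℝ≥0} (hT : 0 < T) (δ : ℝ≥0) (N : ℕ)
    {G : Plane → ℝ} (hG : Measurable G) {g : ℝ → ℝ} (hg : Measurable g)
    {h : (ℝ≥0 → ℝ) → ℝ} (hh : Measurable h) {CG Cg Ch : ℝ}
    (hCG : ∀ v, |G v| ≤ CG) (hCg : ∀ y, |g y| ≤ Cg) (hCh : ∀ f, |h f| ≤ Ch) :
    (∫ ω, gridSum φ T δ N G g h (fun t => Y t ω) (fun t => z t ω) ∂P) * ∫ ω, φ (z δ ω) ∂P =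
      (∫ ω, gridSum φ T δ N G (fun _ => 1) (fun _ => 1) (fun t => Y t ω) (fun t => z t ω) ∂P) *
        ((∫ ω, φ (z δ ω) * g (z δ ω) ∂P) * ∫ ω, h (fun t => z t ω) ∂P) := by
  -- The sum over the past does not depend on `g` and `h`. Comparison with `g = h = 1` eliminates
  -- it, and cross-multiplication avoids dividing by the expected cutoff.
  have hsum : ∀ {g : ℝ → ℝ} (_ : Measurable g) {h : (ℝ≥0 → ℝ) → ℝ} (_ : Measurable h)
      {Cg Ch : ℝ} (_ : ∀ y, |g y| ≤ Cg) (_ : ∀ f, |h f| ≤ Ch),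
      ∫ ω, gridSum φ T δ N G g h (fun t => Y t ω) (fun t => z t ω) ∂P =
        (∑ j ∈ Finset.range N,
          ∫ ω, G (Y (T + j * δ) ω) * survival φ (gridIncrement T δ fun t => z t ω) j ∂P) *
          ((∫ ω, φ (z δ ω) * g (z δ ω) ∂P) * ∫ ω, h (fun t => z t ω) ∂P) := by
    intro g hg h hh Cg Ch hCg hCh
    simp only [gridSum]
    rw [integral_finsetSum, Finset.sum_mul]
    · refine Finset.sum_congr rfl fun j _ => ?_
      exact integral_gridSum_term hz hb hY hφ hT δ hG (hφ.mul hg) hh j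
    · intro j _
      have hi := measurable_gridIncrement hz T δ j
      have hm := ((hG.comp (hYm (T + j * δ))).mul (measurable_survival hz hφ T δ j)).mul
        (((hφ.comp hi).mul (hg.comp hi)).mul
          (hh.comp ((measurable_shiftPath (T + (j + 1 : ℕ) * δ)).comp hz.measurable_path)))
      refine Integrable.of_bound hm.aestronglyMeasurable (CG * 1 * (1 * Cg * Ch))
        (Eventually.of_forall fun ω => ?_)
      have hCG0 : 0 ≤ CG := (abs_nonneg _).trans (hCG 0)
      have hCg0 : 0 ≤ Cg := (abs_nonneg _).trans (hCg 0)
      simp only [Real.norm_eq_abs, abs_mul]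
      gcongr
      · exact hCG _
      · rw [abs_of_nonneg (survival_nonneg h1 _ j)]; exact survival_le_one h0 h1 _ j
      · rw [abs_of_nonneg (h0 _)]; exact h1 _
      · exact hCg _
      · exact hCh _
  rw [hsum hg hh hCg hCh, hsum (g := fun _ => 1) measurable_const (h := fun _ => 1)
    measurable_const (Cg := 1) (Ch := 1) (fun _ => by simp) fun _ => by simp]
  simp
  ring

lemma integral_survival (hz : IsPureJumpLevyProcess P ν z) (hb : LipschitzWith L b)
    (hY : ∀ᵐ ω ∂P, IsDriven b x (fun t => z t ω) fun t => Y t ω)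
    {φ : ℝ → ℝ} (hφ : Measurable φ) (h0 : ∀ y, 0 ≤ φ y) (h1 : ∀ y, φ y ≤ 1)
    {T : ℝ≥0} (hT : 0 < T) (δ : ℝ≥0) (N : ℕ) :
    ∫ ω, survival φ (gridIncrement T δ fun t => z t ω) N ∂P =
      (1 - ∫ ω, φ (z δ ω) ∂P) ^ N := by
  induction N with
  | zero => simp [survival]
  | succ N ih =>
    have := integral_gridSum_term hz hb hY hφ hT δ (G := fun _ => 1) measurable_const
      (ψ := fun y => 1 - φ y) (measurable_const.sub hφ) (h := fun _ => 1) measurable_const N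
    simp only [one_mul, mul_one, ih] at this
    simp only [survival, Finset.prod_range_succ] at this ⊢
    rw [this, pow_succ, integral_sub (integrable_const _)]
    · simp
    · refine Integrable.of_bound (hφ.comp (hz.measurable δ)).aestronglyMeasurable 1
        (Eventually.of_forall fun ω => ?_)
      rw [Real.norm_eq_abs, abs_of_nonneg (h0 _)]
      exact h1 _

/-- With all test functions `1`, the expected sum is `1 - (1 - q) ^ N`, where `q` is the mean of the
cutoff. This lower bound later forces a big jump to occur. -/
lemma one_sub_exp_le_integral_gridSum (hz : IsPureJumpLevyProcess P ν z)
    (hb : LipschitzWith L b)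
    (hY : ∀ᵐ ω ∂P, IsDriven b x (fun t => z t ω) fun t => Y t ω)
    {φ : ℝ → ℝ} (hφ : Measurable φ) (h0 : ∀ y, 0 ≤ φ y) (h1 : ∀ y, φ y ≤ 1)
    {T : ℝ≥0} (hT : 0 < T) (δ : ℝ≥0) (N : ℕ) :
    1 - Real.exp (-(N * ∫ ω, φ (z δ ω) ∂P)) ≤
      ∫ ω, gridSum φ T δ N (fun _ => 1) (fun _ => 1) (fun _ => 1) (fun t => Y t ω)
        (fun t => z t ω) ∂P := by
  have hint : Integrable (fun ω => survival φ (gridIncrement T δ fun t => z t ω) N) P := by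
    refine Integrable.of_bound (measurable_survival hz hφ T δ N).aestronglyMeasurable 1
        (Eventually.of_forall fun ω => ?_)
    rw [Real.norm_eq_abs, abs_of_nonneg (survival_nonneg h1 _ _)]
    exact survival_le_one h0 h1 _ _
  simp only [gridSum, one_mul, mul_one, sum_survival_mul]
  rw [integral_sub (integrable_const _) hint, integral_survival hz hb hY hφ h0 h1 hT]
  simp only [integral_const, probReal_univ, smul_eq_mul, mul_one]
  refine sub_le_sub_left ?_ 1
  have hq : ∫ ω, φ (z δ ω) ∂P ≤ 1 := by
    have := integral_mono_of_nonneg (μ := P) (Eventually.of_forall fun ω => h0 (z δ ω))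
      (integrable_const (1 : ℝ)) (Eventually.of_forall fun ω => h1 (z δ ω))
    simpa using this
  have := Real.one_sub_le_exp_neg (∫ ω, φ (z δ ω) ∂P)
  calc (1 - ∫ ω, φ (z δ ω) ∂P) ^ N ≤ Real.exp (-∫ ω, φ (z δ ω) ∂P) ^ N :=
        pow_le_pow_left₀ (sub_nonneg.2 hq) this N
    _ = _ := by rw [← Real.exp_nat_mul]; ring_nf

end Expectation

/-! ### Iterated limits along `atTop.curry atTop`. -/

section IteratedLimits

/-- Needed for uniqueness of limits along the curried filter, which encodes the inner limit in the
second index followed by the limit in the first. -/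
instance neBot_curry {α β : Type*} {l : Filter α} {m : Filter β} [NeBot l] [NeBot m] :
    NeBot (l.curry m) := by
  refine ⟨fun h => ?_⟩
  have : ∀ᶠ _ in l.curry m, False := by rw [h]; exact eventually_bot
  rw [eventually_curry_iff] at this
  obtain ⟨_, ha⟩ := this.exists
  obtain ⟨_, hb⟩ := ha.exists
  exact hb

lemma tendsto_curry_of_tendsto {α β E : Type*} [PseudoMetricSpace E] {l : Filter α} {m : Filter β}
    {u : α → β → E} {v : α → E} {c : E} (hu : ∀ i, Tendsto (u i) m (𝓝 (v i)))
    (hv : Tendsto v l (𝓝 c)) : Tendsto (fun p : α × β => u p.1 p.2) (l.curry m) (𝓝 c) := by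
  rw [Metric.tendsto_nhds]
  intro ε hε
  rw [eventually_curry_iff]
  filter_upwards [Metric.tendsto_nhds.1 hv (ε / 2) (half_pos hε)] with i hi
  filter_upwards [Metric.tendsto_nhds.1 (hu i) (ε / 2) (half_pos hε)] with j hj
  calc dist (u i j) c ≤ dist (u i j) (v i) + dist (v i) c := dist_triangle _ _ _
    _ < ε := by linarith

variable {Ω : Type*} [MeasurableSpace Ω] {P : Measure Ω} [IsFiniteMeasure P]

/-- Bounded convergence for iterated limits. -/
lemma tendsto_integral_curry {a : ℕ → ℕ → Ω → ℝ} {a0 : Ω → ℝ} {C : ℝ}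
    (hm : ∀ m n, Measurable (a m n)) (hC : ∀ m n ω, |a m n ω| ≤ C)
    (h : ∀ᵐ ω ∂P, ∀ᶠ m in atTop, Tendsto (fun n => a m n ω) atTop (𝓝 (a0 ω))) :
    AEMeasurable a0 P ∧ (∀ᵐ ω ∂P, |a0 ω| ≤ C) ∧
      Tendsto (fun p : ℕ × ℕ => ∫ ω, a p.1 p.2 ω ∂P) (atTop.curry atTop) (𝓝 (∫ ω, a0 ω ∂P)) := by
  have hmeas : AEMeasurable a0 P := by
    refine aemeasurable_of_tendsto_metrizable_ae atTop
      (f := fun m ω => limUnder atTop fun n => a m n ω)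
      (fun m => (measurable_limUnder (hm m)).aemeasurable) ?_
    filter_upwards [h] with ω hω
    refine tendsto_const_nhds.congr' ?_
    filter_upwards [hω] with m hmω using hmω.limUnder_eq.symm
  have hbd : ∀ᵐ ω ∂P, |a0 ω| ≤ C := by
    filter_upwards [h] with ω hω
    obtain ⟨m, hmω⟩ := hω.exists
    exact le_of_tendsto hmω.abs (Eventually.of_forall fun n => hC m n ω)
  refine ⟨hmeas, hbd, ?_⟩
  obtain ⟨a1, ha1, ha01⟩ := hmeas
  have hbd1 : ∀ᵐ ω ∂P, |a1 ω| ≤ C := by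
    filter_upwards [hbd, ha01] with ω hω h1
    rwa [← h1]
  have hlim1 : ∀ᵐ ω ∂P, ∀ᶠ m in atTop, Tendsto (fun n => a m n ω) atTop (𝓝 (a1 ω)) := by
    filter_upwards [h, ha01] with ω hω h1
    rwa [← h1]
  rw [integral_congr_ae ha01]
  set d : ℕ → ℕ → Ω → ℝ≥0∞ := fun m n ω => ‖a m n ω - a1 ω‖ₑ with hd
  have hdm : ∀ m n, Measurable (d m n) := fun m n => ((hm m n).sub ha1).enorm
  have hdC : ∀ m n, d m n ≤ᵐ[P] fun _ => ENNReal.ofReal (2 * C) := by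
    intro m n
    filter_upwards [hbd1] with ω hω
    simp only [hd, Real.enorm_eq_ofReal_abs]
    refine ENNReal.ofReal_le_ofReal ((abs_sub _ _).trans ?_)
    linarith [hC m n ω]
  have hfin : ∫⁻ _, ENNReal.ofReal (2 * C) ∂P ≠ ∞ := by
    rw [lintegral_const]
    exact ENNReal.mul_ne_top ENNReal.ofReal_ne_top (measure_ne_top _ _)
  -- Dominated convergence in the outer index, applied to inner upper limits of the error; the
  -- reverse Fatou lemma then bounds the upper limit of the integrals in the inner index.
  have hL : Tendsto (fun m => ∫⁻ ω, limsup (fun n => d m n ω) atTop ∂P) atTop (𝓝 0) := by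
    have := tendsto_lintegral_of_dominated_convergence' (μ := P)
      (F := fun m ω => limsup (fun n => d m n ω) atTop) (f := fun _ => 0)
      (fun _ => ENNReal.ofReal (2 * C)) (fun m => (Measurable.limsup (hdm m)).aemeasurable)
      (fun m => ?_) hfin ?_
    · simpa using this
    · filter_upwards [ae_all_iff.2 (hdC m)] with ω hω
      exact (limsup_le_limsup (Eventually.of_forall hω)).trans (limsup_const _).le
    · filter_upwards [hlim1] with ω hω
      refine tendsto_const_nhds.congr' ?_
      filter_upwards [hω] with m hmω
      refine (Tendsto.limsup_eq ?_).symm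
      have := (hmω.sub_const (a1 ω)).enorm
      simpa [hd] using this
  refine tendsto_integral_of_L1 a1 ha1.aestronglyMeasurable (Eventually.of_forall fun p =>
    Integrable.of_bound (hm _ _).aestronglyMeasurable C (Eventually.of_forall (hC _ _))) ?_
  rw [ENNReal.tendsto_nhds_zero]
  intro ε hε
  rw [eventually_curry_iff]
  filter_upwards [(tendsto_order.1 hL).2 ε hε] with m hmε
  have h1 := (limsup_lintegral_le _ (hdm m) (hdC m) hfin).trans_lt hmε
  filter_upwards [eventually_lt_of_limsup_lt h1] with n hn using hn.le

end IteratedLimits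

/-! ### Continuous cutoffs and the rate of big jumps. -/

/-- A continuous cutoff which is `1` on jumps of size at least `K` and which vanishes on
jumps of size at most `K - K / (m + 2)`. -/
def cutoff (K : ℝ) (m : ℕ) (y : ℝ) : ℝ := max 0 (min 1 (1 - (m + 2) * (K - |y|) / K))

section Cutoff

variable {K : ℝ} {m : ℕ} {y : ℝ}

lemma continuous_cutoff (K : ℝ) (m : ℕ) : Continuous (cutoff K m) := by
  unfold cutoff; fun_prop

lemma cutoff_nonneg (K : ℝ) (m : ℕ) (y : ℝ) : 0 ≤ cutoff K m y := le_max_left _ _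

lemma cutoff_le_one (K : ℝ) (m : ℕ) (y : ℝ) : cutoff K m y ≤ 1 :=
  max_le zero_le_one (min_le_left _ _)

lemma cutoff_eq_one (hK : 0 < K) (h : K ≤ |y|) : cutoff K m y = 1 := by
  have : ((m : ℝ) + 2) * (K - |y|) / K ≤ 0 :=
    div_nonpos_of_nonpos_of_nonneg
      (mul_nonpos_of_nonneg_of_nonpos (by positivity) (by linarith)) hK.le
  rw [cutoff, min_eq_left (by linarith), max_eq_right zero_le_one]

lemma cutoff_eq_zero (hK : 0 < K) (h : K ≤ (m + 2) * (K - |y|)) : cutoff K m y = 0 := by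
  have : 1 ≤ ((m : ℝ) + 2) * (K - |y|) / K := by rwa [le_div_iff₀ hK, one_mul]
  rw [cutoff, max_eq_left ((min_le_right _ _).trans (by linarith))]

lemma cutoff_eq_zero_of_lt_half (hK : 0 < K) (h : |y| < K / 2) : cutoff K m y = 0 := by
  refine cutoff_eq_zero hK ?_
  have : (0 : ℝ) ≤ m := m.cast_nonneg
  nlinarith

lemma eventually_cutoff_eq_zero (hK : 0 < K) {K' : ℝ} (hK' : K' < K) :
    ∀ᶠ m : ℕ in atTop, ∀ y, |y| ≤ K' → cutoff K m y = 0 := by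
  have h := (tendsto_natCast_atTop_atTop (R := ℝ)).atTop_mul_const (sub_pos.2 hK')
  filter_upwards [h.eventually_ge_atTop K] with m hm y hy
  refine cutoff_eq_zero hK ?_
  have : (0 : ℝ) ≤ m := m.cast_nonneg
  nlinarith

lemma tendsto_cutoff (hK : 0 < K) (y : ℝ) :
    Tendsto (fun m => cutoff K m y) atTop (𝓝 ((bigJumps K).indicator (fun _ => 1) y)) := by
  by_cases hy : K ≤ |y|
  · have : y ∈ bigJumps K := by
      rcases le_abs.1 hy with h | h
      · exact Or.inr h
      · exact Or.inl (by simp only [Set.mem_Iic]; linarith)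
    simp [this, cutoff_eq_one hK hy]
  · have : y ∉ bigJumps K := by
      rintro (h | h)
      · exact hy ((le_neg.1 h).trans (neg_le_abs y))
      · exact hy (le_trans h (le_abs_self y))
    rw [Set.indicator_of_notMem this]
    refine tendsto_const_nhds.congr' ?_
    filter_upwards [eventually_cutoff_eq_zero hK (not_le.1 hy)] with m hm using (hm y le_rfl).symm

end Cutoff

lemma measurableSet_bigJumps (K : ℝ) : MeasurableSet (bigJumps K) :=
  measurableSet_Iic.union measurableSet_Ici

/-- The rate of big jumps from the small time behaviour of a Lévy process. -/
lemma IsPureJumpLevyProcess.tendsto_integral_cutoff_div {Ω : Type*} [MeasurableSpace Ω]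
    {P : Measure Ω} [IsProbabilityMeasure P] {ν : Measure ℝ} {z : ℝ≥0 → Ω → ℝ}
    (hz : IsPureJumpLevyProcess P ν z) (hν : IsLevyMeasure ν) {K : ℝ} (hK : 0 < K)
    (hγ : 0 < ν (bigJumps K)) {g : ℝ → ℝ} (hg : Continuous g) {C : ℝ} (hC : ∀ y, |g y| ≤ C) :
    Tendsto (fun p : ℕ × ℕ => (∫ ω, cutoff K p.1 (z (gridStep p.2) ω) *
      g (z (gridStep p.2) ω) ∂P) / gridStep p.2) (atTop.curry atTop)
      (𝓝 (∫ y in bigJumps K, g y ∂ν)) := by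
  have hC0 : 0 ≤ C := (abs_nonneg _).trans (hC 0)
  have hle : ∀ m y, |cutoff K m y * g y| ≤ C := fun m y => by
    rw [abs_mul, abs_of_nonneg (cutoff_nonneg _ _ _)]
    calc _ ≤ 1 * C := by
          gcongr
          · exact cutoff_le_one _ _ _
          · exact hC y
      _ = C := one_mul C
  refine tendsto_curry_of_tendsto (v := fun m => ∫ y, cutoff K m y * g y ∂ν)
    (u := fun m n => (∫ ω, cutoff K m (z (gridStep n) ω) * g (z (gridStep n) ω) ∂P) / gridStep n)
    (fun m => ?_) ?_
  · have hcont : Continuous fun y => cutoff K m y * g y := (continuous_cutoff K m).mul hg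
    have hmap : ∀ n, IsProbabilityMeasure (P.map (z (gridStep n))) := fun n =>
      Measure.isProbabilityMeasure_map (hz.measurable _).aemeasurable
    have := hν.tendsto_integral_div hK hγ (μ := fun n => P.map (z (gridStep n)))
      (t := fun n => (gridStep n : ℝ)) (fun n => gridStep_pos n)
      (by simpa using NNReal.tendsto_coe.2 (tendsto_nhds_of_tendsto_nhdsWithin tendsto_gridStep))
      (fun n ξ => ?_) hcont (hle m) (half_pos hK)
      (fun y hy => by rw [cutoff_eq_zero_of_lt_half hK hy, zero_mul])
    · refine this.congr fun n => ?_
      rw [integral_map (hz.measurable _).aemeasurable hcont.aestronglyMeasurable]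
    · rw [charFun_apply_real, integral_map (hz.measurable _).aemeasurable
        (by fun_prop : Continuous _).aestronglyMeasurable, ← hz.char_eq]
      congr 1 with ω
      ring_nf
  · rw [← integral_indicator (measurableSet_bigJumps K)]
    -- Every cutoff vanishes below `K / 2`, a region whose complement has finite `ν`-measure.
    refine tendsto_integral_of_dominated_convergence
      ((bigJumps (K / 2)).indicator fun _ => C)
      (fun m => ((continuous_cutoff K m).mul hg).aestronglyMeasurable) ?_ (fun m => ?_) ?_
    · rw [integrable_indicator_iff (measurableSet_bigJumps _)]
      exact integrableOn_const (hν.bigJumps_lt_top (half_pos hK)).ne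
    · refine Eventually.of_forall fun y => ?_
      by_cases hy : y ∈ bigJumps (K / 2)
      · rw [Set.indicator_of_mem hy]; exact hle m y
      · rw [Set.indicator_of_notMem hy, cutoff_eq_zero_of_lt_half hK]
        · simp
        · by_contra hcon
          apply hy
          rcases le_abs.1 (not_lt.1 hcon) with h | h
          · exact Or.inr h
          · exact Or.inl (by simp only [Set.mem_Iic]; linarith)
    · refine Eventually.of_forall fun y => ?_
      have := (tendsto_cutoff hK y).mul_const (g y)
      convert this using 2
      by_cases hy : y ∈ bigJumps K <;> simp [hy]

/-! ### Pathwise convergence of grid sums to the first big jump. -/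

open Classical in
/-- A functional evaluated at the first big jump if it happens before time `T + R`. -/
def firstJumpTerm (T : ℝ≥0) (K : ℝ) (R : ℝ≥0) (G : Plane → ℝ) (g : ℝ → ℝ)
    (h : (ℝ≥0 → ℝ) → ℝ) (Y : ℝ≥0 → Plane) (f : ℝ≥0 → ℝ) : ℝ :=
  if (bigJumpTimes T K f).Nonempty ∧ firstBigJump T K f ≤ T + R then
    G (Function.leftLim Y (firstBigJump T K f)) * g (jump f (firstBigJump T K f)) *
      h (shiftPath (firstBigJump T K f) f)
  else 0

/-- No index before `J` is selected, so `J` has weight `φ (ξ J)` and all other indices together at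
most `1 - φ (ξ J)`. The missing weight at `J` and the rest each contribute an error of at most `C *
(1 - φ (ξ J))`. -/
lemma abs_sum_survival_mul_sub_le {φ : ℝ → ℝ} (h0 : ∀ y, 0 ≤ φ y) (h1 : ∀ y, φ y ≤ 1)
    {ξ c : ℕ → ℝ} {C : ℝ} (hC : ∀ j, |c j| ≤ C) {J N : ℕ} (hJN : J < N)
    (hJ : ∀ i < J, φ (ξ i) = 0) :
    |(∑ j ∈ Finset.range N, survival φ ξ j * φ (ξ j) * c j) - c J| ≤
      2 * C * (1 - φ (ξ J)) := by
  have hC0 : 0 ≤ C := (abs_nonneg _).trans (hC 0)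
  have hmem : J ∈ Finset.range N := Finset.mem_range.2 hJN
  have hsJ : survival φ ξ J = 1 :=
    Finset.prod_eq_one fun i hi => by rw [hJ i (Finset.mem_range.1 hi), sub_zero]
  have hw : ∀ j, 0 ≤ survival φ ξ j * φ (ξ j) := fun j =>
    mul_nonneg (survival_nonneg h1 ξ j) (h0 _)
  have htot := sum_survival_mul φ ξ N
  rw [← Finset.add_sum_erase _ _ hmem, hsJ, one_mul] at htot
  rw [← Finset.add_sum_erase _ _ hmem, hsJ, one_mul]
  have hrest : |∑ j ∈ (Finset.range N).erase J, survival φ ξ j * φ (ξ j) * c j| ≤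
      C * (1 - φ (ξ J)) := by
    calc _ ≤ ∑ j ∈ (Finset.range N).erase J, C * (survival φ ξ j * φ (ξ j)) := by
          refine (Finset.abs_sum_le_sum_abs _ _).trans (Finset.sum_le_sum fun j _ => ?_)
          rw [abs_mul, abs_of_nonneg (hw j), mul_comm]
          exact mul_le_mul_of_nonneg_right (hC j) (hw j)
      _ = C * (∑ j ∈ (Finset.range N).erase J, survival φ ξ j * φ (ξ j)) := by
          rw [Finset.mul_sum]
      _ ≤ _ := by
          refine mul_le_mul_of_nonneg_left ?_ hC0
          linarith [survival_nonneg h1 ξ N]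
  have hself : |(φ (ξ J) - 1) * c J| ≤ C * (1 - φ (ξ J)) := by
    rw [abs_mul, abs_sub_comm, abs_of_nonneg (sub_nonneg.2 (h1 _)), mul_comm]
    exact mul_le_mul_of_nonneg_right (hC J) (sub_nonneg.2 (h1 _))
  calc _ = |(φ (ξ J) - 1) * c J +
        ∑ j ∈ (Finset.range N).erase J, survival φ ξ j * φ (ξ j) * c j| := by
        congr 1; ring
    _ ≤ _ := (abs_add_le _ _).trans (by linarith)

section Pathwise

variable {f : ℝ≥0 → ℝ} {T : ℝ≥0} {K : ℝ}

/-- Without big jumps, short increments stay below some `K' < K`. The cutoff index is chosen from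
`K'` and then the mesh is made fine, which dictates the order of the two limits. -/
lemma IsCadlag.eventually_cutoff_gridIncrement_eq_zero (hf : IsCadlag f) (hK : 0 < K)
    {I : Set ℝ≥0} {b : ℝ≥0} (hI : I ⊆ Set.Iic b)
    (h : ∀ s, (∃ p ∈ I, ∃ q ∈ I, p < s ∧ s ≤ q) → |jump f s| < K) :
    ∀ᶠ m in atTop, ∀ᶠ n in atTop, ∀ i : ℕ, T + i * gridStep n ∈ I →
      T + (i + 1 : ℕ) * gridStep n ∈ I →
      cutoff K m (gridIncrement T (gridStep n) f i) = 0 := by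
  obtain ⟨K', hK', δ, hδ, hosc⟩ := hf.exists_oscillation_lt hK hI h
  filter_upwards [eventually_cutoff_eq_zero hK hK'] with m hm
  have h0 : Tendsto (fun n => (gridStep n : ℝ)) atTop (𝓝 0) := by
    simpa using NNReal.tendsto_coe.2 (tendsto_nhds_of_tendsto_nhdsWithin tendsto_gridStep)
  filter_upwards [(tendsto_order.1 h0).2 δ hδ] with n hn i hi hi'
  refine hm _ (hosc _ hi _ hi' ?_ ?_)
  · gcongr; omega
  · push_cast
    linarith

lemma natCast_mul_gridStep (r n : ℕ) : ((r * (n + 1) : ℕ) : ℝ≥0) * gridStep n = r := by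
  unfold gridStep
  push_cast
  field_simp

/-- Before the grid interval containing the first big jump every cutoff vanishes; on that interval
the increment tends to the jump and its cutoff to `1`. If no big jump occurs up to `T + r`, all
terms vanish. -/
lemma IsCadlag.tendsto_gridSum {Y : ℝ≥0 → Plane} (hY : IsCadlag Y) (hf : IsCadlag f)
    (hK : 0 < K) {G : Plane → ℝ} (hG : Continuous G) {g : ℝ → ℝ} (hg : Continuous g)
    {h : (ℝ≥0 → ℝ) → ℝ} (hh : Continuous h) {CG Cg Ch : ℝ}
    (hCG : ∀ v, |G v| ≤ CG) (hCg : ∀ y, |g y| ≤ Cg) (hCh : ∀ f, |h f| ≤ Ch) (r : ℕ) :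
    ∀ᶠ m in atTop, Tendsto (fun n => gridSum (cutoff K m) T (gridStep n) (r * (n + 1)) G g h Y f)
      atTop (𝓝 (firstJumpTerm T K r G g h Y f)) := by
  by_cases hcase : (bigJumpTimes T K f).Nonempty ∧ firstBigJump T K f ≤ T + r
  · rw [firstJumpTerm, if_pos hcase]
    obtain ⟨hne, hσr⟩ := hcase
    have hσ := hf.firstBigJump_mem hK hne
    set σ := firstBigJump T K f with hσdef
    have hTσ : T < σ := hσ.1
    have hpos : 0 < σ - T := tsub_pos_of_lt hTσ
    have hadd : T + (σ - T) = σ := add_tsub_cancel_of_le hTσ.le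
    -- The grid interval `(T + J n * gridStep n, T + (J n + 1) * gridStep n]` contains `σ`.
    set J : ℕ → ℕ := fun n => gridIndex (σ - T) n - 1 with hJdef
    have hJ1 : ∀ n, J n + 1 = gridIndex (σ - T) n := fun n =>
      Nat.sub_add_cancel (Nat.ceil_pos.2 (div_pos hpos (gridStep_pos n)))
    have hlt : ∀ n, T + (J n : ℝ≥0) * gridStep n < σ := fun n => by
      conv_rhs => rw [← hadd]
      exact add_lt_add_right (gridIndex_pred_mul_lt hpos n) T
    have hge : ∀ n, σ ≤ T + ((J n + 1 : ℕ) : ℝ≥0) * gridStep n := fun n => by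
      rw [hJ1]
      conv_lhs => rw [← hadd]
      exact add_le_add_right (le_gridIndex_mul (σ - T) n) T
    have ht1 : Tendsto (fun n => T + (J n : ℝ≥0) * gridStep n) atTop (𝓝 σ) := by
      have := (tendsto_gridIndex_pred_mul hpos).const_add T
      rwa [hadd] at this
    have ht2 : Tendsto (fun n => T + ((J n + 1 : ℕ) : ℝ≥0) * gridStep n) atTop (𝓝 σ) := by
      have := (tendsto_gridIndex_mul (σ - T)).const_add T
      simpa only [hadd, hJ1] using this
    have hξ : Tendsto (fun n => gridIncrement T (gridStep n) f (J n)) atTop (𝓝 (jump f σ)) :=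
      (hf.tendsto_right ht2 (Eventually.of_forall hge)).sub
        (hf.tendsto_left ht1 (Eventually.of_forall hlt))
    have hshift : Tendsto (fun n => DegenerateLevy.shiftPath
        (T + ((J n + 1 : ℕ) : ℝ≥0) * gridStep n) f) atTop
        (𝓝 (DegenerateLevy.shiftPath σ f)) := by
      refine tendsto_pi_nhds.2 fun u => ?_
      exact (hf.tendsto_right (ht2.add_const u)
        (Eventually.of_forall fun n => add_le_add_left (hge n) u)).sub
        (hf.tendsto_right ht2 (Eventually.of_forall hge))
    have hterm : Tendsto (fun n => G (Y (T + (J n : ℝ≥0) * gridStep n)) *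
        g (gridIncrement T (gridStep n) f (J n)) *
        h (DegenerateLevy.shiftPath (T + ((J n + 1 : ℕ) : ℝ≥0) * gridStep n) f)) atTop
        (𝓝 (G (Function.leftLim Y σ) * g (jump f σ) * h (DegenerateLevy.shiftPath σ f))) :=
      (((hG.tendsto _).comp (hY.tendsto_left ht1 (Eventually.of_forall hlt))).mul
        ((hg.tendsto _).comp hξ)).mul ((hh.tendsto _).comp hshift)
    -- The interval is open at `σ`, so that none of the increments considered crosses the jump.
    filter_upwards [hf.eventually_cutoff_gridIncrement_eq_zero (T := T) hK
      (I := Set.Ico T σ) (b := σ) (fun u hu => hu.2.le) fun s ⟨p, hp, q, hq, hps, hsq⟩ =>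
        not_le.1 fun hs => notMem_bigJumpTimes_of_lt_firstBigJump (T := T) (K := K) (f := f)
          (hsq.trans_lt hq.2) ⟨hp.1.trans_lt hps, hs⟩] with m hm
    have hw : Tendsto (fun n => 2 * (CG * Cg * Ch) *
        (1 - cutoff K m (gridIncrement T (gridStep n) f (J n)))) atTop (𝓝 0) := by
      have := (((continuous_cutoff K m).tendsto _).comp hξ).const_sub 1 |>.const_mul
        (2 * (CG * Cg * Ch))
      rw [cutoff_eq_one hK hσ.2, sub_self, mul_zero] at this
      exact this
    refine hterm.congr_dist (squeeze_zero' (Eventually.of_forall fun n => dist_nonneg) ?_ hw)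
    filter_upwards [hm] with n hn
    rw [dist_comm, Real.dist_eq]
    have hJN : J n < r * (n + 1) := by
      have : (J n : ℝ≥0) * gridStep n < ((r * (n + 1) : ℕ) : ℝ≥0) * gridStep n := by
        rw [natCast_mul_gridStep]
        exact lt_of_add_lt_add_left ((hlt n).trans_le hσr)
      exact_mod_cast lt_of_mul_lt_mul_right this zero_le
    have hCG0 : 0 ≤ CG := (abs_nonneg _).trans (hCG 0)
    have hCg0 : 0 ≤ Cg := (abs_nonneg _).trans (hCg 0)
    have key := abs_sum_survival_mul_sub_le (cutoff_nonneg K m) (cutoff_le_one K m)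
      (ξ := gridIncrement T (gridStep n) f) (C := CG * Cg * Ch)
      (c := fun j => G (Y (T + (j : ℝ≥0) * gridStep n)) *
        g (gridIncrement T (gridStep n) f j) *
        h (DegenerateLevy.shiftPath (T + ((j + 1 : ℕ) : ℝ≥0) * gridStep n) f))
      (fun j => by
        rw [abs_mul, abs_mul]
        gcongr
        · exact hCG _
        · exact hCg _
        · exact hCh _) hJN
      (fun i hi => by
        have hi' : T + ((i + 1 : ℕ) : ℝ≥0) * gridStep n < σ := by
          refine lt_of_le_of_lt ?_ (hlt n)
          gcongr
          omega
        refine hn i ⟨le_self_add, lt_of_le_of_lt ?_ hi'⟩ ⟨le_self_add, hi'⟩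
        gcongr
        omega)
    refine le_trans (le_of_eq ?_) key
    congr 2
    refine Finset.sum_congr rfl fun j _ => ?_
    ring
  · rw [firstJumpTerm, if_neg hcase]
    filter_upwards [hf.eventually_cutoff_gridIncrement_eq_zero (T := T) hK
      (I := Set.Icc T (T + r)) (b := T + r) (fun u hu => hu.2)
      fun s ⟨p, hp, q, hq, hps, hsq⟩ => not_le.1 fun hs => by
        have hmem : s ∈ bigJumpTimes T K f := ⟨hp.1.trans_lt hps, hs⟩
        exact hcase ⟨⟨s, hmem⟩, (csInf_le (OrderBot.bddBelow _) hmem).trans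
          (hsq.trans hq.2)⟩] with m hm
    refine tendsto_const_nhds.congr' ?_
    filter_upwards [hm] with n hn
    refine (Finset.sum_eq_zero fun j hj => ?_).symm
    have hj' : j + 1 ≤ r * (n + 1) := Finset.mem_range.1 hj
    have hle : T + ((j + 1 : ℕ) : ℝ≥0) * gridStep n ≤ T + r := by
      rw [← natCast_mul_gridStep r n]
      gcongr
    rw [hn j ⟨le_self_add, le_trans ?_ hle⟩ ⟨le_self_add, hle⟩]
    · simp
    · gcongr
      omega

end Pathwise

/-! ### Existence of the first big jump and factorization there. -/

section FirstBigJump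

variable {Ω : Type*} [MeasurableSpace Ω] {P : Measure Ω} [IsProbabilityMeasure P]
  {ν : Measure ℝ} {z : ℝ≥0 → Ω → ℝ}
  {b : Plane → Plane} {L : ℝ≥0} {x : Plane} {Y : ℝ≥0 → Ω → Plane} {K : ℝ} {T : ℝ≥0}

lemma tendsto_integral_gridSum (hz : IsPureJumpLevyProcess P ν z) (hK : 0 < K)
    (hYm : ∀ t, Measurable (Y t))
    (hY : ∀ᵐ ω ∂P, IsDriven b x (fun t => z t ω) fun t => Y t ω)
    {G : Plane → ℝ} (hG : Continuous G) {g : ℝ → ℝ} (hg : Continuous g)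
    {h : (ℝ≥0 → ℝ) → ℝ} (hh : Continuous h) (hhm : Measurable h) {CG Cg Ch : ℝ}
    (hCG : ∀ v, |G v| ≤ CG) (hCg : ∀ y, |g y| ≤ Cg) (hCh : ∀ f, |h f| ≤ Ch) (r : ℕ) :
    AEMeasurable (fun ω => firstJumpTerm T K r G g h (fun t => Y t ω) fun t => z t ω) P ∧
      (∀ᵐ ω ∂P, |firstJumpTerm T K r G g h (fun t => Y t ω) fun t => z t ω| ≤ CG * Cg * Ch) ∧
      Tendsto (fun p : ℕ × ℕ => ∫ ω, gridSum (cutoff K p.1) T (gridStep p.2) (r * (p.2 + 1)) G g h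
        (fun t => Y t ω) (fun t => z t ω) ∂P) (atTop.curry atTop)
        (𝓝 (∫ ω, firstJumpTerm T K r G g h (fun t => Y t ω) (fun t => z t ω) ∂P)) := by
  refine tendsto_integral_curry (a := fun m n ω => gridSum (cutoff K m) T (gridStep n)
    (r * (n + 1)) G g h (fun t => Y t ω) fun t => z t ω)
    (fun m n => measurable_gridSum hz hYm (continuous_cutoff K m).measurable T _ _ hG.measurable
      hg.measurable hhm)
    (fun m n ω => abs_gridSum_le (cutoff_nonneg K m) (cutoff_le_one K m) hCG hCg hCh _ _) ?_
  filter_upwards [hY, hz.cadlag] with ω hYω hzω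
  exact hYω.cadlag.tendsto_gridSum hzω hK hG hg hh hCG hCg hCh r

/-- The limit of `integral_gridSum_mul` divided by the mesh: the mean of the cutoff over the mesh
tends to `ν (bigJumps K)`. -/
lemma integral_firstJumpTerm_mul (hz : IsPureJumpLevyProcess P ν z) (hν : IsLevyMeasure ν)
    (hK : 0 < K) (hγ : 0 < ν (bigJumps K)) (hT : 0 < T) (hb : LipschitzWith L b)
    (hYm : ∀ t, Measurable (Y t))
    (hY : ∀ᵐ ω ∂P, IsDriven b x (fun t => z t ω) fun t => Y t ω)
    {G : Plane → ℝ} (hG : Continuous G) {g : ℝ → ℝ} (hg : Continuous g)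
    {h : (ℝ≥0 → ℝ) → ℝ} (hh : Continuous h) (hhm : Measurable h) {CG Cg Ch : ℝ}
    (hCG : ∀ v, |G v| ≤ CG) (hCg : ∀ y, |g y| ≤ Cg) (hCh : ∀ f, |h f| ≤ Ch) (r : ℕ) :
    (∫ ω, firstJumpTerm T K r G g h (fun t => Y t ω) (fun t => z t ω) ∂P) *
        ν.real (bigJumps K) =
      (∫ ω, firstJumpTerm T K r G (fun _ => 1) (fun _ => 1) (fun t => Y t ω)
        (fun t => z t ω) ∂P) *
        ((∫ y in bigJumps K, g y ∂ν) * ∫ ω, h (fun t => z t ω) ∂P) := by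
  have h1 := (tendsto_integral_gridSum (T := T) hz hK hYm hY hG hg hh hhm hCG hCg hCh r).2.2
  have h2 := (tendsto_integral_gridSum (T := T) hz hK hYm hY hG (g := fun _ => 1)
    continuous_const (h := fun _ => 1) continuous_const measurable_const hCG (Cg := 1)
    (fun _ => by simp) (Ch := 1) (fun _ => by simp) r).2.2
  have h3 := hz.tendsto_integral_cutoff_div hν hK hγ (g := fun _ => 1) continuous_const (C := 1)
    (fun _ => by simp)
  have h4 := hz.tendsto_integral_cutoff_div hν hK hγ hg hCg
  simp only [mul_one, integral_const, smul_eq_mul, measureReal_restrict_apply_univ] at h3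
  refine tendsto_nhds_unique (h1.mul h3)
    ((h2.mul (h4.mul_const (∫ ω, h (fun t => z t ω) ∂P))).congr fun p => ?_)
  have key := integral_gridSum_mul hz hb hYm hY (continuous_cutoff K p.1).measurable
    (cutoff_nonneg K p.1) (cutoff_le_one K p.1) hT (gridStep p.2) (r * (p.2 + 1)) hG.measurable
    hg.measurable hhm hCG hCg hCh
  rw [mul_div_assoc', key]
  ring

/-- A Lévy process almost surely has a big jump after any given time. -/
lemma ae_bigJumpTimes_nonempty (hz : IsPureJumpLevyProcess P ν z) (hν : IsLevyMeasure ν)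
    (hK : 0 < K) (hγ : 0 < ν (bigJumps K)) (hT : 0 < T) (hb : LipschitzWith L b)
    (hYm : ∀ t, Measurable (Y t))
    (hY : ∀ᵐ ω ∂P, IsDriven b x (fun t => z t ω) fun t => Y t ω) :
    ∀ᵐ ω ∂P, (bigJumpTimes T K fun t => z t ω).Nonempty := by
  classical
  have hγ' : 0 < ν.real (bigJumps K) :=
    ENNReal.toReal_pos hγ.ne' (hν.bigJumps_lt_top hK).ne
  set e : ℕ → Ω → ℝ := fun r ω => firstJumpTerm T K r (fun _ => 1) (fun _ => 1) (fun _ => 1)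
    (fun t => Y t ω) fun t => z t ω with he
  have hlim := fun r : ℕ => tendsto_integral_gridSum (T := T) hz hK hYm hY (G := fun _ => 1)
    continuous_const (g := fun _ => 1)
    continuous_const (h := fun _ => 1) continuous_const measurable_const (CG := 1)
    (fun _ => by simp) (Cg := 1) (fun _ => by simp) (Ch := 1) (fun _ => by simp) r
  have h3 := hz.tendsto_integral_cutoff_div hν hK hγ (g := fun _ => 1) continuous_const (C := 1)
    (fun _ => by simp)
  simp only [mul_one, integral_const, smul_eq_mul, measureReal_restrict_apply_univ] at h3
  -- There are `r * (n + 1) = r / gridStep n` grid steps, so their number times the mean of the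
  -- cutoff tends to `r * ν (bigJumps K)`.
  have hge : ∀ r : ℕ, 1 - Real.exp (-(r * ν.real (bigJumps K))) ≤ ∫ ω, e r ω ∂P := by
    intro r
    refine le_of_tendsto_of_tendsto' (((h3.const_mul (r : ℝ)).neg.rexp).const_sub 1)
      (hlim r).2.2 fun p => ?_
    refine le_trans (le_of_eq ?_) (one_sub_exp_le_integral_gridSum hz hb hY
      (continuous_cutoff K p.1).measurable (cutoff_nonneg K p.1) (cutoff_le_one K p.1) hT
      (gridStep p.2) (r * (p.2 + 1)))
    congr 3
    rw [gridStep]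
    push_cast
    field_simp
  set e0 : Ω → ℝ := fun ω => if (bigJumpTimes T K fun t => z t ω).Nonempty then 1 else 0 with he0
  have hpt : ∀ ω, Tendsto (fun r => e r ω) atTop (𝓝 (e0 ω)) := by
    intro ω
    refine tendsto_const_nhds.congr' ?_
    obtain ⟨n, hn⟩ := exists_nat_ge (firstBigJump T K fun t => z t ω)
    filter_upwards [eventually_ge_atTop n] with r hr
    have : firstBigJump T K (fun t => z t ω) ≤ T + (r : ℝ≥0) :=
      hn.trans ((Nat.cast_le.2 hr).trans le_add_self)
    simp [he, he0, firstJumpTerm, this]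
  have hmeas : AEMeasurable e0 P :=
    aemeasurable_of_tendsto_metrizable_ae atTop (fun r => (hlim r).1) (Eventually.of_forall hpt)
  have hint : Integrable e0 P := by
    refine Integrable.of_bound hmeas.aestronglyMeasurable 1 (Eventually.of_forall fun ω => ?_)
    simp only [he0]
    split_ifs <;> simp
  have hconv : Tendsto (fun r => ∫ ω, e r ω ∂P) atTop (𝓝 (∫ ω, e0 ω ∂P)) :=
    tendsto_integral_of_dominated_convergence (fun _ => 1)
      (fun r => (hlim r).1.aestronglyMeasurable) (integrable_const _)
      (fun r => by simpa using (hlim r).2.1) (Eventually.of_forall hpt)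
  -- Letting `r → ∞`, the probability of a big jump exceeds every `1 - exp (-r γ)`, with `γ = ν
  -- (bigJumps K) > 0`.
  have hone : 1 ≤ ∫ ω, e0 ω ∂P := by
    refine le_of_tendsto_of_tendsto' ?_ hconv hge
    have : Tendsto (fun r : ℕ => (r : ℝ) * ν.real (bigJumps K)) atTop atTop :=
      (tendsto_natCast_atTop_atTop (R := ℝ)).atTop_mul_const hγ'
    simpa using (Real.tendsto_exp_neg_atTop_nhds_zero.comp this).const_sub 1
  have hnn : 0 ≤ fun ω => 1 - e0 ω := fun ω => by
    simp only [he0, Pi.zero_apply]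
    split_ifs <;> simp
  have hz0 : ∫ ω, (1 - e0 ω) ∂P = 0 := by
    refine le_antisymm ?_ (integral_nonneg hnn)
    rw [integral_sub (integrable_const _) hint]
    simpa using hone
  have hae := (integral_eq_zero_iff_of_nonneg hnn ((integrable_const _).sub hint)).1 hz0
  filter_upwards [hae] with ω hω
  by_contra hcon
  simp [he0, hcon] at hω

/-- The position before the first big jump, the jump, and the noise after the jump are independent,
and the latter two are distributed as a big jump and as the noise. -/
lemma integral_preValue_mul_jumpValue_mul_postPath (hz : IsPureJumpLevyProcess P ν z)
    (hν : IsLevyMeasure ν) (hK : 0 < K) (hγ : 0 < ν (bigJumps K)) (hT : 0 < T)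
    (hb : LipschitzWith L b) (hYm : ∀ t, Measurable (Y t))
    (hY : ∀ᵐ ω ∂P, IsDriven b x (fun t => z t ω) fun t => Y t ω)
    {G : Plane → ℝ} (hG : Continuous G) {g : ℝ → ℝ} (hg : Continuous g)
    {h : (ℝ≥0 → ℝ) → ℝ} (hh : Continuous h) (hhm : Measurable h) {CG Cg Ch : ℝ}
    (hCG : ∀ v, |G v| ≤ CG) (hCg : ∀ y, |g y| ≤ Cg) (hCh : ∀ f, |h f| ≤ Ch) :
    ∫ ω, G (preValue b T K x fun t => z t ω) * g (jumpValue T K fun t => z t ω) *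
      h (postPath T K fun t => z t ω) ∂P =
    (∫ ω, G (preValue b T K x fun t => z t ω) ∂P) * ((∫ y, g y ∂(bigJumpLaw ν K)) *
      ∫ ω, h (fun t => z t ω) ∂P) := by
  have hγ' : 0 < ν.real (bigJumps K) :=
    ENNReal.toReal_pos hγ.ne' (hν.bigJumps_lt_top hK).ne
  have hconv : ∀ {g : ℝ → ℝ} (_ : Continuous g) {h : (ℝ≥0 → ℝ) → ℝ} (_ : Continuous h)
      (_ : Measurable h) {Cg Ch : ℝ} (_ : ∀ y, |g y| ≤ Cg) (_ : ∀ f, |h f| ≤ Ch),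
      Tendsto (fun r : ℕ => ∫ ω, firstJumpTerm T K r G g h (fun t => Y t ω)
        (fun t => z t ω) ∂P) atTop
        (𝓝 (∫ ω, G (preValue b T K x fun t => z t ω) * g (jumpValue T K fun t => z t ω) *
          h (postPath T K fun t => z t ω) ∂P)) := by
    intro g hg h hh hhm Cg Ch hCg hCh
    have hlim := fun r : ℕ =>
      tendsto_integral_gridSum (T := T) hz hK hYm hY hG hg hh hhm hCG hCg hCh r
    refine tendsto_integral_of_dominated_convergence (fun _ => CG * Cg * Ch)
      (fun r => (hlim r).1.aestronglyMeasurable) (integrable_const _)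
      (fun r => (hlim r).2.1) ?_
    filter_upwards [hY, hz.cadlag, hz.zero,
      ae_bigJumpTimes_nonempty hz hν hK hγ hT hb hYm hY] with ω hYω hzω hz0 hne
    rw [hYω.preValue_eq hb hzω hz0 hK hne, hzω.jumpValue_eq hK hne, hzω.postPath_eq hK hne]
    refine tendsto_const_nhds.congr' ?_
    obtain ⟨n, hn⟩ := exists_nat_ge (firstBigJump T K fun t => z t ω)
    filter_upwards [eventually_ge_atTop n] with r hr
    have : firstBigJump T K (fun t => z t ω) ≤ T + (r : ℝ≥0) :=
      hn.trans ((Nat.cast_le.2 hr).trans le_add_self)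
    rw [firstJumpTerm, if_pos ⟨hne, this⟩]
  have h1 := hconv hg hh hhm hCg hCh
  have h2 := hconv (g := fun _ => 1) continuous_const (h := fun _ => 1) continuous_const
    measurable_const (Cg := 1) (Ch := 1) (fun _ => by simp) (fun _ => by simp)
  simp only [mul_one] at h2
  -- The horizon `r` is sent to infinity on both sides; the choice `g = h = 1` identifies the first
  -- factor as the mean of `G` at the pre-jump position.
  have h3 := tendsto_nhds_unique (h1.mul_const (ν.real (bigJumps K)))
    ((h2.mul_const ((∫ y in bigJumps K, g y ∂ν) * ∫ ω, h (fun t => z t ω) ∂P)).congr fun r =>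
      (integral_firstJumpTerm_mul hz hν hK hγ hT hb hYm hY hG hg hh hhm hCG hCg hCh r).symm)
  have h4 : ∫ y, g y ∂(bigJumpLaw ν K) =
      (ν.real (bigJumps K))⁻¹ * ∫ y in bigJumps K, g y ∂ν := by
    rw [bigJumpLaw, integral_smul_measure, ENNReal.toReal_inv, smul_eq_mul]
    rfl
  rw [h4, ← mul_left_inj' hγ'.ne', h3]
  field_simp

end FirstBigJump

/-! ### Regeneration of the noise at the first big jump. -/

section Regeneration

variable {Ω : Type*} [MeasurableSpace Ω] {P : Measure Ω}
  {ν : Measure ℝ} {z : ℝ≥0 → Ω → ℝ}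
  {b : Plane → Plane} {L : ℝ≥0} {x : Plane} {Y : ℝ≥0 → Ω → Plane} {K : ℝ} {T : ℝ≥0}

lemma abs_boundedContinuousFunction_le {α : Type*} [TopologicalSpace α]
    (f : BoundedContinuousFunction α ℝ) (a : α) : |f a| ≤ ‖f‖ := f.norm_coe_le_norm a

lemma IsPureJumpLevyProcess.measurable_comp_path {β : Type*} [MeasurableSpace β]
    (hz : IsPureJumpLevyProcess P ν z) {u : Plane × (ℝ≥0 → ℝ) → β} (hu : Measurable u)
    (x : Plane) : Measurable fun ω => u (x, fun t => z t ω) :=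
  hu.comp (measurable_const.prodMk hz.measurable_path)

variable [IsProbabilityMeasure P]

/-- The big jump is independent of the position before it. -/
lemma map_preValue_jumpValue (hz : IsPureJumpLevyProcess P ν z)
    (hν : IsLevyMeasure ν) (hK : 0 < K) (hγ : 0 < ν (bigJumps K)) (hT : 0 < T)
    (hb : LipschitzWith L b) (hYm : ∀ t, Measurable (Y t))
    (hY : ∀ᵐ ω ∂P, IsDriven b x (fun t => z t ω) fun t => Y t ω) :
    P.map (fun ω => (preValue b T K x fun t => z t ω, jumpValue T K fun t => z t ω)) =
      (P.map fun ω => preValue b T K x fun t => z t ω).prod (bigJumpLaw ν K) := by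
  have := isProbabilityMeasure_bigJumpLaw hν hK hγ
  have hpre := hz.measurable_comp_path (measurable_preValue hb.continuous.measurable T K) x
  have hjump := (measurable_jumpValue T K).comp hz.measurable_path
  refine Measure.eq_prod_of_integral_mul_boundedContinuousFunction fun f g => ?_
  have key := integral_preValue_mul_jumpValue_mul_postPath hz hν hK hγ hT hb hYm hY f.continuous
    g.continuous (h := fun _ => 1) continuous_const measurable_const
    (abs_boundedContinuousFunction_le f) (abs_boundedContinuousFunction_le g) (Ch := 1)
    fun _ => by simp
  rw [integral_map, integral_map]
  · simpa using key
  · exact hpre.aemeasurable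
  · exact f.continuous.aestronglyMeasurable
  · exact (hpre.prodMk hjump).aemeasurable
  · exact ((f.continuous.comp continuous_fst).mul
      (g.continuous.comp continuous_snd)).aestronglyMeasurable

/-- The noise after the first big jump has the law of the noise. -/
lemma map_postPath (hz : IsPureJumpLevyProcess P ν z)
    (hν : IsLevyMeasure ν) (hK : 0 < K) (hγ : 0 < ν (bigJumps K)) (hT : 0 < T)
    (hb : LipschitzWith L b) (hYm : ∀ t, Measurable (Y t))
    (hY : ∀ᵐ ω ∂P, IsDriven b x (fun t => z t ω) fun t => Y t ω) :
    P.map (fun ω => postPath T K fun t => z t ω) = P.map fun ω t => z t ω := by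
  have := isProbabilityMeasure_bigJumpLaw hν hK hγ
  have hpost := (measurable_postPath T K).comp hz.measurable_path
  suffices hid : IdentDistrib (fun ω => postPath T K fun t => z t ω) (fun ω t => z t ω) P P from
    hid.map_eq
  -- Test functions of finitely many coordinates are both continuous and measurable on path space,
  -- as the factorization demands.
  refine (identDistrib_iff_forall_finset_identDistrib
    (X := fun u ω => postPath T K (fun t => z t ω) u) (Y := z)
    hpost.aemeasurable hz.measurable_path.aemeasurable).2 fun J => ?_
  have hJ1 : Measurable fun ω => J.restrict (postPath T K fun t => z t ω) :=
    (Finset.measurable_restrict J).comp hpost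
  have hJ2 : Measurable fun ω => J.restrict fun t => z t ω :=
    (Finset.measurable_restrict J).comp hz.measurable_path
  refine ⟨hJ1.aemeasurable, hJ2.aemeasurable, ?_⟩
  have := Measure.isProbabilityMeasure_map hJ1.aemeasurable (μ := P)
  have := Measure.isProbabilityMeasure_map hJ2.aemeasurable (μ := P)
  refine ext_of_forall_integral_eq_of_IsFiniteMeasure fun f => ?_
  have hfc : Continuous fun w : ℝ≥0 → ℝ => f (J.restrict w) :=
    f.continuous.comp (continuous_pi fun i => continuous_apply _)
  have key := integral_preValue_mul_jumpValue_mul_postPath hz hν hK hγ hT hb hYm hY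
    (G := fun _ => 1) continuous_const (g := fun _ => 1) continuous_const
    (h := fun w => f (J.restrict w)) hfc
    (f.continuous.measurable.comp (Finset.measurable_restrict J))
    (CG := 1) (fun _ => by simp) (Cg := 1) (fun _ => by simp)
    (fun w => abs_boundedContinuousFunction_le f _)
  rw [integral_map, integral_map]
  · simpa using key
  · exact hJ2.aemeasurable
  · exact f.continuous.aestronglyMeasurable
  · exact hJ1.aemeasurable
  · exact f.continuous.aestronglyMeasurable

/-- The noise after the first big jump is independent of the position at that time. -/
lemma indepFun_postValue_postPath (hz : IsPureJumpLevyProcess P ν z)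
    (hν : IsLevyMeasure ν) (hK : 0 < K) (hγ : 0 < ν (bigJumps K)) (hT : 0 < T)
    (hb : LipschitzWith L b) (hYm : ∀ t, Measurable (Y t))
    (hY : ∀ᵐ ω ∂P, IsDriven b x (fun t => z t ω) fun t => Y t ω) :
    IndepFun (fun ω => postValue b T K x fun t => z t ω)
      (fun ω => postPath T K fun t => z t ω) P := by
  have := isProbabilityMeasure_bigJumpLaw hν hK hγ
  have hpre := hz.measurable_comp_path (measurable_preValue hb.continuous.measurable T K) x
  have hjump := (measurable_jumpValue T K).comp hz.measurable_path
  have hpost := (measurable_postPath T K).comp hz.measurable_path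
  refine IndepFun.indepFun_process (Y := fun u ω => postPath T K (fun t => z t ω) u)
    (hz.measurable_comp_path (measurable_postValue hb.continuous.measurable T K) x)
    (fun u => (measurable_pi_apply u).comp hpost) fun J => ?_
  have hJ : Measurable fun ω (i : J) => postPath T K (fun t => z t ω) i :=
    measurable_pi_lambda _ fun i => (measurable_pi_apply _).comp hpost
  -- The jump is embedded in the plane so that it forms one family with the pre-jump position; the
  -- sum of the two entries is `postValue`.
  have hind : IndepFun (fun ω (i : Fin 2) =>
      (![fun ω => preValue b T K x fun t => z t ω,
        fun ω => !₂[jumpValue T K fun t => z t ω, 0]] i : Ω → Plane) ω)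
      (fun ω (i : J) => postPath T K (fun t => z t ω) i) P := by
    refine pi_indepFun_of_prod_bcf (fun i => ?_) hJ.aemeasurable fun f g => ?_
    · fin_cases i
      · exact hpre.aemeasurable
      · exact (measurable_planeVec hjump measurable_const).aemeasurable
    · have hfc : Continuous fun y : ℝ => f 1 (!₂[y, 0] : Plane) := by
        refine (f 1).continuous.comp ((PiLp.continuous_toLp 2 (fun _ : Fin 2 => ℝ)).comp ?_)
        refine continuous_pi fun i => ?_
        fin_cases i
        · exact continuous_id
        · exact continuous_const
      have hgc : Continuous fun w : ℝ≥0 → ℝ => g fun i : J => w i :=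
        g.continuous.comp (continuous_pi fun i => continuous_apply _)
      have hgm : Measurable fun w : ℝ≥0 → ℝ => g fun i : J => w i :=
        g.continuous.measurable.comp (measurable_pi_lambda _ fun i => measurable_pi_apply _)
      have k1 := integral_preValue_mul_jumpValue_mul_postPath hz hν hK hγ hT hb hYm hY
        (f 0).continuous (g := fun y : ℝ => f 1 (!₂[y, 0] : Plane)) hfc hgc hgm
        (abs_boundedContinuousFunction_le (f 0))
        (fun y => abs_boundedContinuousFunction_le (f 1) _)
        fun w => abs_boundedContinuousFunction_le g _
      have k2 := integral_preValue_mul_jumpValue_mul_postPath hz hν hK hγ hT hb hYm hY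
        (f 0).continuous (g := fun y : ℝ => f 1 (!₂[y, 0] : Plane)) hfc
        (h := fun _ => 1) continuous_const measurable_const
        (abs_boundedContinuousFunction_le (f 0))
        (fun y => abs_boundedContinuousFunction_le (f 1) _) (Ch := 1) fun _ => by simp
      have k3 : ∫ ω, (g fun i : J => z i ω) ∂P =
          ∫ ω, (g fun i : J => postPath T K (fun t => z t ω) i) ∂P := by
        have := integral_preValue_mul_jumpValue_mul_postPath hz hν hK hγ hT hb hYm hY
          (G := fun _ => 1) continuous_const (g := fun _ => 1) continuous_const hgc hgm
          (CG := 1) (fun _ => by simp) (Cg := 1) (fun _ => by simp)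
          (fun w => abs_boundedContinuousFunction_le g _)
        simpa using this.symm
      simp only [mul_one, integral_const, probReal_univ, smul_eq_mul] at k2
      simp only [Fin.prod_univ_two, Pi.mul_apply, Function.comp, Matrix.cons_val_zero,
        Matrix.cons_val_one]
      rw [k1, k2, k3]
      ring
  have hcomp := hind.comp (φ := fun v : Fin 2 → Plane => v 0 + v 1)
    (Measurable.fun_add (measurable_pi_apply 0) (measurable_pi_apply 1)) measurable_id
  exact hcomp

end Regeneration

/-! ### Markov chains: uniqueness in law, images, random maps. -/

section MarkovChains

variable {Ω Ω' E W : Type*} [MeasurableSpace Ω] [MeasurableSpace Ω'] [MeasurableSpace E]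
  [MeasurableSpace W]

/-- The last entry of a finite history. -/
def lastEntry (k : ℕ) (h : Finset.Iic k → E) : E := h ⟨k, Finset.mem_Iic.2 le_rfl⟩

lemma measurable_lastEntry (k : ℕ) : Measurable (lastEntry (E := E) k) := measurable_pi_apply _

/-- Appending an entry to a finite history. -/
def appendEntry (k : ℕ) (p : (Finset.Iic k → E) × E) (i : Finset.Iic (k + 1)) : E :=
  if h : (i : ℕ) ≤ k then p.1 ⟨i, Finset.mem_Iic.2 h⟩ else p.2

lemma measurable_appendEntry (k : ℕ) : Measurable (appendEntry (E := E) k) := by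
  refine measurable_pi_lambda _ fun i => ?_
  by_cases h : (i : ℕ) ≤ k
  · simp only [appendEntry, h, dite_true]
    exact (measurable_pi_apply _).comp measurable_fst
  · simp only [appendEntry, h, dite_false]
    exact measurable_snd

lemma appendEntry_history {E : Type*} (k : ℕ) (u : ℕ → E) :
    appendEntry k (fun i : Finset.Iic k => u i, u (k + 1)) =
      fun i : Finset.Iic (k + 1) => u i := by
  funext i
  by_cases h : (i : ℕ) ≤ k
  · simp [appendEntry, h]
  · have : (i : ℕ) = k + 1 := by have := Finset.mem_Iic.1 i.2; omega
    simp [appendEntry, this]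

/-- Markov chains with equal initial laws and equal transition kernels have equal laws. -/
lemma identDistrib_of_hasCondDistrib {P : Measure Ω} {P' : Measure Ω'} [IsFiniteMeasure P]
    [IsFiniteMeasure P']
    {U : ℕ → Ω → E} {U' : ℕ → Ω' → E} (hU : ∀ k, Measurable (U k)) (hU' : ∀ k, Measurable (U' k))
    {κ : ∀ k : ℕ, Kernel (Finset.Iic k → E) E} (h0 : P.map (U 0) = P'.map (U' 0))
    (h : ∀ k, HasCondDistrib (U (k + 1)) (fun ω (i : Finset.Iic k) => U i ω) (κ k) P)
    (h' : ∀ k, HasCondDistrib (U' (k + 1)) (fun ω (i : Finset.Iic k) => U' i ω) (κ k) P') :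
    IdentDistrib (fun ω k => U k ω) (fun ω k => U' k ω) P P' := by
  have hm : ∀ k : ℕ, Measurable fun ω (i : Finset.Iic k) => U i ω := fun k =>
    measurable_pi_lambda _ fun i => hU i
  have hm' : ∀ k : ℕ, Measurable fun ω (i : Finset.Iic k) => U' i ω := fun k =>
    measurable_pi_lambda _ fun i => hU' i
  have hist : ∀ k : ℕ, P.map (fun ω (i : Finset.Iic k) => U i ω) =
      P'.map fun ω (i : Finset.Iic k) => U' i ω := by
    intro k
    induction k with
    | zero =>
      have hc : Measurable fun (e : E) (_ : Finset.Iic 0) => e :=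
        measurable_pi_lambda _ fun _ => measurable_id
      have e1 : ∀ u : ℕ → E, (fun i : Finset.Iic 0 => u i) = fun _ => u 0 := fun u => by
        funext i
        have : (i : ℕ) = 0 := Nat.le_zero.1 (Finset.mem_Iic.1 i.2)
        rw [this]
      rw [show (fun ω (i : Finset.Iic 0) => U i ω) = fun ω _ => U 0 ω from
        funext fun ω => e1 fun k => U k ω,
        show (fun ω (i : Finset.Iic 0) => U' i ω) = fun ω _ => U' 0 ω from
        funext fun ω => e1 fun k => U' k ω]
      have := congrArg (Measure.map fun (e : E) (_ : Finset.Iic 0) => e) h0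
      rwa [Measure.map_map hc (hU 0), Measure.map_map hc (hU' 0)] at this
    | succ k ih =>
      have e := (h k).map_eq
      rw [ih, ← (h' k).map_eq] at e
      have := congrArg (Measure.map (appendEntry k)) e
      rw [Measure.map_map (measurable_appendEntry k) ((hm k).prodMk (hU _)),
        Measure.map_map (measurable_appendEntry k) ((hm' k).prodMk (hU' _))] at this
      simpa only [Function.comp_def, fun ω => appendEntry_history k fun k => U k ω,
        fun ω => appendEntry_history k fun k => U' k ω] using this
  have hUa := (measurable_pi_lambda (fun ω k => U k ω) hU).aemeasurable (μ := P)
  have hUa' := (measurable_pi_lambda (fun ω k => U' k ω) hU').aemeasurable (μ := P')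
  refine ⟨hUa, hUa', ?_⟩
  have hlim := isProjectiveLimit_map hUa
  suffices hJ : ∀ J : Finset ℕ, P.map (fun ω => J.restrict fun k => U k ω) =
      P'.map (fun ω => J.restrict fun k => U' k ω) by
    simp_rw [hJ] at hlim
    exact hlim.unique (isProjectiveLimit_map hUa')
  intro J
  have hle : ∀ j : J, (j : ℕ) ∈ Finset.Iic (J.sup id) := fun j =>
    Finset.mem_Iic.2 (Finset.le_sup (f := id) j.2)
  have hr : Measurable fun (w : Finset.Iic (J.sup id) → E) (j : J) => w ⟨j, hle j⟩ :=
    measurable_pi_lambda _ fun j => measurable_pi_apply _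
  have := congrArg (Measure.map fun (w : Finset.Iic (J.sup id) → E) (j : J) => w ⟨j, hle j⟩)
    (hist (J.sup id))
  rwa [Measure.map_map hr (hm _), Measure.map_map hr (hm' _)] at this

/-- The image of a Markov chain under a map compatible with the transition kernels. -/
lemma IsMarkovChain.hasCondDistrib_comp {F : Type*} [MeasurableSpace F] {P : Measure Ω}
    [SFinite P] {κ : Kernel E E} [IsSFiniteKernel κ] {S : ℕ → Ω → E} (hS : IsMarkovChain P κ S)
    {f : E → F} (hf : Measurable f) {η : Kernel F F} [IsSFiniteKernel η]
    (hη : ∀ a, (κ a).map f = η (f a)) (k : ℕ) :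
    HasCondDistrib (fun ω => f (S (k + 1) ω)) (fun ω (i : Finset.Iic k) => f (S i ω))
      (η.comap (lastEntry k) (measurable_lastEntry k)) P := by
  have hmap : Measurable fun (h : Finset.Iic k → E) (i : Finset.Iic k) => f (h i) :=
    measurable_pi_lambda _ fun i => hf.comp (measurable_pi_apply i)
  have h1 := (hS.markov k).comp_left hf
  -- The law of the next image depends on the history only through its image, so conditioning may be
  -- coarsened to the image history.
  have e : (κ.comap (fun h : Finset.Iic k → E => h ⟨k, Finset.mem_Iic.2 le_rfl⟩)
      (measurable_pi_apply _)).map f =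
      (η.comap (lastEntry k) (measurable_lastEntry k)).comap _ hmap := by
    ext1 h
    rw [Kernel.map_apply _ hf, Kernel.comap_apply, Kernel.comap_apply, Kernel.comap_apply, hη]
    rfl
  rw [e] at h1
  exact h1.comp_right

variable {Φ : E × W → E × W} {Λ : Measure W} [IsProbabilityMeasure Λ] {κ : Kernel E E}
  [IsMarkovKernel κ]

lemma measurable_iterate_mk (hΦ : Measurable Φ) (x : E) (k : ℕ) :
    Measurable fun w => Φ^[k] (x, w) :=
  (hΦ.iterate k).comp (measurable_const.prodMk measurable_id)

/-- Conditionally on the past, a random map regenerates its noise. -/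
lemma hasCondDistrib_iterate_prod (hΦ : Measurable Φ)
    (hκ : ∀ x, Λ.map (fun w => Φ (x, w)) = (κ x).prod Λ) (x : E) (k : ℕ)
    (h : HasCondDistrib (fun w => (Φ^[k] (x, w)).2)
      (fun w (i : Finset.Iic k) => (Φ^[i] (x, w)).1) (Kernel.const _ Λ) Λ) :
    HasCondDistrib (fun w => Φ^[k + 1] (x, w)) (fun w (i : Finset.Iic k) => (Φ^[i] (x, w)).1)
      (κ.comap (lastEntry k) (measurable_lastEntry k) ×ₖ Kernel.const _ Λ) Λ := by
  have hm := measurable_iterate_mk hΦ x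
  have hhist : Measurable fun w (i : Finset.Iic k) => (Φ^[i] (x, w)).1 :=
    measurable_pi_lambda _ fun i => (hm _).fst
  have hΨ : Measurable fun p : (Finset.Iic k → E) × W => Φ (lastEntry k p.1, p.2) :=
    hΦ.comp (((measurable_lastEntry k).comp measurable_fst).prodMk measurable_snd)
  refine ⟨(hhist.prodMk (hm _)).aemeasurable, ?_⟩
  have e : (fun w => (fun i : Finset.Iic k => (Φ^[i] (x, w)).1, Φ^[k + 1] (x, w))) =
      (fun p : (Finset.Iic k → E) × W => (p.1, Φ (lastEntry k p.1, p.2))) ∘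
        fun w => (fun i : Finset.Iic k => (Φ^[i] (x, w)).1, (Φ^[k] (x, w)).2) := by
    funext w
    simp only [Function.comp, lastEntry, Function.iterate_succ', Prod.mk.eta]
  rw [e, ← Measure.map_map (measurable_fst.prodMk hΨ) (hhist.prodMk (hm k).snd), h.map_eq]
  ext s hs
  rw [Measure.map_apply (measurable_fst.prodMk hΨ) hs,
    Measure.compProd_apply ((measurable_fst.prodMk hΨ) hs), Measure.compProd_apply hs]
  refine lintegral_congr fun a => ?_
  have hΨa : Measurable fun w => Φ (lastEntry k a, w) := hΨ.comp measurable_prodMk_left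
  rw [Kernel.const_apply, Kernel.prod_apply, Kernel.comap_apply, Kernel.const_apply, ← hκ,
    Measure.map_apply hΨa (measurable_prodMk_left hs)]
  rfl

/-- After `k` steps the remaining noise has law `Λ` and is independent of all positions so far. By
induction: given the past, one more step yields a new position and, independently of it, fresh
noise. -/
lemma hasCondDistrib_iterate_snd (hΦ : Measurable Φ)
    (hκ : ∀ x, Λ.map (fun w => Φ (x, w)) = (κ x).prod Λ) (x : E) (k : ℕ) :
    HasCondDistrib (fun w => (Φ^[k] (x, w)).2)
      (fun w (i : Finset.Iic k) => (Φ^[i] (x, w)).1) (Kernel.const _ Λ) Λ := by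
  have hm := measurable_iterate_mk hΦ x
  induction k with
  | zero =>
    have hc : ∀ w, (fun i : Finset.Iic 0 => (Φ^[i] (x, w)).1) = fun _ => x := fun w => by
      funext i
      have : (i : ℕ) = 0 := Nat.le_zero.1 (Finset.mem_Iic.1 i.2)
      rw [this]
      rfl
    rw [show (fun w (i : Finset.Iic 0) => (Φ^[i] (x, w)).1) = fun _ _ => x from funext hc]
    refine ⟨(measurable_const.prodMk measurable_id).aemeasurable, ?_⟩
    rw [Measure.compProd_const, Measure.map_const, measure_univ, one_smul, Measure.dirac_prod]
    rfl
  | succ k ih =>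
    have h1 := hasCondDistrib_iterate_prod hΦ hκ x k ih
    -- Rewriting the product as a composition-product allows the new position to join the
    -- conditioning history.
    have e : κ.comap (lastEntry k) (measurable_lastEntry k) ×ₖ Kernel.const _ Λ =
        κ.comap (lastEntry k) (measurable_lastEntry k) ⊗ₖ
          Kernel.const ((Finset.Iic k → E) × E) Λ := by
      ext a s hs
      rw [Kernel.prod_apply, Kernel.compProd_apply hs, Measure.prod_apply hs]
      rfl
    rw [e] at h1
    have h2 : HasCondDistrib (fun w => (Φ^[k + 1] (x, w)).2)
        (fun w => ((fun i : Finset.Iic k => (Φ^[i] (x, w)).1), (Φ^[k + 1] (x, w)).1))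
        (Kernel.const _ Λ) Λ := HasCondDistrib.of_compProd h1
    have h3 : HasCondDistrib (fun w => (Φ^[k + 1] (x, w)).2)
        (fun w => ((fun i : Finset.Iic k => (Φ^[i] (x, w)).1), (Φ^[k + 1] (x, w)).1))
        ((Kernel.const (Finset.Iic (k + 1) → E) Λ).comap (appendEntry k)
          (measurable_appendEntry k)) Λ := h2
    have h4 := h3.comp_right
    have e2 : (fun w (i : Finset.Iic (k + 1)) => (Φ^[i] (x, w)).1) =
        appendEntry k ∘ fun w => ((fun i : Finset.Iic k => (Φ^[i] (x, w)).1),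
          (Φ^[k + 1] (x, w)).1) := by
      funext w
      exact (appendEntry_history k fun i => (Φ^[i] (x, w)).1).symm
    rwa [e2]

lemma hasCondDistrib_iterate_fst (hΦ : Measurable Φ)
    (hκ : ∀ x, Λ.map (fun w => Φ (x, w)) = (κ x).prod Λ) (x : E) (k : ℕ) :
    HasCondDistrib (fun w => (Φ^[k + 1] (x, w)).1)
      (fun w (i : Finset.Iic k) => (Φ^[i] (x, w)).1)
      (κ.comap (lastEntry k) (measurable_lastEntry k)) Λ := by
  have h1 := (hasCondDistrib_iterate_prod hΦ hκ x k
    (hasCondDistrib_iterate_snd hΦ hκ x k)).fst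
  rwa [Kernel.fst_prod] at h1

/-- Transfers almost sure properties of the original noise to the noise after each sampling time. -/
lemma map_iterate_snd (hΦ : Measurable Φ)
    (hκ : ∀ x, Λ.map (fun w => Φ (x, w)) = (κ x).prod Λ) (x : E) (k : ℕ) :
    Λ.map (fun w => (Φ^[k] (x, w)).2) = Λ :=
  (hasCondDistrib_iterate_snd hΦ hκ x k).hasLaw_of_const.map_eq

end MarkovChains

/-! ### Realising the chains for all initial states on one space. -/

section Construction

variable {E : Type*} [MeasurableSpace E]

/-- The law of the Markov chain with transition kernel `κ` started at `a`. -/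
def chainLaw (κ : Kernel E E) [IsMarkovKernel κ] (a : E) : Measure (ℕ → E) :=
  Kernel.trajMeasure (X := fun _ => E) (Measure.dirac a)
    fun k => κ.comap (lastEntry k) (measurable_lastEntry k)

instance isProbabilityMeasure_chainLaw (κ : Kernel E E) [IsMarkovKernel κ] (a : E) :
    IsProbabilityMeasure (chainLaw κ a) := by
  unfold chainLaw; infer_instance

lemma map_eval_zero_chainLaw (κ : Kernel E E) [IsMarkovKernel κ] (a : E) :
    (chainLaw κ a).map (fun u => u 0) = Measure.dirac a := by
  have h1 : (chainLaw κ a).map (Preorder.frestrictLe (π := fun _ => E) 0) =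
      (Measure.dirac a).map (MeasurableEquiv.piUnique _).symm := by
    rw [chainLaw, Kernel.trajMeasure, Measure.map_comp _ _ (by fun_prop),
      Kernel.traj_map_frestrictLe, Kernel.partialTraj_self, Measure.id_comp]
  have h2 := congrArg (Measure.map fun h : Finset.Iic 0 → E => h ⟨0, by simp⟩) h1
  rw [Measure.map_map (measurable_pi_apply _) (by fun_prop),
    Measure.map_map (measurable_pi_apply _) (by fun_prop)] at h2
  refine h2.trans ?_
  have : (fun h : Finset.Iic 0 → E => h ⟨0, by simp⟩) ∘
      (MeasurableEquiv.piUnique (fun _ : Finset.Iic 0 => E)).symm = id := by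
    funext e
    rfl
  exact (congrArg (fun f => (Measure.dirac a).map f) this).trans Measure.map_id

lemma hasCondDistrib_chainLaw (κ : Kernel E E) [IsMarkovKernel κ] (a : E) (k : ℕ) :
    HasCondDistrib (fun u : ℕ → E => u (k + 1)) (fun u (i : Finset.Iic k) => u i)
      (κ.comap (lastEntry k) (measurable_lastEntry k)) (chainLaw κ a) := by
  refine ⟨by fun_prop, ?_⟩
  exact (Kernel.map_frestrictLe_trajMeasure_compProd_eq_map_trajMeasure
    (X := fun _ => E) (a := k)).symm

lemma hasCondDistrib_comp_measurePreserving {Ω Ω' A B : Type*} [MeasurableSpace Ω]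
    [MeasurableSpace Ω'] [MeasurableSpace A] [MeasurableSpace B] {P : Measure Ω} {P' : Measure Ω'} {g : Ω' → Ω}
    (hg : MeasurePreserving g P' P) {V : Ω → A} {U : Ω → B} (hU : Measurable U)
    (hV : Measurable V) {κ : Kernel A B} (h : HasCondDistrib U V κ P) :
    HasCondDistrib (fun ω => U (g ω)) (fun ω => V (g ω)) κ P' := by
  refine ⟨((hV.prodMk hU).comp hg.measurable).aemeasurable, ?_⟩
  have e1 : P'.map (fun ω => V (g ω)) = P.map V := by
    rw [← hg.map_eq, Measure.map_map hV hg.measurable]; rfl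
  rw [e1, ← h.map_eq, ← hg.map_eq, Measure.map_map (hV.prodMk hU) hg.measurable]
  rfl

/-- All Markov chains with a given transition kernel live on one probability space. -/
lemma exists_isMarkovChain {E : Type} [MeasurableSpace E] (κ : Kernel E E) [IsMarkovKernel κ] :
    ∃ (Ω' : Type) (_ : MeasurableSpace Ω') (P' : Measure Ω') (_ : IsProbabilityMeasure P')
      (S : E → ℕ → Ω' → E), ∀ a, IsMarkovChain P' κ (S a) ∧ P'.map (S a 0) = Measure.dirac a := by
  -- Independent copies of the trajectory laws, one factor for each initial state.
  refine ⟨E → ℕ → E, inferInstance, Measure.infinitePi fun a => chainLaw κ a, inferInstance,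
    fun a k ω => ω a k, fun a => ?_⟩
  have hg := measurePreserving_eval_infinitePi (fun a => chainLaw κ a) a
  refine ⟨⟨fun k => (measurable_pi_apply k).comp (measurable_pi_apply a), fun k => ?_⟩, ?_⟩
  · exact hasCondDistrib_comp_measurePreserving hg (measurable_pi_apply _)
      (measurable_pi_lambda _ fun i => measurable_pi_apply _) (hasCondDistrib_chainLaw κ a k)
  · have h0 := map_eval_zero_chainLaw κ a
    have h1 := Measure.map_map (μ := Measure.infinitePi fun a => chainLaw κ a)
      (measurable_pi_apply (X := fun _ : ℕ => E) 0) hg.measurable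
    rw [hg.map_eq] at h1
    exact h1.symm.trans h0

end Construction

/-! ### Random-map kernels and the coupled jump. -/

section Kernels

variable {α β γ : Type*} [MeasurableSpace α] [MeasurableSpace β] [MeasurableSpace γ]

/-- The transition kernel of the random map `u (·, w)`, where `w` has the law `Λ`. -/
def randomMapKernel (u : α × β → γ) (Λ : Measure β) : Kernel α γ :=
  (Kernel.id ×ₖ Kernel.const α Λ).map u

lemma randomMapKernel_apply {u : α × β → γ} (hu : Measurable u) (Λ : Measure β) [SFinite Λ]
    (a : α) : randomMapKernel u Λ a = Λ.map fun w => u (a, w) := by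
  rw [randomMapKernel, Kernel.map_apply _ hu, Kernel.prod_apply, Kernel.id_apply,
    Kernel.const_apply, Measure.dirac_prod, Measure.map_map hu measurable_prodMk_left]
  rfl

lemma isMarkovKernel_randomMapKernel {u : α × β → γ} (hu : Measurable u) (Λ : Measure β)
    [IsProbabilityMeasure Λ] : IsMarkovKernel (randomMapKernel u Λ) :=
  Kernel.IsMarkovKernel.map _ hu

end Kernels

section CoupledJump

lemma IsMaximalCouplingKernel.isMarkovKernel {ρ : Measure ℝ} [IsProbabilityMeasure ρ]
    {Q : Kernel (ℝ × ℝ) (ℝ × ℝ)} (hQ : IsMaximalCouplingKernel ρ Q) : IsMarkovKernel Q := by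
  refine ⟨fun p => ?_⟩
  have h := (hQ p.1 p.2).fst
  have h1 : IsProbabilityMeasure (ρ.map fun η => p.1 + η) :=
    Measure.isProbabilityMeasure_map (by fun_prop)
  rw [← h] at h1
  exact Measure.isProbabilityMeasure_of_map Prod.fst

lemma measurable_coupledJump : Measurable fun q : (Plane × Plane) × (ℝ × ℝ) =>
    ((!₂[q.2.1, q.1.1 1] : Plane), (!₂[q.2.2, q.1.2 1] : Plane)) :=
  (measurable_planeVec (by fun_prop) (by fun_prop)).prodMk
    (measurable_planeVec (by fun_prop) (by fun_prop))

/-- The coupled jump as a transition kernel. -/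
def coupledJumpKernel (Q : Kernel (ℝ × ℝ) (ℝ × ℝ)) : Kernel (Plane × Plane) (Plane × Plane) :=
  (Kernel.id ×ₖ Q.comap (fun p : Plane × Plane => (p.1 0, p.2 0)) (by fun_prop)).map
    fun q => ((!₂[q.2.1, q.1.1 1] : Plane), (!₂[q.2.2, q.1.2 1] : Plane))

lemma coupledJumpKernel_apply (Q : Kernel (ℝ × ℝ) (ℝ × ℝ)) [IsMarkovKernel Q]
    (p : Plane × Plane) : coupledJumpKernel Q p = coupledJumpLaw Q p := by
  rw [coupledJumpKernel, Kernel.map_apply _ measurable_coupledJump, Kernel.prod_apply,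
    Kernel.id_apply, Kernel.comap_apply, Measure.dirac_prod,
    Measure.map_map measurable_coupledJump measurable_prodMk_left]
  rfl

lemma isMarkovKernel_coupledJumpKernel (Q : Kernel (ℝ × ℝ) (ℝ × ℝ)) [IsMarkovKernel Q] :
    IsMarkovKernel (coupledJumpKernel Q) :=
  Kernel.IsMarkovKernel.map _ measurable_coupledJump

lemma planeVec_add_eq (v : Plane) (y : ℝ) : (!₂[v 0 + y, v 1] : Plane) = v + !₂[y, 0] := by
  ext i; fin_cases i <;> simp

lemma measurable_planeVec_const (c : ℝ) : Measurable fun y : ℝ => (!₂[y, c] : Plane) :=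
  measurable_planeVec measurable_id measurable_const

/-- Comes from the first marginal of `Q`: replacing the first coordinate by one distributed as `p.1
0 + η` adds `(η, 0)` to the point. -/
lemma map_fst_coupledJumpLaw {ρ : Measure ℝ} {Q : Kernel (ℝ × ℝ) (ℝ × ℝ)}
    (hQ : IsMaximalCouplingKernel ρ Q) (p : Plane × Plane) :
    (coupledJumpLaw Q p).map Prod.fst = ρ.map fun y => p.1 + !₂[y, 0] := by
  have hm : Measurable fun u : ℝ × ℝ =>
      ((!₂[u.1, p.1 1] : Plane), (!₂[u.2, p.2 1] : Plane)) :=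
    measurable_coupledJump.comp (measurable_prodMk_left (x := p))
  rw [coupledJumpLaw, Measure.map_map measurable_fst hm]
  have h := congrArg (Measure.map fun y : ℝ => (!₂[y, p.1 1] : Plane)) (hQ (p.1 0) (p.2 0)).fst
  rw [Measure.map_map (measurable_planeVec_const _) measurable_fst,
    Measure.map_map (measurable_planeVec_const _) (by fun_prop)] at h
  simpa only [Function.comp_def, planeVec_add_eq] using h

lemma map_snd_coupledJumpLaw {ρ : Measure ℝ} {Q : Kernel (ℝ × ℝ) (ℝ × ℝ)}
    (hQ : IsMaximalCouplingKernel ρ Q) (p : Plane × Plane) :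
    (coupledJumpLaw Q p).map Prod.snd = ρ.map fun y => p.2 + !₂[y, 0] := by
  have hm : Measurable fun u : ℝ × ℝ =>
      ((!₂[u.1, p.1 1] : Plane), (!₂[u.2, p.2 1] : Plane)) :=
    measurable_coupledJump.comp (measurable_prodMk_left (x := p))
  rw [coupledJumpLaw, Measure.map_map measurable_snd hm]
  have h := congrArg (Measure.map fun y : ℝ => (!₂[y, p.2 1] : Plane)) (hQ (p.1 0) (p.2 0)).snd
  rw [Measure.map_map (measurable_planeVec_const _) measurable_snd,
    Measure.map_map (measurable_planeVec_const _) (by fun_prop)] at h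
  simpa only [Function.comp_def, planeVec_add_eq] using h

/-- A component of a coupled jump performs an independent jump. -/
lemma map_comp_coupledJumpKernel {ρ : Measure ℝ} [IsProbabilityMeasure ρ]
    {κ : Kernel (Plane × Plane) (Plane × Plane)} {μ : Measure (Plane × Plane)}
    {π : Plane × Plane → Plane} (hπ : Measurable π)
    (hκ : ∀ p, (κ p).map π = ρ.map fun y => π p + !₂[y, 0]) :
    (κ ∘ₘ μ).map π = ((μ.map π).prod ρ).map fun q => q.1 + !₂[q.2, 0] := by
  have hadd : Measurable fun q : Plane × ℝ => q.1 + (!₂[q.2, 0] : Plane) :=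
    measurable_fst.add (measurable_planeVec measurable_snd measurable_const)
  ext s hs
  rw [Measure.map_apply hπ hs, Measure.bind_apply (hπ hs) κ.aemeasurable,
    Measure.map_apply hadd hs, Measure.prod_apply (hadd hs),
    lintegral_map (measurable_measure_prodMk_left (hadd hs)) hπ]
  refine lintegral_congr fun p => ?_
  have hp : Measurable fun y : ℝ => π p + (!₂[y, 0] : Plane) := hadd.comp measurable_prodMk_left
  rw [← Measure.map_apply hπ hs, hκ, Measure.map_apply hp hs]
  rfl

end CoupledJump

/-! ### The sampled solution as a Markov chain. -/

section SampledChain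

/-- Position and noise at the first big jump, as functionals of initial position and noise. -/
def jumpMap (b : Plane → Plane) (T : ℝ≥0) (K : ℝ) (p : Plane × (ℝ≥0 → ℝ)) :
    Plane × (ℝ≥0 → ℝ) := (postValue b T K p.1 p.2, postPath T K p.2)

lemma measurable_jumpMap {b : Plane → Plane} (hb : Measurable b) (T : ℝ≥0) (K : ℝ) :
    Measurable (jumpMap b T K) :=
  (measurable_postValue hb T K).prodMk ((measurable_postPath T K).comp measurable_snd)

/-- Iterating the jump map samples a solution at the successive sampling times. -/
lemma IsDriven.iterate_jumpMap {b : Plane → Plane} {L : ℝ≥0} {x : Plane} {f : ℝ≥0 → ℝ}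
    {Y : ℝ≥0 → Plane} {T : ℝ≥0} {K : ℝ} (hY : IsDriven b x f Y) (hb : LipschitzWith L b)
    (hf : IsCadlag f) (hf0 : f 0 = 0) (hK : 0 < K)
    (hne : ∀ k, IsCadlag ((jumpMap b T K)^[k] (x, f)).2 →
      (bigJumpTimes T K ((jumpMap b T K)^[k] (x, f)).2).Nonempty) (k : ℕ) :
    (jumpMap b T K)^[k] (x, f) =
      (Y (samplingTime T K f k), shiftPath (samplingTime T K f k) f) := by
  induction k with
  | zero =>
    have : DegenerateLevy.shiftPath 0 f = f := by
      funext t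
      simp [DegenerateLevy.shiftPath, hf0]
    simp only [Function.iterate_zero, id, samplingTime, this, hY.init hf0]
  | succ k ih =>
    have hne' := hne k
    rw [ih] at hne'
    set s := samplingTime T K f k
    have hs := hf.shiftPath s
    have hn := hne' hs
    have hs0 : DegenerateLevy.shiftPath s f 0 = 0 := by simp [DegenerateLevy.shiftPath]
    rw [Function.iterate_succ_apply', ih, hf.samplingTime_succ T K k hn, jumpMap]
    simp only
    rw [(hY.shift hb.continuous s).postValue_eq hb hs hs0 hK hn, hs.postPath_eq hK hn,
      shiftPath_shiftPath]

variable {Ω : Type*} [MeasurableSpace Ω] {P : Measure Ω} [IsProbabilityMeasure P]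
  {ν : Measure ℝ} {z : ℝ≥0 → Ω → ℝ}
  {b : Plane → Plane} {L : ℝ≥0} {K : ℝ} {T : ℝ≥0} {X : Plane → ℝ≥0 → Ω → Plane}

lemma measurable_postValue_right {b : Plane → Plane} (hb : Measurable b) (T : ℝ≥0) (K : ℝ)
    (x : Plane) : Measurable (postValue b T K x) :=
  Measurable.of_uncurry_left (f := postValue b T K) (measurable_postValue hb T K)

/-- The positions of two solutions before the first big jump. -/
def preValuePair (b : Plane → Plane) (T : ℝ≥0) (K : ℝ) (q : (Plane × Plane) × (ℝ≥0 → ℝ)) :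
    Plane × Plane := (preValue b T K q.1.1 q.2, preValue b T K q.1.2 q.2)

lemma measurable_preValuePair {b : Plane → Plane} (hb : Measurable b) (T : ℝ≥0) (K : ℝ) :
    Measurable (preValuePair b T K) := by
  have h := measurable_preValue hb T K
  have h1 : Measurable fun q : (Plane × Plane) × (ℝ≥0 → ℝ) =>
      (fun p : Plane × (ℝ≥0 → ℝ) => preValue b T K p.1 p.2) (q.1.1, q.2) :=
    h.comp (measurable_fst.fst.prodMk measurable_snd)
  have h2 : Measurable fun q : (Plane × Plane) × (ℝ≥0 → ℝ) =>
      (fun p : Plane × (ℝ≥0 → ℝ) => preValue b T K p.1 p.2) (q.1.2, q.2) :=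
    h.comp (measurable_fst.snd.prodMk measurable_snd)
  exact h1.prodMk h2

/-- The noise regenerates at the first big jump. -/
lemma map_jumpMap (hz : IsPureJumpLevyProcess P ν z) (hν : IsLevyMeasure ν) (hK : 0 < K)
    (hγ : 0 < ν (bigJumps K)) (hT : 0 < T) (hb : LipschitzWith L b)
    (hXm : ∀ x t, Measurable (X x t))
    (hX : ∀ x, ∀ᵐ ω ∂P, IsDriven b x (fun t => z t ω) fun t => X x t ω) (x : Plane) :
    (P.map fun ω t => z t ω).map (fun w => jumpMap b T K (x, w)) =
      (randomMapKernel (fun p : Plane × (ℝ≥0 → ℝ) => postValue b T K p.1 p.2)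
        (P.map fun ω t => z t ω) x).prod (P.map fun ω t => z t ω) := by
  have hzm := hz.measurable_path
  have := Measure.isProbabilityMeasure_map hzm.aemeasurable (μ := P)
  have hpv := measurable_postValue hb.continuous.measurable T K
  have hind := indepFun_postValue_postPath hz hν hK hγ hT hb (hXm x) (hX x)
  have h1 := (indepFun_iff_map_prod_eq_prod_map_map
    (hz.measurable_comp_path hpv x).aemeasurable
    ((measurable_postPath T K).comp hzm).aemeasurable).1 hind
  have h2 := map_postPath hz hν hK hγ hT hb (hXm x) (hX x)
  have hpx := measurable_postValue_right hb.continuous.measurable T K x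
  have hjx : Measurable fun w => jumpMap b T K (x, w) :=
    hpx.prodMk (measurable_postPath T K)
  rw [randomMapKernel_apply hpv, Measure.map_map hjx hzm, Measure.map_map hpx hzm]
  rw [← h2]
  exact h1

/-- The sampled solution agrees almost surely with a Markov chain driven by the jump map. -/
lemma exists_markov_version (hz : IsPureJumpLevyProcess P ν z) (hν : IsLevyMeasure ν) (hK : 0 < K)
    (hγ : 0 < ν (bigJumps K)) (hT : 0 < T) (hb : LipschitzWith L b)
    (hXm : ∀ x t, Measurable (X x t))
    (hX : ∀ x, ∀ᵐ ω ∂P, IsDriven b x (fun t => z t ω) fun t => X x t ω) (x : Plane) :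
    ∃ U : ℕ → Ω → Plane, (∀ k, Measurable (U k)) ∧ (∀ ω, U 0 ω = x) ∧
      (∀ k, HasCondDistrib (U (k + 1)) (fun ω (i : Finset.Iic k) => U i ω)
        ((randomMapKernel (fun p : Plane × (ℝ≥0 → ℝ) => postValue b T K p.1 p.2)
          (P.map fun ω t => z t ω)).comap (lastEntry k) (measurable_lastEntry k)) P) ∧
      (fun ω k => U k ω) =ᵐ[P] fun ω k => X x (samplingTime T K (fun t => z t ω) k) ω := by
  have hzm := hz.measurable_path
  set Λ := P.map fun ω t => z t ω with hΛ
  have hΛp : IsProbabilityMeasure Λ := Measure.isProbabilityMeasure_map hzm.aemeasurable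
  have hpv := measurable_postValue hb.continuous.measurable T K
  have := isMarkovKernel_randomMapKernel hpv Λ
  have hΦ := measurable_jumpMap hb.continuous.measurable T K
  have hκ := map_jumpMap hz hν hK hγ hT hb hXm hX
  have hmp : MeasurePreserving (fun ω t => z t ω) P Λ := ⟨hzm, rfl⟩
  have hit := fun k => measurable_iterate_mk hΦ x k
  refine ⟨fun k ω => ((jumpMap b T K)^[k] (x, fun t => z t ω)).1,
    fun k => ((hit k).fst).comp hzm, fun ω => rfl, fun k => ?_, ?_⟩
  · exact hasCondDistrib_comp_measurePreserving hmp (hit (k + 1)).fst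
      (measurable_pi_lambda _ fun i : Finset.Iic k => (hit i).fst)
      (hasCondDistrib_iterate_fst hΦ hκ x k)
  -- A measurable set of paths that, among càdlàg paths, singles out those with a big jump after
  -- `T`. Measurability lets the almost sure statement pass to the path law `Λ`.
  · set good : Set (ℝ≥0 → ℝ) := ⋃ n : ℕ, denseOscillation T K n with hgood
    have hgm : MeasurableSet good :=
      MeasurableSet.iUnion fun n => measurableSet_denseOscillation T K n
    have hiff : ∀ {f : ℝ≥0 → ℝ}, IsCadlag f → (f ∈ good ↔ (bigJumpTimes T K f).Nonempty) := by
      intro f hf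
      simp only [hgood, Set.mem_iUnion, hf.mem_denseOscillation_iff hK]
      constructor
      · rintro ⟨_, s, hs, _⟩
        exact ⟨s, hs⟩
      · rintro ⟨s, hs⟩
        obtain ⟨n, hn⟩ := exists_nat_gt s
        exact ⟨n, s, hs, hn⟩
    have hΛgood : ∀ᵐ w ∂Λ, w ∈ good := by
      refine (ae_map_iff hzm.aemeasurable hgm).2 ?_
      filter_upwards [hz.cadlag, ae_bigJumpTimes_nonempty hz hν hK hγ hT hb (hXm x) (hX x)]
        with ω h1 h2
      exact (hiff h1).2 h2
    -- The noise after each iteration again has law `Λ`, so almost surely no iteration runs out of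
    -- big jumps.
    have hall : ∀ᵐ ω ∂P, ∀ k, ((jumpMap b T K)^[k] (x, fun t => z t ω)).2 ∈ good := by
      refine ae_all_iff.2 fun k => ?_
      have h1 : ∀ᵐ w ∂Λ, ((jumpMap b T K)^[k] (x, w)).2 ∈ good := by
        refine ae_of_ae_map (hit k).snd.aemeasurable ?_
        rwa [map_iterate_snd hΦ hκ x k]
      exact ae_of_ae_map hzm.aemeasurable h1
    filter_upwards [hall, hz.cadlag, hz.zero, hX x] with ω h1 h2 h3 h4
    funext k
    rw [h4.iterate_jumpMap hb h2 h3 hK fun k hk => (hiff hk).1 (h1 k)]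

end SampledChain

end

end DegenerateLevy

/-! ### The coupled chain. -/

open DegenerateLevy in
theorem proposition3p2 {Ω : Type*} [MeasurableSpace Ω] (P : Measure Ω) [IsProbabilityMeasure P]
    (lam1 lam2 : ℝ) (hlam1 : 0 < lam1) (hlam2 : 0 < lam2)
    (F : Plane → Plane) (hFlip : ∃ L : ℝ≥0, LipschitzWith L F) (hFbdd : ∃ C : ℝ, ∀ v, ‖F v‖ ≤ C)
    (ν : Measure ℝ) (hν : IsLevyMeasure ν)
    (z : ℝ≥0 → Ω → ℝ) (hz : IsPureJumpLevyProcess P ν z)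
    (K : ℝ) (hK : 0 < K) (hγ : 0 < ν (bigJumps K))
    (T : ℝ≥0) (hT : 0 < T)
    (X : Plane → ℝ≥0 → Ω → Plane) (hX : ∀ x, IsSolution P lam1 lam2 F z x (X x)) :
    (∃ Q : Kernel (ℝ × ℝ) (ℝ × ℝ), IsMaximalCouplingKernel (bigJumpLaw ν K) Q) ∧
    ∀ Q : Kernel (ℝ × ℝ) (ℝ × ℝ), IsMaximalCouplingKernel (bigJumpLaw ν K) Q →
      ∃ R : Kernel (Plane × Plane) (Plane × Plane), IsMarkovKernel R ∧
        (∀ (x y : Plane) (A : Set (Plane × Plane)), MeasurableSet A →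
          R (x, y) A = ∫⁻ p, coupledJumpLaw Q p A ∂(preJumpLaw P T K z X x y)) ∧
        ∃ (Ω' : Type) (_ : MeasurableSpace Ω') (P' : Measure Ω') (_ : IsProbabilityMeasure P')
          (S : Plane × Plane → ℕ → Ω' → Plane × Plane),
          ∀ x y : Plane,
            IsMarkovChain P' R (S (x, y)) ∧
            (∀ᵐ ω' ∂P', S (x, y) 0 ω' = (x, y)) ∧
            IdentDistrib (fun ω' (k : ℕ) => (S (x, y) k ω').1)
              (fun ω (k : ℕ) => X x (samplingTime T K (fun t => z t ω) k) ω) P' P ∧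
            IdentDistrib (fun ω' (k : ℕ) => (S (x, y) k ω').2)
              (fun ω (k : ℕ) => X y (samplingTime T K (fun t => z t ω) k) ω) P' P := by
  have hρ := isProbabilityMeasure_bigJumpLaw hν hK hγ
  refine ⟨exists_isMaximalCouplingKernel _, fun Q hQ => ?_⟩
  have hQm := hQ.isMarkovKernel
  obtain ⟨L, hb⟩ := exists_lipschitzWith_drift lam1 lam2 hFlip
  set b := drift lam1 lam2 F
  have hbm := hb.continuous.measurable
  have hXm : ∀ x t, Measurable (X x t) := fun x => (hX x).measurable
  have hdr : ∀ x, ∀ᵐ ω ∂P, IsDriven b x (fun t => z t ω) fun t => X x t ω := fun x => by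
    filter_upwards [(hX x).cadlag, (hX x).eqn] with ω h1 h2 using ⟨h1, h2⟩
  have hzm := hz.measurable_path
  set Λ := P.map fun ω t => z t ω with hΛ
  have hΛp : IsProbabilityMeasure Λ := Measure.isProbabilityMeasure_map hzm.aemeasurable
  have hpv := measurable_postValue hbm T K
  have hpr := measurable_preValue hbm T K
  have hpre := measurable_preValuePair hbm T K
  have := isMarkovKernel_randomMapKernel hpre Λ
  have := isMarkovKernel_coupledJumpKernel Q
  have := isMarkovKernel_randomMapKernel hpv Λ
  -- `η` is the one-step kernel of a single sampled solution; both marginals of `R` are shown to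
  -- equal it.
  set η := randomMapKernel (fun p : Plane × (ℝ≥0 → ℝ) => postValue b T K p.1 p.2) Λ with hη
  set R := coupledJumpKernel Q ∘ₖ randomMapKernel (preValuePair b T K) Λ with hR
  have hprelaw : ∀ p, randomMapKernel (preValuePair b T K) Λ p = P.map fun ω =>
      (preValue b T K p.1 fun t => z t ω, preValue b T K p.2 fun t => z t ω) := fun p => by
    have hpre' : Measurable fun w => preValuePair b T K (p, w) :=
      Measurable.of_uncurry_left (f := fun p w => preValuePair b T K (p, w)) hpre
    rw [randomMapKernel_apply hpre, hΛ, Measure.map_map hpre' hzm]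
    rfl
  have hprem : ∀ p : Plane × Plane, Measurable fun ω =>
      (preValue b T K p.1 fun t => z t ω, preValue b T K p.2 fun t => z t ω) := fun p =>
    (hz.measurable_comp_path hpr p.1).prodMk (hz.measurable_comp_path hpr p.2)
  -- Independence of the jump from the pre-jump position presents `η` as an independent jump added
  -- to that position, which is also the form of the marginals of `R`.
  have hηeq : ∀ x, η x = ((P.map fun ω => preValue b T K x fun t => z t ω).prod
      (bigJumpLaw ν K)).map fun q => q.1 + !₂[q.2, 0] := fun x => by
    have hadd : Measurable fun q : Plane × ℝ => q.1 + (!₂[q.2, 0] : Plane) :=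
      measurable_fst.add (measurable_planeVec measurable_snd measurable_const)
    have hpj : Measurable fun ω =>
        (preValue b T K x fun t => z t ω, jumpValue T K fun t => z t ω) :=
      (hz.measurable_comp_path hpr x).prodMk ((measurable_jumpValue T K).comp hzm)
    rw [← map_preValue_jumpValue hz hν hK hγ hT hb (hXm x) (hdr x), hη,
      randomMapKernel_apply hpv, hΛ, Measure.map_map hadd hpj,
      Measure.map_map (measurable_postValue_right hbm T K x) hzm]
    rfl
  have hfst : ∀ p, (R p).map Prod.fst = η p.1 := fun p => by
    rw [hR, Kernel.comp_apply, map_comp_coupledJumpKernel measurable_fst (fun q => by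
      rw [coupledJumpKernel_apply]; exact map_fst_coupledJumpLaw hQ q), hηeq, hprelaw,
      Measure.map_map measurable_fst (hprem p)]
    rfl
  have hsnd : ∀ p, (R p).map Prod.snd = η p.2 := fun p => by
    rw [hR, Kernel.comp_apply, map_comp_coupledJumpKernel measurable_snd (fun q => by
      rw [coupledJumpKernel_apply]; exact map_snd_coupledJumpLaw hQ q), hηeq, hprelaw,
      Measure.map_map measurable_snd (hprem p)]
    rfl
  refine ⟨R, inferInstance, fun x y A hA => ?_, ?_⟩
  · rw [hR, Kernel.comp_apply' _ _ _ hA, hprelaw]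
    simp only [coupledJumpKernel_apply]
    congr 1
    refine Measure.map_congr ?_
    filter_upwards [hdr x, hdr y, hz.cadlag, hz.zero,
      ae_bigJumpTimes_nonempty hz hν hK hγ hT hb (hXm x) (hdr x)] with ω h1 h2 h3 h4 h5
    rw [h1.preValue_eq hb h3 h4 hK h5, h2.preValue_eq hb h3 h4 hK h5, samplingTime_one]
  · obtain ⟨Ω', mΩ', P', hP', S, hS⟩ := exists_isMarkovChain R
    refine ⟨Ω', mΩ', P', hP', S, fun x y => ?_⟩
    obtain ⟨hchain, hinit⟩ := hS (x, y)
    have hinit' : ∀ᵐ ω' ∂P', S (x, y) 0 ω' = (x, y) := by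
      have : ∀ᵐ p ∂(P'.map (S (x, y) 0)), p = (x, y) := by
        rw [hinit]
        exact (ae_dirac_iff (measurableSet_singleton (x, y))).2 rfl
      exact ae_of_ae_map (hchain.measurable 0).aemeasurable this
    -- Both components are treated at once: the projected chain and the sampled solution are Markov
    -- with the same kernel `η` and the same start.
    have hcomp : ∀ (π : Plane × Plane → Plane), Measurable π →
        (∀ p, (R p).map π = η (π p)) →
        IdentDistrib (fun ω' (k : ℕ) => π (S (x, y) k ω'))
          (fun ω (k : ℕ) => X (π (x, y)) (samplingTime T K (fun t => z t ω) k) ω) P' P := by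
      intro π hπ hRπ
      obtain ⟨U, hUm, hU0, hU, hUX⟩ := exists_markov_version hz hν hK hγ hT hb hXm hdr (π (x, y))
      have h1 := identDistrib_of_hasCondDistrib (U := fun k ω' => π (S (x, y) k ω'))
        (fun k => hπ.comp (hchain.measurable k)) hUm (?_ : _ = P.map (U 0))
        (hchain.hasCondDistrib_comp hπ hRπ) hU
      · exact h1.trans (IdentDistrib.of_ae_eq (measurable_pi_lambda _ hUm).aemeasurable hUX)
      · have e1 : P'.map (fun ω' => π (S (x, y) 0 ω')) = P'.map fun _ => π (x, y) :=
          Measure.map_congr (hinit'.mono fun ω' h => congrArg π h)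
        rw [e1, funext hU0, Measure.map_const, Measure.map_const]
        simp
    exact ⟨hchain, hinit', hcomp Prod.fst measurable_fst hfst, hcomp Prod.snd measurable_snd hsnd⟩
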